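/- Let $\mathcal H=\ell^2(\mathbb N)$ be the Hilbert space of one bosonic mode, with Fock basis $(|n\rangle)_{n\in\mathbb N}$ and ladder operator $a|n\rangle=\sqrt n\,|n-1\rangle$. A state is a positive operator $\rho$ on $\mathcal H$ with trace $1$; its von Neumann entropy is $S(\rho)=-\operatorname{Tr}[\rho\ln\rho]\in[0,\infty]$. For $0\le\lambda\le1$ the quantum-limited attenuator is $$\Phi_\lambda(\rho)=\operatorname{Tr}_E\!\left[U_\lambda\,(\rho\otimes|0\rangle\langle0|_E)\,U_\lambda^\dagger\right],\qquad U_\lambda=\exp\!\left[\arccos\sqrt\lambda\,\left(a^\dagger e-e^\dagger a\right)\right],$$ where $E$ is a second mode with ladder operator $e$. Let $g(N)=(N+1)\ln(N+1)-N\ln N$ for $0\le N<\infty$ (with $0\ln0=0$) and $g(\infty)=\infty$; $g$ is a bijection of $[0,\infty]$ onto itself, with inverse $g^{-1}$. For $0\le N<\infty$ let $\omega_N=\sum_{n=0}^\infty\frac1{N+1}\left(\frac N{N+1}\right)^n|n\rangle\langle n|$ be the Gaussian thermal state. Theorem. Let $0\le\lambda\le1$. For every state $\rho$, $\Phi_\lambda(\rho)$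 is a state and $$S(\Phi_\lambda(\rho))\ \ge\ g\!\left(\lambda\,g^{-1}(S(\rho))\right)\qquad(\text{with } 0\cdot\infty=0).$$ Moreover Gaussian thermal input states minimize the output entropy among all input states with a given entropy: for every $0\le N<\infty$, $\omega_N$ is a state with $S(\omega_N)=g(N)$ and $$S(\Phi_\lambda(\omega_N))=g\!\left(\lambda\,g^{-1}(S(\omega_N))\right),$$ and hence $S(\Phi_\lambda(\omega_N))\le S(\Phi_\lambda(\rho))$ for every state $\rho$ with $S(\rho)=S(\omega_N)$. -/

import Mathlib

open scoped ENNReal lp InnerProductSpace Matrix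

/-! ### One mode and two modes -/

/-- The Hilbert space of one mode, in the Fock (number) representation. -/
abbrev Mode : Type := ℓ²(ℕ, ℂ)

/-- The Hilbert space of two modes `A` and `E`; the basis vector indexed by `(m, k)` is
`|m⟩_A ⊗ |k⟩_E`. -/
abbrev TwoModes : Type := ℓ²(ℕ × ℕ, ℂ)

/-- The Fock state `|n⟩`. -/
noncomputable def ket (n : ℕ) : Mode := lp.single 2 n (1 : ℂ)

/-- The two-mode Fock state `|m⟩_A ⊗ |k⟩_E`, with `p = (m, k)`. -/
noncomputable def ket2 (p : ℕ × ℕ) : TwoModes := lp.single 2 p (1 : ℂ)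

theorem inner_ket2 (p q : ℕ × ℕ) : ⟪ket2 p, ket2 q⟫_ℂ = if p = q then 1 else 0 := by
  unfold ket2
  rw [lp.inner_single_left]
  by_cases h : p = q
  · subst h; simp
  · simp [h, lp.single_apply]

theorem orthonormal_ket2 : Orthonormal ℂ ket2 :=
  orthonormal_iff_ite.2 inner_ket2

/-- The isometry `x ↦ x ⊗ |k⟩_E` from the mode `A` to the two modes. -/
noncomputable def tensorKet (k : ℕ) : Mode →ₗᵢ[ℂ] TwoModes :=
  ((orthonormal_ket2.comp (fun m : ℕ => (m, k))
    (fun _ _ h => congrArg Prod.fst h)).orthogonalFamily).linearIsometry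

theorem tensorKet_ket (k m : ℕ) : tensorKet k (ket m) = ket2 (m, k) := by
  unfold tensorKet ket
  rw [OrthogonalFamily.linearIsometry_apply_single]
  simp

/-! ### States and entropy -/

/-- A quantum state (density operator): a positive operator with trace one. -/
structure IsState (ρ : Mode →L[ℂ] Mode) : Prop where
  isPositive : ρ.IsPositive
  trace_eq_one : HasSum (fun n : ℕ => ⟪ket n, ρ (ket n)⟫_ℂ) 1

/-- The trace, in `[0, ∞]`, of a positive operator. -/
noncomputable def posTrace (T : Mode →L[ℂ] Mode) : ℝ≥0∞ :=
  ∑' n : ℕ, ENNReal.ofReal (⟪ket n, T (ket n)⟫_ℂ).re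

/-- The operator `-ρ ln ρ` on a Hilbert space, given by the continuous functional calculus
of self-adjoint operators. -/
noncomputable def entropyOperator {H : Type*} [NormedAddCommGroup H] [InnerProductSpace ℂ H]
    [CompleteSpace H] (ρ : H →L[ℂ] H) : H →L[ℂ] H :=
  cfc Real.negMulLog ρ

/-- The von Neumann entropy `S(ρ) = Tr (-ρ ln ρ)`, in `[0, ∞]`, of a state `ρ` (for which the
operator `-ρ ln ρ` is positive). -/
noncomputable def vonNeumannEntropy (ρ : Mode →L[ℂ] Mode) : ℝ≥0∞ :=
  posTrace (entropyOperator ρ)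

/-! ### The beam splitter -/

/-- The operator `a†e - e†a` (where `a`, `e` are the ladder operators of `A` and `E`) preserves the
total number of photons. This is its matrix on the sector with `N` photons, in the basis
`|j⟩_A ⊗ |N - j⟩_E`, `0 ≤ j ≤ N`:
`a†e |j, N - j⟩ = √((j + 1) (N - j)) |j + 1, N - j - 1⟩` and
`e†a |i + 1, N - i - 1⟩ = √((i + 1) (N - i)) |i, N - i⟩`. -/
noncomputable def mixingGenerator (N : ℕ) : Matrix (Fin (N + 1)) (Fin (N + 1)) ℂ :=
  Matrix.of fun i j =>
    if (i : ℕ) = j + 1 then ((Real.sqrt (((j : ℝ) + 1) * ((N : ℝ) - j)) : ℝ) : ℂ)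
    else if (j : ℕ) = i + 1 then -((Real.sqrt (((i : ℝ) + 1) * ((N : ℝ) - i)) : ℝ) : ℂ)
    else 0

/-- The matrix of `exp (θ (a†e - e†a))` on the sector with `N` photons. -/
noncomputable def mixingMatrix (θ : ℝ) (N : ℕ) : Matrix (Fin (N + 1)) (Fin (N + 1)) ℂ :=
  NormedSpace.exp ((θ : ℂ) • mixingGenerator N)

theorem mixingGenerator_conjTranspose (N : ℕ) : (mixingGenerator N)ᴴ = -mixingGenerator N := by
  ext i j
  simp only [mixingGenerator, Matrix.conjTranspose_apply, Matrix.of_apply, Matrix.neg_apply]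
  by_cases h1 : (j : ℕ) = i + 1
  · have h2 : ¬ (i : ℕ) = j + 1 := by omega
    rw [if_pos h1, if_neg h2, if_pos h1, neg_neg]
    exact Complex.conj_ofReal _
  · by_cases h2 : (i : ℕ) = j + 1
    · rw [if_neg h1, if_pos h2, if_pos h2, star_neg]
      exact congrArg Neg.neg (Complex.conj_ofReal _)
    · rw [if_neg h1, if_neg h2, if_neg h2, if_neg h1]
      simp

theorem mixingMatrix_unitary (θ : ℝ) (N : ℕ) :
    (mixingMatrix θ N)ᴴ * mixingMatrix θ N = 1 := by
  have h : (mixingMatrix θ N)ᴴ = (mixingMatrix θ N)⁻¹ := by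
    unfold mixingMatrix
    rw [← Matrix.exp_conjTranspose, ← Matrix.exp_neg, Matrix.conjTranspose_smul,
      mixingGenerator_conjTranspose]
    simp
  rw [h]
  refine Matrix.nonsing_inv_mul _ ?_
  rw [← Matrix.isUnit_iff_isUnit_det]
  exact Matrix.isUnit_exp _

/-- The vector `exp (θ (a†e - e†a)) |j⟩_A ⊗ |N - j⟩_E`. -/
noncomputable def mixedKet (θ : ℝ) (N : ℕ) (j : Fin (N + 1)) : TwoModes :=
  ∑ i : Fin (N + 1), mixingMatrix θ N i j • ket2 ((i : ℕ), N - i)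

theorem inner_mixedKet_same (θ : ℝ) (N : ℕ) (j j' : Fin (N + 1)) :
    ⟪mixedKet θ N j, mixedKet θ N j'⟫_ℂ = if j = j' then 1 else 0 := by
  have hk : ∀ i i' : Fin (N + 1), ⟪ket2 ((i : ℕ), N - i), ket2 ((i' : ℕ), N - i')⟫_ℂ
      = if i = i' then 1 else 0 := by
    intro i i'
    rw [inner_ket2]
    congr 1
    simp only [Prod.mk.injEq, eq_iff_iff]
    constructor
    · intro h; exact Fin.ext h.1
    · rintro rfl; simp
  have h := congrFun (congrFun (mixingMatrix_unitary θ N) j) j'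
  rw [Matrix.mul_apply, Matrix.one_apply] at h
  rw [← h]
  simp only [mixedKet, sum_inner, inner_sum, inner_smul_left, inner_smul_right, hk]
  simp [Matrix.conjTranspose_apply, mul_comm]

theorem inner_mixedKet_ne (θ : ℝ) {N N' : ℕ} (h : N ≠ N') (j : Fin (N + 1)) (j' : Fin (N' + 1)) :
    ⟪mixedKet θ N j, mixedKet θ N' j'⟫_ℂ = 0 := by
  unfold mixedKet
  rw [sum_inner]
  refine Finset.sum_eq_zero fun i _ => ?_
  rw [inner_sum]
  refine Finset.sum_eq_zero fun i' _ => ?_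
  have hne : ¬ (((i : ℕ), N - (i : ℕ)) = ((i' : ℕ), N' - (i' : ℕ))) := by
    simp only [Prod.mk.injEq]
    have := i.2
    have := i'.2
    omega
  rw [inner_smul_left, inner_smul_right, inner_ket2, if_neg hne, mul_zero, mul_zero]

/-- The image of `|m⟩_A ⊗ |k⟩_E`, with `p = (m, k)`, under `exp (θ (a†e - e†a))`. -/
noncomputable def beamSplitterKet (θ : ℝ) (p : ℕ × ℕ) : TwoModes :=
  mixedKet θ (p.1 + p.2) ⟨p.1, by omega⟩

theorem orthonormal_beamSplitterKet (θ : ℝ) : Orthonormal ℂ (beamSplitterKet θ) := by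
  rw [orthonormal_iff_ite]
  rintro ⟨m, k⟩ ⟨m', k'⟩
  unfold beamSplitterKet
  by_cases h : m + k = m' + k'
  · obtain ⟨N, hN⟩ : ∃ N, N = m + k := ⟨_, rfl⟩
    have key : ∀ (M M' : ℕ) (hM : M = N) (hM' : M' = N) (h1 : m < M + 1) (h2 : m' < M' + 1),
        ⟪mixedKet θ M ⟨m, h1⟩, mixedKet θ M' ⟨m', h2⟩⟫_ℂ = if m = m' then 1 else 0 := by
      rintro M M' rfl rfl h1 h2
      rw [inner_mixedKet_same]
      simp
    rw [key (m + k) (m' + k') hN.symm (by omega)]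
    congr 1
    simp only [Prod.mk.injEq, eq_iff_iff]
    omega
  · rw [inner_mixedKet_ne θ h]
    have : ¬ ((m, k) = (m', k')) := by
      simp only [Prod.mk.injEq]
      omega
    simp [this]

/-- The beam splitter `exp (θ (a†e - e†a))` on the two modes. -/
noncomputable def beamSplitter (θ : ℝ) : TwoModes →ₗᵢ[ℂ] TwoModes :=
  (orthonormal_beamSplitterKet θ).orthogonalFamily.linearIsometry

theorem beamSplitter_ket2 (θ : ℝ) (p : ℕ × ℕ) :
    beamSplitter θ (ket2 p) = beamSplitterKet θ p := by
  unfold beamSplitter ket2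
  rw [OrthogonalFamily.linearIsometry_apply_single]
  simp

/-! ### The attenuator -/

/-- The partial trace over the mode `E`: the sum over `l` of `⟨l|_E X |l⟩_E`. The series converges
absolutely in operator norm when `X` is trace class. -/
noncomputable def partialTraceE (X : TwoModes →L[ℂ] TwoModes) : Mode →L[ℂ] Mode :=
  ∑' l : ℕ, (ContinuousLinearMap.adjoint (tensorKet l).toContinuousLinearMap) ∘L X ∘L
    (tensorKet l).toContinuousLinearMap

/-- The operator `ρ ⊗ |0⟩⟨0|_E`. -/
noncomputable def tensorVacuum (ρ : Mode →L[ℂ] Mode) : TwoModes →L[ℂ] TwoModes :=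
  (tensorKet 0).toContinuousLinearMap ∘L ρ ∘L
    ContinuousLinearMap.adjoint (tensorKet 0).toContinuousLinearMap

/-- The beam splitter of transmissivity `lam`, i.e. with angle `θ ∈ [0, π/2]` such that
`cos θ = √lam`. -/
noncomputable def beamSplitterOfTransmissivity (lam : ℝ) : TwoModes →L[ℂ] TwoModes :=
  (beamSplitter (Real.arccos (Real.sqrt lam))).toContinuousLinearMap

/-- The one-mode quantum-limited attenuator of parameter `lam`:
`Φ(ρ) = Tr_E [U (ρ ⊗ |0⟩⟨0|_E) U†]`, where `U` is the beam splitter of transmissivity `lam`. -/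
noncomputable def attenuator (lam : ℝ) (ρ : Mode →L[ℂ] Mode) : Mode →L[ℂ] Mode :=
  partialTraceE (beamSplitterOfTransmissivity lam ∘L tensorVacuum ρ ∘L
    ContinuousLinearMap.adjoint (beamSplitterOfTransmissivity lam))

/-- The Gaussian thermal state `ω_E = ∑ n, (1 / (E + 1)) (E / (E + 1)) ^ n |n⟩⟨n|`. -/
noncomputable def thermalState (E : ℝ) : Mode →L[ℂ] Mode :=
  ∑' n : ℕ, (((1 / (E + 1)) * (E / (E + 1)) ^ n : ℝ) : ℂ) •
    InnerProductSpace.rankOne ℂ (ket n) (ket n)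

/-! ### The function `g` and its inverse -/

/-- `g(x) = (x + 1) ln (x + 1) - x ln x`, for real `x ≥ 0` (with `0 ln 0 = 0`). -/
noncomputable def gReal (x : ℝ) : ℝ := (x + 1) * Real.log (x + 1) - x * Real.log x

theorem continuous_gReal : Continuous gReal := by
  unfold gReal
  exact (Real.continuous_mul_log.comp (continuous_id.add continuous_const)).sub
    Real.continuous_mul_log

theorem gReal_zero : gReal 0 = 0 := by simp [gReal]

theorem strictMonoOn_gReal : StrictMonoOn gReal (Set.Ici 0) := by
  refine strictMonoOn_of_deriv_pos (convex_Ici 0) continuous_gReal.continuousOn ?_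
  intro x hx
  rw [interior_Ici] at hx
  have hx0 : (0 : ℝ) < x := hx
  have h1 : HasDerivAt (fun y : ℝ => y * Real.log y) (Real.log x + 1) x :=
    Real.hasDerivAt_mul_log hx0.ne'
  have h2 : HasDerivAt (fun y : ℝ => (y + 1) * Real.log (y + 1)) (Real.log (x + 1) + 1) x :=
    (Real.hasDerivAt_mul_log (x := x + 1) (by positivity)).comp_add_const x 1
  have h3 : HasDerivAt gReal ((Real.log (x + 1) + 1) - (Real.log x + 1)) x := h2.sub h1
  rw [h3.deriv]
  have := Real.log_lt_log hx0 (lt_add_one x)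
  linarith

theorem gReal_nonneg {x : ℝ} (hx : 0 ≤ x) : 0 ≤ gReal x := by
  rw [← gReal_zero]
  exact strictMonoOn_gReal.monotoneOn (Set.mem_Ici.2 le_rfl) (Set.mem_Ici.2 hx) hx

theorem log_le_gReal {x : ℝ} (hx : 0 ≤ x) : Real.log (x + 1) ≤ gReal x := by
  unfold gReal
  rcases hx.eq_or_lt with rfl | h
  · simp
  · have := mul_le_mul_of_nonneg_left (Real.log_le_log h (by linarith : x ≤ x + 1)) hx
    linarith

/-- The function `g` on `[0, ∞]`, with `g(∞) = ∞`. -/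
noncomputable def gFun (E : ℝ≥0∞) : ℝ≥0∞ :=
  if E = ∞ then ∞ else ENNReal.ofReal (gReal E.toReal)

theorem bijective_gFun : Function.Bijective gFun := by
  constructor
  · intro x y hxy
    unfold gFun at hxy
    by_cases hx : x = ∞ <;> by_cases hy : y = ∞
    · rw [hx, hy]
    · simp [hx, hy] at hxy
    · simp [hx, hy] at hxy
    · rw [if_neg hx, if_neg hy, ENNReal.ofReal_eq_ofReal_iff (gReal_nonneg ENNReal.toReal_nonneg)
        (gReal_nonneg ENNReal.toReal_nonneg)] at hxy
      exact (ENNReal.toReal_eq_toReal_iff' hx hy).1 (strictMonoOn_gReal.injOn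
        (Set.mem_Ici.2 ENNReal.toReal_nonneg) (Set.mem_Ici.2 ENNReal.toReal_nonneg) hxy)
  · intro s
    by_cases hs : s = ∞
    · exact ⟨∞, by simp [gFun, hs]⟩
    · have hE : (0 : ℝ) ≤ Real.exp s.toReal := (Real.exp_pos _).le
      have hle : s.toReal ≤ gReal (Real.exp s.toReal) := by
        refine le_trans ?_ (log_le_gReal hE)
        rw [Real.le_log_iff_exp_le (by positivity)]
        linarith
      obtain ⟨x, hx, hgx⟩ := intermediate_value_Icc hE continuous_gReal.continuousOn
        (show s.toReal ∈ Set.Icc (gReal 0) (gReal (Real.exp s.toReal)) from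
          ⟨by rw [gReal_zero]; exact ENNReal.toReal_nonneg, hle⟩)
      refine ⟨ENNReal.ofReal x, ?_⟩
      rw [gFun, if_neg ENNReal.ofReal_ne_top, ENNReal.toReal_ofReal hx.1, hgx,
        ENNReal.ofReal_toReal hs]

/-- The inverse of `g : [0, ∞] → [0, ∞]`. -/
noncomputable def gInv : ℝ≥0∞ → ℝ≥0∞ := (Equiv.ofBijective gFun bijective_gFun).symm

/-!
The idea is to compare the entropy along the attenuator semigroup with that of the thermal state
which reaches the same output entropy, using a sharp bound on the entropy production.

In the Fock basis the attenuator is an explicit transformation `attKernel` of matrices. The beam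
splitter sends `|N⟩|0⟩` to a binomial superposition, which is verified by differentiating in the
angle (`mixingMatrix_apply_last`), and `fockMatrix_attenuator` follows. In the parameter
`u = ln lam`, the transformations of a finitely supported matrix form a semigroup generated by
`σ ↦ X = (N σ + σ N) / 2 - a σ a†` (`hasDerivAt_attKernel_exp`).

For a state `σ` on finitely many Fock states, with eigenvalues `p_0 ≥ p_1 ≥ …`, the entropy
production `Tr [X (-ln σ)]` equals `∑ |a_ij|² p_j ln (p_i / p_j)` in the eigenbasis. A
layer-cake decomposition and `[a, a†] ≤ 1` bound it by `∑ k p_k ln (p_{k-1} / p_k)` (`sum_weight_mul_log_le`). Among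
probability vectors of entropy `g(y)` this is largest for the geometric ones, where it equals
`F(y) = y ln ((y + 1) / y)`: the log-sum inequality bounds the functional by
`∑ p_k F(q_{k+1} / p_k)`, where `q_k` are the tails of `p`, the entropy is `∑ p_k g(q_{k+1} / p_k)`
by the chain rule, and `F ∘ g⁻¹` is concave (`sum_mul_log_le_entropyRate`). Hence the entropy
production is at most that of the thermal state of the same entropy (`entropyProduction_le`), and a
comparison of differential inequalities gives the theorem for such states
(`gReal_le_matEntropy_attKernel`). The entropy is never differentiated: by the inequalities of
Peierls and Gibbs it lies below `-Tr [σ ln σ_u]`, with equality at `u`.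

The passage to infinite dimension uses the homogeneous entropy `h(A) = S(A) + t ln t`, `t = Tr A`,
which is monotone and decreases under compression by contractions (`homEntropy_mono`,
`homEntropy_conj_le`). The input is damped to `z^N ρ z^N` and truncated. Damping gives the output
geometric tails, uniformly in the truncation, so that the truncation can be removed, and it does not
increase the homogeneous entropy of the output (`homEntropy_attKernel_damp_le`), so that `z` can
tend to one (`gReal_le_of_homEntropy_corner`). Finally `S(ρ)` is tied to the homogeneous
entropies of the corners of the matrix of `ρ`: they are at most `S(ρ)` (`ofReal_homEntropy_corner_le`) and exceed any
smaller number (`exists_lt_homEntropy_corner`).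

Equality holds for thermal states, as the attenuator sends `ω_E` to `ω_{lam E}`
(`attenuator_thermalState`) and `S(ω_E) = g(E)` (`vonNeumannEntropy_thermalState`).
-/

/-! ### Scalar inequalities for entropies -/

open Real in
/-- The tangent line of `x ↦ -x ln x` at `b`. -/
theorem negMulLog_le_tangent {x b : ℝ} (hx : 0 ≤ x) (hb : 0 < b) :
    negMulLog x ≤ -(x * log b) + b - x := by
  rcases hx.eq_or_lt with rfl | hx
  · simp [hb.le]
  · have h := add_one_le_exp (log (b / x))
    rw [exp_log (by positivity), log_div hb.ne' hx.ne'] at h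
    have h2 := mul_le_mul_of_nonneg_left h hx.le
    rw [mul_div_cancel₀ _ hx.ne'] at h2
    unfold negMulLog
    nlinarith

theorem negMulLog_le_sqrt {x : ℝ} (hx : 0 ≤ x) : Real.negMulLog x ≤ √x := by
  rcases hx.eq_or_lt with rfl | hx
  · simp
  · have hs : 0 < √x := Real.sqrt_pos.2 hx
    -- `-ln x ≤ 1 / √x`, as `2 ln y ≤ 2 ln 2 + y - 2 ≤ y` at `y = 1 / √x`
    have h4 : Real.log x + 1 / √x ≥ 0 := by
      have h5 := Real.add_one_le_exp (-(Real.log x / 2) - Real.log 2)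
      rw [Real.exp_sub, Real.exp_log two_pos, Real.exp_neg, ← Real.log_sqrt hx.le,
        Real.exp_log hs, Real.log_sqrt hx.le] at h5
      have h6 : Real.log 2 < 0.6931471808 := Real.log_two_lt_d9
      rw [one_div]
      linarith
    have h7 : x * (1 / √x) = √x := by
      rw [mul_one_div, Real.div_sqrt]
    unfold Real.negMulLog
    nlinarith [mul_nonneg hx.le h4]

/-- `F(N) = N ln ((N + 1) / N)`: the rate at which the entropy of the thermal state with `N`
photons decreases under the attenuator semigroup. -/
noncomputable def entropyRate (x : ℝ) : ℝ := x * (Real.log (x + 1) - Real.log x)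

theorem hasDerivAt_gReal {x : ℝ} (hx : 0 < x) :
    HasDerivAt gReal (Real.log (x + 1) - Real.log x) x := by
  have h1 : HasDerivAt (fun y : ℝ => y * Real.log y) (Real.log x + 1) x :=
    Real.hasDerivAt_mul_log hx.ne'
  have h2 : HasDerivAt (fun y : ℝ => (y + 1) * Real.log (y + 1)) (Real.log (x + 1) + 1) x :=
    (Real.hasDerivAt_mul_log (x := x + 1) (by positivity)).comp_add_const x 1
  exact (h2.sub h1).congr_deriv (by ring)

theorem entropyRate_eq (x : ℝ) : entropyRate x = gReal x - Real.log (x + 1) := by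
  unfold entropyRate gReal; ring

theorem log_add_one_sub_log_pos {x : ℝ} (hx : 0 < x) : 0 < Real.log (x + 1) - Real.log x := by
  have := Real.log_lt_log hx (lt_add_one x)
  linarith

theorem entropyRate_pos {x : ℝ} (hx : 0 < x) : 0 < entropyRate x :=
  mul_pos hx (log_add_one_sub_log_pos hx)

/-- The ratio `g' / (ln (x + 1))'` is antitone. -/
theorem antitoneOn_add_one_mul_log :
    AntitoneOn (fun x : ℝ => (x + 1) * (Real.log (x + 1) - Real.log x)) (Set.Ioi 0) := by
  have hd : ∀ x ∈ Set.Ioi (0 : ℝ), HasDerivAt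
      (fun x : ℝ => (x + 1) * (Real.log (x + 1) - Real.log x))
      (Real.log (x + 1) - Real.log x - 1 / x) x := by
    intro x hx
    have hx : 0 < x := hx
    have h1 : HasDerivAt (fun y : ℝ => y + 1) 1 x := (hasDerivAt_id x).add_const 1
    have h := h1.fun_mul (((h1.log (by positivity))).fun_sub (Real.hasDerivAt_log hx.ne'))
    refine h.congr_deriv ?_
    have : x + 1 ≠ 0 := by positivity
    field_simp
    ring
  refine antitoneOn_of_deriv_nonpos (convex_Ioi 0)
    (fun x hx => (hd x hx).continuousAt.continuousWithinAt)
    (fun x hx => ?_) (fun x hx => ?_)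
  · rw [interior_Ioi] at hx
    exact (hd x hx).differentiableAt.differentiableWithinAt
  · rw [interior_Ioi] at hx
    rw [(hd x hx).deriv]
    have hx : 0 < x := hx
    have h := Real.log_le_sub_one_of_pos (show 0 < (x + 1) / x by positivity)
    rw [Real.log_div (by positivity) hx.ne'] at h
    have : (x + 1) / x - 1 = 1 / x := by field_simp; ring
    linarith

/-- As a function of the entropy `g(N)`, the rate `F(N)` lies below its tangent line at `g(y)`, and
so is concave. As `F = g - ln (N + 1)`, this follows from the monotonicity of the ratio of the
derivatives of `g` and `ln (N + 1)`. -/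
theorem exists_entropyRate_le_tangent {y : ℝ} (hy : 0 < y) :
    ∃ μ : ℝ, ∀ x, 0 ≤ x → entropyRate x ≤ entropyRate y + μ * (gReal x - gReal y) := by
  set L : ℝ → ℝ := fun x => Real.log (x + 1) - Real.log x
  have hLpos : ∀ x, 0 < x → 0 < L x := fun x hx => log_add_one_sub_log_pos hx
  -- the slope is `F' / g'` at `y`, that is, `1 - 1 / ((y + 1) L(y))`
  set c : ℝ := 1 / ((y + 1) * L y) with hc
  refine ⟨1 - c, fun x hx => ?_⟩
  have hden : 0 < (y + 1) * L y := mul_pos (by linarith) (hLpos y hy)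
  set ψ : ℝ → ℝ := fun x => c * gReal x - Real.log (x + 1) with hψ
  suffices h : ψ x ≤ ψ y by
    rw [entropyRate_eq, entropyRate_eq]
    simp only [hψ] at h
    linarith
  have hcont : ContinuousOn ψ (Set.Ici 0) := by
    refine ((continuous_gReal.const_mul c).continuousOn).sub ?_
    refine ContinuousOn.log (by fun_prop) ?_
    intro z hz
    have : (0 : ℝ) ≤ z := hz
    positivity
  have hder : ∀ z, 0 < z → HasDerivAt ψ (c * L z - 1 / (z + 1)) z := by
    intro z hz
    have h1 : HasDerivAt (fun y : ℝ => y + 1) 1 z := (hasDerivAt_id z).add_const 1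
    exact ((hasDerivAt_gReal hz).const_mul c).sub (h1.log (by positivity))
  have hanti := antitoneOn_add_one_mul_log
  rcases le_total x y with hxy | hxy
  · have hmono : MonotoneOn ψ (Set.Icc 0 y) := by
      refine monotoneOn_of_deriv_nonneg (convex_Icc 0 y) (hcont.mono Set.Icc_subset_Ici_self)
        (fun z hz => ?_) (fun z hz => ?_)
      · rw [interior_Icc] at hz
        exact (hder z hz.1).differentiableAt.differentiableWithinAt
      · rw [interior_Icc] at hz
        rw [(hder z hz.1).deriv]
        have h1 : (y + 1) * L y ≤ (z + 1) * L z := hanti hz.1 hy hz.2.le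
        have hz1 : 0 < z + 1 := by linarith [hz.1]
        rw [hc, sub_nonneg, div_le_iff₀ hz1, div_mul_eq_mul_div, div_mul_eq_mul_div,
          le_div_iff₀ hden]
        linarith
    exact hmono ⟨hx, hxy⟩ ⟨hy.le, le_rfl⟩ hxy
  · have hmono : AntitoneOn ψ (Set.Ici y) := by
      refine antitoneOn_of_deriv_nonpos (convex_Ici y) (hcont.mono (Set.Ici_subset_Ici.2 hy.le))
        (fun z hz => ?_) (fun z hz => ?_)
      · rw [interior_Ici] at hz
        exact (hder z (hy.trans hz)).differentiableAt.differentiableWithinAt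
      · rw [interior_Ici] at hz
        have hz0 : 0 < z := hy.trans hz
        rw [(hder z hz0).deriv]
        have h1 : (z + 1) * L z ≤ (y + 1) * L y := hanti hy hz0 (le_of_lt hz)
        have hz1 : 0 < z + 1 := by linarith
        rw [hc, sub_nonpos, le_div_iff₀ hz1, div_mul_eq_mul_div, div_mul_eq_mul_div,
          div_le_iff₀ hden]
        linarith
    exact hmono Set.self_mem_Ici hxy hxy

/-- Log-sum inequality for a sequence against its shift. -/
theorem sum_mul_log_div_le {D k : ℕ} {p : ℕ → ℝ} (hp : ∀ n < D, 0 < p n) (hk : k + 1 < D) :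
    ∑ n ∈ Finset.Ico (k + 1) D, p n * (Real.log (p (n - 1)) - Real.log (p n)) ≤
      (∑ n ∈ Finset.Ico (k + 1) D, p n) *
        (Real.log (∑ n ∈ Finset.Ico k D, p n) - Real.log (∑ n ∈ Finset.Ico (k + 1) D, p n)) := by
  set A := ∑ n ∈ Finset.Ico (k + 1) D, p n with hA
  set B := ∑ n ∈ Finset.Ico k D, p n with hB
  have hApos : 0 < A := Finset.sum_pos (fun n hn => hp n (Finset.mem_Ico.1 hn).2)
    ⟨k + 1, Finset.mem_Ico.2 ⟨le_rfl, hk⟩⟩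
  have hBpos : 0 < B := Finset.sum_pos (fun n hn => hp n (Finset.mem_Ico.1 hn).2)
    ⟨k, Finset.mem_Ico.2 ⟨le_rfl, by omega⟩⟩
  have hshift : ∑ n ∈ Finset.Ico (k + 1) D, p (n - 1) ≤ B := by
    obtain ⟨D', rfl⟩ : ∃ D', D = D' + 1 := ⟨D - 1, by omega⟩
    rw [← Finset.sum_Ico_add' (fun n => p (n - 1)) k D' 1, hB, Finset.sum_Ico_succ_top (by omega)]
    have := hp D' (by omega)
    simp only [Nat.add_sub_cancel]
    linarith
  have hterm : ∀ n ∈ Finset.Ico (k + 1) D, p n * (Real.log (p (n - 1)) - Real.log (p n)) ≤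
      p n * (Real.log B - Real.log A) + A / B * p (n - 1) - p n := by
    intro n hn
    rw [Finset.mem_Ico] at hn
    have h1 := hp n hn.2
    have h2 := hp (n - 1) (by omega)
    have h := negMulLog_le_tangent h1.le (show 0 < A / B * p (n - 1) by positivity)
    rw [Real.log_mul (by positivity) h2.ne', Real.log_div hApos.ne' hBpos.ne'] at h
    unfold Real.negMulLog at h
    nlinarith
  refine (Finset.sum_le_sum hterm).trans ?_
  rw [Finset.sum_sub_distrib, Finset.sum_add_distrib, ← Finset.sum_mul, ← Finset.mul_sum, ← hA]
  have : A / B * ∑ n ∈ Finset.Ico (k + 1) D, p (n - 1) ≤ A / B * B := by gcongr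
  rw [div_mul_cancel₀ _ hBpos.ne'] at this
  linarith

/-- The chain rule for the entropy, with the remaining mass `p + q` split into `p` and `q`. -/
theorem mul_gReal_div {p q : ℝ} (hp : 0 < p) (hq : 0 ≤ q) :
    p * gReal (q / p) = Real.negMulLog p + Real.negMulLog q - Real.negMulLog (p + q) := by
  have h1 : q / p + 1 = (p + q) / p := by field_simp; ring
  unfold gReal Real.negMulLog
  rw [h1, Real.log_div (by positivity) hp.ne']
  rcases hq.eq_or_lt with rfl | hq
  · simp
  · rw [Real.log_div hq.ne' hp.ne']
    field_simp
    ring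

theorem mul_entropyRate_div {p q : ℝ} (hp : 0 < p) (hq : 0 ≤ q) :
    p * entropyRate (q / p) = q * (Real.log (p + q) - Real.log q) := by
  have h1 : q / p + 1 = (p + q) / p := by field_simp; ring
  unfold entropyRate
  rw [h1, Real.log_div (by positivity) hp.ne']
  rcases hq.eq_or_lt with rfl | hq
  · simp
  · rw [Real.log_div hq.ne' hp.ne']
    field_simp
    ring

/-- The isoperimetric inequality for a probability vector `p`: among all vectors of a given entropy
`g(y)`, the functional `∑ k p_k ln (p_{k-1} / p_k)` is largest on the geometric ones.

With the tails `q_k = ∑_{n ≥ k} p_n`, the functional is at most `∑ p_k F(q_{k+1} / p_k)` by the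
log-sum inequality, while the chain rule gives the entropy as `∑ p_k g(q_{k+1} / p_k)`; what remains
is Jensen's inequality for `F ∘ g⁻¹`. -/
theorem sum_mul_log_le_entropyRate {D : ℕ} {p : ℕ → ℝ} {y : ℝ} (hp : ∀ n < D, 0 < p n)
    (hsum : ∑ n ∈ Finset.range D, p n = 1) (hy : 0 < y)
    (hH : ∑ n ∈ Finset.range D, Real.negMulLog (p n) = gReal y) :
    ∑ k ∈ Finset.Ico 1 D, (k : ℝ) * (p k * (Real.log (p (k - 1)) - Real.log (p k)))
      ≤ entropyRate y := by
  set q : ℕ → ℝ := fun k => ∑ n ∈ Finset.Ico k D, p n with hq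
  have hq0 : ∀ k, 0 ≤ q k := fun k =>
    Finset.sum_nonneg fun n hn => (hp n (Finset.mem_Ico.1 hn).2).le
  have hqs : ∀ k < D, q k = p k + q (k + 1) := fun k hk => Finset.sum_eq_sum_Ico_succ_bot hk p
  have hqD : q D = 0 := by simp [hq]
  have hq1 : q 0 = 1 := by simp only [hq]; rw [← hsum, Finset.range_eq_Ico]
  have hDpos : 0 < D := by
    rcases Nat.eq_zero_or_pos D with rfl | h
    · simp at hsum
    · exact h
  have step1 : ∑ k ∈ Finset.Ico 1 D, (k : ℝ) * (p k * (Real.log (p (k - 1)) - Real.log (p k)))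
      = ∑ k ∈ Finset.range (D - 1), ∑ n ∈ Finset.Ico (k + 1) D,
          p n * (Real.log (p (n - 1)) - Real.log (p n)) := by
    rw [Finset.sum_comm' (t' := Finset.Ico 1 D) (s' := fun n => Finset.range n)]
    · refine Finset.sum_congr rfl fun n _ => ?_
      simp
    · intro x y
      simp only [Finset.mem_range, Finset.mem_Ico]
      omega
  have step2 : ∑ k ∈ Finset.range (D - 1), ∑ n ∈ Finset.Ico (k + 1) D,
          p n * (Real.log (p (n - 1)) - Real.log (p n))
      ≤ ∑ k ∈ Finset.range D, p k * entropyRate (q (k + 1) / p k) := by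
    obtain ⟨D', rfl⟩ : ∃ D', D = D' + 1 := ⟨D - 1, by omega⟩
    rw [Finset.sum_range_succ, hqD]
    simp only [Nat.add_sub_cancel, zero_div]
    have h0 : entropyRate 0 = 0 := by simp [entropyRate]
    rw [h0, mul_zero, add_zero]
    refine Finset.sum_le_sum fun k hk => ?_
    rw [Finset.mem_range] at hk
    rw [mul_entropyRate_div (hp k (by omega)) (hq0 _), ← hqs k (by omega)]
    exact sum_mul_log_div_le hp (by omega)
  have hHq : ∑ k ∈ Finset.range D, p k * gReal (q (k + 1) / p k) = gReal y := by
    have h1 : ∀ k ∈ Finset.range D, p k * gReal (q (k + 1) / p k) =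
        Real.negMulLog (p k) + (Real.negMulLog (q (k + 1)) - Real.negMulLog (q k)) := by
      intro k hk
      rw [Finset.mem_range] at hk
      rw [mul_gReal_div (hp k hk) (hq0 _), ← hqs k hk]
      ring
    rw [Finset.sum_congr rfl h1, Finset.sum_add_distrib,
      Finset.sum_range_sub (fun k => Real.negMulLog (q k)), hH, hqD, hq1]
    simp
  obtain ⟨μ, hμ⟩ := exists_entropyRate_le_tangent hy
  rw [step1]
  refine step2.trans ?_
  calc ∑ k ∈ Finset.range D, p k * entropyRate (q (k + 1) / p k)
      ≤ ∑ k ∈ Finset.range D,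
          (p k * entropyRate y + μ * (p k * gReal (q (k + 1) / p k)) - μ * gReal y * p k) := by
        refine Finset.sum_le_sum fun k hk => ?_
        rw [Finset.mem_range] at hk
        have h1 := hp k hk
        have := mul_le_mul_of_nonneg_left (hμ _ (div_nonneg (hq0 (k + 1)) h1.le)) h1.le
        linarith
    _ = entropyRate y := by
        rw [Finset.sum_sub_distrib, Finset.sum_add_distrib, ← Finset.sum_mul, ← Finset.mul_sum,
          ← Finset.mul_sum, hsum, hHq]
        ring

/-- Layer-cake bound: if the weights `W` transfer at most `k` more into than out of each initial
segment of length `k`, then the entropy production of a decreasing `p` is at most that of the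
weights `W (k - 1) k = k`. -/
theorem sum_weight_mul_log_le {D : ℕ} {p : ℕ → ℝ} {W : ℕ → ℕ → ℝ} (hp : ∀ n < D, 0 < p n)
    (hanti : ∀ m n, m ≤ n → n < D → p n ≤ p m) (hW0 : ∀ i j, 0 ≤ W i j)
    (hW : ∀ k < D, ∑ i ∈ Finset.range D, ∑ j ∈ Finset.range D,
      W i j * ((if i < k then 1 else 0) - (if j < k then 1 else 0)) ≤ k) :
    ∑ i ∈ Finset.range D, ∑ j ∈ Finset.range D, W i j * (p j * (Real.log (p i) - Real.log (p j)))
      ≤ ∑ k ∈ Finset.Ico 1 D, (k : ℝ) * (p k * (Real.log (p (k - 1)) - Real.log (p k))) := by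
  set d : ℕ → ℝ := fun k => Real.log (p (k - 1)) - Real.log (p k) with hd
  have hd0 : ∀ k ∈ Finset.Ico 1 D, 0 ≤ d k := by
    intro k hk
    rw [Finset.mem_Ico] at hk
    exact sub_nonneg.2 (Real.log_le_log (hp k hk.2) (hanti _ _ (Nat.sub_le k 1) hk.2))
  have htel : ∀ i < D, ∑ k ∈ Finset.Ico 1 D, (if i < k then (1 : ℝ) else 0) * d k
      = Real.log (p i) - Real.log (p (D - 1)) := by
    intro i hi
    obtain ⟨D', rfl⟩ : ∃ D', D = D' + 1 := ⟨D - 1, by omega⟩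
    have h1 : ∀ k ∈ Finset.Ico 1 (D' + 1), (if i < k then (1 : ℝ) else 0) * d k =
        if i < k then d k else 0 := fun k _ => by split_ifs <;> simp
    rw [Finset.sum_congr rfl h1, ← Finset.sum_filter]
    have h2 : (Finset.Ico 1 (D' + 1)).filter (fun k => i < k) = Finset.Ico (i + 1) (D' + 1) := by
      ext k; simp only [Finset.mem_filter, Finset.mem_Ico]; omega
    rw [h2, ← Finset.sum_Ico_add' d i D' 1]
    have h3 : ∀ k ∈ Finset.Ico i D', d (k + 1) =
        -(Real.log (p (k + 1)) - Real.log (p k)) := fun k _ => by simp [hd]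
    rw [Finset.sum_congr rfl h3, Finset.sum_neg_distrib,
      Finset.sum_Ico_sub (fun k => Real.log (p k)) (by omega)]
    simp
  have hlog : ∀ i < D, ∀ j < D, Real.log (p i) - Real.log (p j) =
      ∑ k ∈ Finset.Ico 1 D,
        ((if i < k then (1 : ℝ) else 0) - (if j < k then 1 else 0)) * d k := by
    intro i hi j hj
    simp only [sub_mul, Finset.sum_sub_distrib, htel i hi, htel j hj]
    ring
  calc ∑ i ∈ Finset.range D, ∑ j ∈ Finset.range D, W i j * (p j * (Real.log (p i) - Real.log (p j)))
      = ∑ i ∈ Finset.range D, ∑ j ∈ Finset.range D, ∑ k ∈ Finset.Ico 1 D,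
          W i j * (p j * (((if i < k then (1 : ℝ) else 0) - (if j < k then 1 else 0)) * d k)) := by
        refine Finset.sum_congr rfl fun i hi => Finset.sum_congr rfl fun j hj => ?_
        rw [hlog i (Finset.mem_range.1 hi) j (Finset.mem_range.1 hj), Finset.mul_sum,
          Finset.mul_sum]
    _ = ∑ k ∈ Finset.Ico 1 D, ∑ i ∈ Finset.range D, ∑ j ∈ Finset.range D,
          W i j * (p j * (((if i < k then (1 : ℝ) else 0) - (if j < k then 1 else 0)) * d k)) :=
        (Finset.sum_congr rfl fun i _ => Finset.sum_comm).trans Finset.sum_comm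
    _ ≤ ∑ k ∈ Finset.Ico 1 D, (k : ℝ) * (p k * d k) := by
        refine Finset.sum_le_sum fun k hk => ?_
        have hdk := hd0 k hk
        rw [Finset.mem_Ico] at hk
        have hpk := hp k hk.2
        calc _ ≤ ∑ i ∈ Finset.range D, ∑ j ∈ Finset.range D,
              (p k * d k) * (W i j * ((if i < k then 1 else 0) - (if j < k then 1 else 0))) := by
              refine Finset.sum_le_sum fun i _ => Finset.sum_le_sum fun j hj => ?_
              have hj := Finset.mem_range.1 hj
              have hWd := mul_nonneg (hW0 i j) hdk
              split_ifs with h1 h2 h2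
              · simp
              · have := mul_le_mul_of_nonneg_left (hanti k j (by omega) hj) hWd
                linarith
              · have := mul_le_mul_of_nonneg_left (hanti j k (by omega) hk.2) hWd
                linarith
              · simp
          _ = (p k * d k) * ∑ i ∈ Finset.range D, ∑ j ∈ Finset.range D,
                W i j * ((if i < k then 1 else 0) - (if j < k then 1 else 0)) := by
              simp only [Finset.mul_sum]
          _ ≤ (p k * d k) * k := mul_le_mul_of_nonneg_left (hW k hk.2) (by positivity)
          _ = k * (p k * d k) := mul_comm _ _

section
open scoped ComplexOrder

/-! ### The entropy of a matrix -/

/-- The entropy `∑ η(x)` with `η(x) = -x ln x`, over the eigenvalues `x` of a matrix with real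
spectrum. Reading the eigenvalues off the characteristic polynomial makes the invariance under
similarity immediate and needs no proof that the matrix is Hermitian. -/
noncomputable def matEntropy {n : Type*} [Fintype n] [DecidableEq n] (A : Matrix n n ℂ) : ℝ :=
  (A.charpoly.roots.map fun x => Real.negMulLog x.re).sum

/-- The entropy made homogeneous of degree one, `h(A) = t S(A / t)` with `t = Tr A`. -/
noncomputable def homEntropy {n : Type*} [Fintype n] [DecidableEq n] (A : Matrix n n ℂ) : ℝ :=
  matEntropy A - Real.negMulLog A.trace.re

/-- The homogeneous entropy of a vector is monotone, by Gibbs' inequality against `p / ∑ p_i` and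
`p_i ≤ ∑ p_i`. -/
theorem sum_negMulLog_sub_le {n : Type*} [Fintype n] {t p : n → ℝ} (ht : ∀ i, 0 ≤ t i)
    (htp : ∀ i, t i ≤ p i) :
    ∑ i, Real.negMulLog (t i) - Real.negMulLog (∑ i, t i) ≤
      ∑ i, Real.negMulLog (p i) - Real.negMulLog (∑ i, p i) := by
  set T := ∑ i, t i with hT
  set P := ∑ i, p i with hP
  have hp : ∀ i, 0 ≤ p i := fun i => (ht i).trans (htp i)
  rcases (Finset.sum_nonneg fun i _ => hp i : 0 ≤ P).eq_or_lt with hP0 | hPpos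
  · have hp0 : ∀ i, p i = 0 := fun i =>
      (Finset.sum_eq_zero_iff_of_nonneg fun i _ => hp i).1 hP0.symm i (Finset.mem_univ i)
    have ht0 : ∀ i, t i = 0 := fun i => le_antisymm ((htp i).trans (hp0 i).le) (ht i)
    simp [hT, hP, hp0, ht0]
  have hT0 : 0 ≤ T := Finset.sum_nonneg fun i _ => ht i
  have key : ∀ i, Real.negMulLog (t i) ≤
      -(t i * Real.log T) + p i * (Real.log P - Real.log (p i)) + T / P * p i - t i := by
    intro i
    rcases (hp i).eq_or_lt with hpi | hpi
    · have : t i = 0 := le_antisymm ((htp i).trans hpi.symm.le) (ht i)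
      simp [this, ← hpi]
    have hlog : 0 ≤ Real.log P - Real.log (p i) := sub_nonneg.2
      (Real.log_le_log hpi (Finset.single_le_sum (fun i _ => hp i) (Finset.mem_univ i)))
    have h3 := mul_le_mul_of_nonneg_right (htp i) hlog
    rcases hT0.eq_or_lt with hTz | hTpos
    · have : t i = 0 :=
        (Finset.sum_eq_zero_iff_of_nonneg fun i _ => ht i).1 hTz.symm i (Finset.mem_univ i)
      have h4 := mul_nonneg (hp i) hlog
      rw [← hTz, this]
      simpa using h4
    · have h := negMulLog_le_tangent (ht i) (show 0 < T / P * p i by positivity)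
      rw [Real.log_mul (by positivity) hpi.ne', Real.log_div hTpos.ne' hPpos.ne'] at h
      linarith
  have hsum := Finset.sum_le_sum fun i (_ : i ∈ Finset.univ) => key i
  have e1 : ∑ i, (-(t i * Real.log T) + p i * (Real.log P - Real.log (p i)) + T / P * p i - t i)
      = -(T * Real.log T) + (P * Real.log P + ∑ i, Real.negMulLog (p i)) + T / P * P - T := by
    rw [Finset.sum_sub_distrib, Finset.sum_add_distrib, Finset.sum_add_distrib,
      Finset.sum_neg_distrib, ← Finset.sum_mul, ← Finset.mul_sum]
    congr 3
    rw [hP, Finset.sum_mul, ← Finset.sum_add_distrib]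
    refine Finset.sum_congr rfl fun i _ => ?_
    unfold Real.negMulLog
    ring
  rw [e1, div_mul_cancel₀ _ hPpos.ne'] at hsum
  have e2 : Real.negMulLog T = -(T * Real.log T) := by unfold Real.negMulLog; ring
  have e3 : Real.negMulLog P = -(P * Real.log P) := by unfold Real.negMulLog; ring
  linarith

theorem Matrix.PosSemidef.re_diag_nonneg {k : Type*} {A : Matrix k k ℂ} (hA : A.PosSemidef)
    (i : k) :
    0 ≤ (A i i).re := (Complex.nonneg_iff.1 hA.diag_nonneg).1

theorem Matrix.PosSemidef.re_diag_le_trace {n : Type*} [Fintype n] {A : Matrix n n ℂ}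
    (hA : A.PosSemidef) (i : n) : (A i i).re ≤ A.trace.re := by
  rw [Matrix.trace, Complex.re_sum]
  exact Finset.single_le_sum (f := fun i => (A i i).re) (fun i _ => hA.re_diag_nonneg i)
    (Finset.mem_univ i)

section
variable {n m : Type*} [Fintype n] [DecidableEq n] [Fintype m] [DecidableEq m]

theorem matEntropy_diagonal (p : n → ℝ) :
    matEntropy (Matrix.diagonal fun i => (p i : ℂ)) = ∑ i, Real.negMulLog (p i) := by
  unfold matEntropy
  rw [Matrix.charpoly_diagonal, Polynomial.roots_prod _ _
    (Finset.prod_ne_zero_iff.2 fun i _ => Polynomial.X_sub_C_ne_zero _)]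
  simp [Polynomial.roots_X_sub_C, Multiset.map_map]

theorem matEntropy_reindex (e : n ≃ m) (A : Matrix n n ℂ) :
    matEntropy (Matrix.reindex e e A) = matEntropy A := by
  unfold matEntropy
  rw [Matrix.charpoly_reindex]

theorem sum_negMulLog_roots_X_pow_mul (k : ℕ) (A : Matrix n n ℂ) :
    ((Polynomial.X ^ k * A.charpoly).roots.map fun x : ℂ => Real.negMulLog x.re).sum
      = matEntropy A := by
  rw [Polynomial.roots_mul (mul_ne_zero (pow_ne_zero _ Polynomial.X_ne_zero)
    (Matrix.charpoly_monic A).ne_zero), Polynomial.roots_pow, Polynomial.roots_X,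
    Multiset.map_add, Multiset.sum_add]
  simp [matEntropy, Multiset.map_nsmul, Multiset.sum_nsmul]

theorem matEntropy_mul_comm (X : Matrix m n ℂ) (Y : Matrix n m ℂ) :
    matEntropy (X * Y) = matEntropy (Y * X) := by
  rw [← sum_negMulLog_roots_X_pow_mul (Fintype.card n) (X * Y),
    ← sum_negMulLog_roots_X_pow_mul (Fintype.card m) (Y * X), Matrix.charpoly_mul_comm' X Y]

theorem homEntropy_mul_comm (X : Matrix m n ℂ) (Y : Matrix n m ℂ) :
    homEntropy (X * Y) = homEntropy (Y * X) := by
  unfold homEntropy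
  rw [matEntropy_mul_comm, Matrix.trace_mul_comm]

/-- Spectral theorem for positive semidefinite matrices, with the eigenvalues indexed by `n`. -/
theorem Matrix.PosSemidef.exists_eq_conj_diagonal {A : Matrix n n ℂ} (hA : A.PosSemidef) :
    ∃ (U : Matrix n n ℂ) (p : n → ℝ), Uᴴ * U = 1 ∧ (∀ i, 0 ≤ p i) ∧
      A = U * Matrix.diagonal (fun i => (p i : ℂ)) * Uᴴ := by
  refine ⟨hA.1.eigenvectorUnitary, hA.1.eigenvalues, ?_, hA.eigenvalues_nonneg, ?_⟩
  · exact Unitary.coe_star_mul_self hA.1.eigenvectorUnitary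
  · exact hA.1.spectral_theorem

theorem conjTranspose_mul_conj_mul {U A : Matrix n n ℂ} (hU : Uᴴ * U = 1) :
    Uᴴ * (U * A * Uᴴ) * U = A := by
  rw [show Uᴴ * (U * A * Uᴴ) * U = (Uᴴ * U) * A * (Uᴴ * U) by simp only [mul_assoc], hU, one_mul,
    mul_one]

theorem matEntropy_conj {U : Matrix n n ℂ} (hU : Uᴴ * U = 1) (A : Matrix n n ℂ) :
    matEntropy (U * A * Uᴴ) = matEntropy A := by
  rw [matEntropy_mul_comm, ← mul_assoc, hU, one_mul]

theorem trace_conjTranspose_conj {U : Matrix n n ℂ} (hU : Uᴴ * U = 1) (A : Matrix n n ℂ) :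
    (Uᴴ * A * U).trace = A.trace := by
  rw [Matrix.trace_mul_comm, ← mul_assoc, mul_eq_one_comm.1 hU, one_mul]

theorem matEntropy_conj_diagonal {U : Matrix n n ℂ} (hU : Uᴴ * U = 1) (p : n → ℝ) :
    matEntropy (U * Matrix.diagonal (fun i => (p i : ℂ)) * Uᴴ) = ∑ i, Real.negMulLog (p i) := by
  rw [matEntropy_conj hU, matEntropy_diagonal]

theorem sum_normSq_col {W : Matrix n n ℂ} (hW : Wᴴ * W = 1) (j : n) :
    ∑ i, Complex.normSq (W i j) = 1 := by
  have h := congrFun (congrFun hW j) j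
  rw [Matrix.mul_apply, Matrix.one_apply_eq] at h
  have h2 := congrArg Complex.re h
  simpa [Matrix.conjTranspose_apply, Complex.normSq_apply] using h2

theorem sum_normSq_row {W : Matrix n n ℂ} (hW : Wᴴ * W = 1) (i : n) :
    ∑ j, Complex.normSq (W i j) = 1 := by
  have hW' : W * Wᴴ = 1 := mul_eq_one_comm.1 hW
  have h := congrFun (congrFun hW' i) i
  rw [Matrix.mul_apply, Matrix.one_apply_eq] at h
  have h2 := congrArg Complex.re h
  simpa [Matrix.conjTranspose_apply, Complex.normSq_apply] using h2

theorem conj_diagonal_apply_self {k : Type*} (W : Matrix n k ℂ) (p : n → ℝ) (j : k) :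
    (Wᴴ * Matrix.diagonal (fun i => (p i : ℂ)) * W) j j
      = ((∑ i, Complex.normSq (W i j) * p i : ℝ) : ℂ) := by
  rw [Matrix.mul_apply, Complex.ofReal_sum]
  refine Finset.sum_congr rfl fun i _ => ?_
  rw [Matrix.mul_diagonal, Matrix.conjTranspose_apply, Complex.star_def, Complex.ofReal_mul,
    Complex.normSq_eq_conj_mul_self]
  ring

/-- Peierls' inequality: the entropy is at most that of the diagonal in any orthonormal basis. -/
theorem matEntropy_le_sum_diag {A V : Matrix n n ℂ} (hA : A.PosSemidef) (hV : Vᴴ * V = 1) :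
    matEntropy A ≤ ∑ j, Real.negMulLog ((Vᴴ * A * V) j j).re := by
  obtain ⟨U, p, hU, hp, rfl⟩ := hA.exists_eq_conj_diagonal
  rw [matEntropy_conj_diagonal hU]
  set W := Uᴴ * V with hW
  have hWW : Wᴴ * W = 1 := by
    rw [hW, Matrix.conjTranspose_mul, Matrix.conjTranspose_conjTranspose, mul_assoc,
      ← mul_assoc U, mul_eq_one_comm.1 hU, one_mul, hV]
  have hD : ∀ j, ((Vᴴ * (U * Matrix.diagonal (fun i => (p i : ℂ)) * Uᴴ) * V) j j).re =
      ∑ i, Complex.normSq (W i j) * p i := by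
    intro j
    have : Vᴴ * (U * Matrix.diagonal (fun i => (p i : ℂ)) * Uᴴ) * V =
        Wᴴ * Matrix.diagonal (fun i => (p i : ℂ)) * W := by
      rw [hW, Matrix.conjTranspose_mul, Matrix.conjTranspose_conjTranspose]
      simp only [mul_assoc]
    rw [this, conj_diagonal_apply_self, Complex.ofReal_re]
  calc ∑ i, Real.negMulLog (p i)
      = ∑ i, (∑ j, Complex.normSq (W i j)) * Real.negMulLog (p i) := by
        simp_rw [sum_normSq_row hWW, one_mul]
    _ = ∑ j, ∑ i, Complex.normSq (W i j) * Real.negMulLog (p i) := by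
        simp_rw [Finset.sum_mul]
        exact Finset.sum_comm
    _ ≤ _ := by
        refine Finset.sum_le_sum fun j _ => ?_
        rw [hD]
        exact Real.concaveOn_negMulLog.le_map_sum (fun i _ => Complex.normSq_nonneg _)
          (sum_normSq_col hWW j) (fun i _ => hp i)

/-- The homogeneous entropy is monotone: in the eigenbasis of `B`, Peierls' inequality for `A`
reduces this to diagonal matrices. -/
theorem homEntropy_mono {A B : Matrix n n ℂ} (hA : A.PosSemidef) (hAB : (B - A).PosSemidef) :
    homEntropy A ≤ homEntropy B := by
  have hB : B.PosSemidef := by simpa using hA.add hAB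
  obtain ⟨U, p, hU, hp, hBU⟩ := hB.exists_eq_conj_diagonal
  have hBd : Uᴴ * B * U = Matrix.diagonal (fun i => (p i : ℂ)) := by
    rw [hBU, conjTranspose_mul_conj_mul hU]
  set t : n → ℝ := fun i => ((Uᴴ * A * U) i i).re with ht
  have ht0 : ∀ i, 0 ≤ t i := fun i => (hA.conjTranspose_mul_mul_same U).re_diag_nonneg i
  have htp : ∀ i, t i ≤ p i := by
    intro i
    have h := (hAB.conjTranspose_mul_mul_same U).re_diag_nonneg i
    rw [Matrix.mul_sub, Matrix.sub_mul, hBd] at h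
    simp only [Matrix.sub_apply, Matrix.diagonal_apply_eq, Complex.sub_re, Complex.ofReal_re] at h
    exact sub_nonneg.1 h
  have h1 : matEntropy A ≤ ∑ i, Real.negMulLog (t i) := matEntropy_le_sum_diag hA hU
  have h2 : A.trace.re = ∑ i, t i := by
    rw [← trace_conjTranspose_conj hU A]
    simp [Matrix.trace, ht]
  have h3 : matEntropy B = ∑ i, Real.negMulLog (p i) := by
    rw [hBU, matEntropy_conj_diagonal hU]
  have h4 : B.trace.re = ∑ i, p i := by
    rw [← trace_conjTranspose_conj hU B, hBd]
    simp [Matrix.trace]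
  unfold homEntropy
  rw [h2, h3, h4]
  have := sum_negMulLog_sub_le ht0 htp
  linarith

/-- Compression by a contraction decreases the homogeneous entropy. If `B = Yᴴ Y`, then
`Cᴴ B C` has the same spectrum, up to zeros, as `Y C Cᴴ Yᴴ ≤ Y Yᴴ`. -/
theorem homEntropy_conj_le {B : Matrix n n ℂ} {C : Matrix n m ℂ} (hB : B.PosSemidef)
    (hC : (1 - C * Cᴴ).PosSemidef) : homEntropy (Cᴴ * B * C) ≤ homEntropy B := by
  obtain ⟨Y, rfl⟩ : ∃ Y : Matrix n n ℂ, B = Yᴴ * Y := by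
    obtain ⟨U, p, hU, hp, rfl⟩ := hB.exists_eq_conj_diagonal
    refine ⟨Matrix.diagonal (fun i => ((√(p i) : ℝ) : ℂ)) * Uᴴ, ?_⟩
    rw [Matrix.conjTranspose_mul, Matrix.conjTranspose_conjTranspose,
      Matrix.diagonal_conjTranspose, mul_assoc, mul_assoc, ← mul_assoc (Matrix.diagonal _),
      Matrix.diagonal_mul_diagonal]
    congr 3
    funext i
    simp only [Pi.star_apply, Complex.star_def, Complex.conj_ofReal]
    rw [← Complex.ofReal_mul, Real.mul_self_sqrt (hp i)]
  rw [show Cᴴ * (Yᴴ * Y) * C = (Cᴴ * Yᴴ) * (Y * C) by simp only [Matrix.mul_assoc],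
    homEntropy_mul_comm, homEntropy_mul_comm Yᴴ Y]
  refine homEntropy_mono ?_ ?_
  · rw [← Matrix.conjTranspose_mul]
    exact Matrix.posSemidef_self_mul_conjTranspose _
  · have : Y * Yᴴ - Y * C * (Cᴴ * Yᴴ) = Y * (1 - C * Cᴴ) * Yᴴ := by
      rw [Matrix.mul_sub, Matrix.sub_mul, Matrix.mul_one]
      simp only [Matrix.mul_assoc]
    rw [this]
    exact hC.mul_mul_conjTranspose_same Y

/-- Pinching in a block decomposition, followed by a full dephasing of the second block. -/
theorem matEntropy_le_block {A : Matrix (n ⊕ m) (n ⊕ m) ℂ} (hA : A.PosSemidef) :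
    matEntropy A ≤ matEntropy A.toBlocks₁₁ +
      ∑ j, Real.negMulLog (A (Sum.inr j) (Sum.inr j)).re := by
  have h11 : A.toBlocks₁₁.PosSemidef := hA.submatrix Sum.inl
  obtain ⟨U, p, hU, hp, hUA⟩ := h11.exists_eq_conj_diagonal
  set V : Matrix (n ⊕ m) (n ⊕ m) ℂ := Matrix.fromBlocks U 0 0 1 with hV
  have hVV : Vᴴ * V = 1 := by
    rw [hV, Matrix.fromBlocks_conjTranspose, Matrix.fromBlocks_multiply]
    simp [hU]
  have h := matEntropy_le_sum_diag hA hVV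
  have hblock : Vᴴ * A * V = Matrix.fromBlocks (Uᴴ * A.toBlocks₁₁ * U) (Uᴴ * A.toBlocks₁₂)
      (A.toBlocks₂₁ * U) A.toBlocks₂₂ := by
    conv_lhs => rw [← Matrix.fromBlocks_toBlocks A]
    rw [hV, Matrix.fromBlocks_conjTranspose, Matrix.fromBlocks_multiply,
      Matrix.fromBlocks_multiply]
    simp
  rw [hblock, Fintype.sum_sum_type] at h
  simp only [Matrix.fromBlocks_apply₁₁, Matrix.fromBlocks_apply₂₂] at h
  have hd : Uᴴ * A.toBlocks₁₁ * U = Matrix.diagonal (fun i => (p i : ℂ)) := by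
    rw [hUA, conjTranspose_mul_conj_mul hU]
  have hE : matEntropy A.toBlocks₁₁ = ∑ i, Real.negMulLog (p i) := by
    rw [hUA, matEntropy_conj_diagonal hU]
  rw [hd] at h
  simpa [hE, Matrix.toBlocks₂₂] using h

theorem abs_re_conj_diag_le {U : Matrix n n ℂ} (hU : Uᴴ * U = 1) (E : Matrix n n ℂ) (j : n) :
    |((Uᴴ * E * U) j j).re| ≤ ∑ a, ∑ b, ‖E a b‖ := by
  have hb : ∀ a, ‖U a j‖ ≤ 1 := fun a =>
    entry_norm_bound_of_unitary (Matrix.mem_unitaryGroup_iff'.2 hU) a j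
  refine (Complex.abs_re_le_norm _).trans ?_
  rw [Matrix.mul_apply, Finset.sum_comm]
  refine (norm_sum_le _ _).trans (Finset.sum_le_sum fun b _ => ?_)
  rw [norm_mul, Matrix.mul_apply]
  calc ‖∑ a, Uᴴ j a * E a b‖ * ‖U b j‖ ≤ (∑ a, ‖E a b‖) * 1 := by
        refine mul_le_mul ((norm_sum_le _ _).trans (Finset.sum_le_sum fun a _ => ?_)) (hb b)
          (norm_nonneg _) (Finset.sum_nonneg fun _ _ => norm_nonneg _)
        rw [norm_mul, Matrix.conjTranspose_apply, norm_star]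
        exact mul_le_of_le_one_left (norm_nonneg _) (hb a)
    _ = ∑ a, ‖E a b‖ := mul_one _

/-- Uniform continuity of the entropy on bounded sets of positive semidefinite matrices. -/
theorem exists_matEntropy_le_add (n : Type*) [Fintype n] [DecidableEq n] (R : ℝ) {ε : ℝ}
    (hε : 0 < ε) : ∃ δ > 0, ∀ A B : Matrix n n ℂ, A.PosSemidef → B.PosSemidef →
      A.trace.re ≤ R → B.trace.re ≤ R → ∑ a, ∑ b, ‖B a b - A a b‖ < δ →
      matEntropy B ≤ matEntropy A + ε := by
  have huc : UniformContinuousOn Real.negMulLog (Set.Icc 0 R) :=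
    isCompact_Icc.uniformContinuousOn_of_continuous Real.continuous_negMulLog.continuousOn
  rw [Metric.uniformContinuousOn_iff] at huc
  obtain ⟨δ, hδ, H⟩ := huc (ε / (Fintype.card n + 1)) (by positivity)
  refine ⟨δ, hδ, fun A B hA hB hAR hBR hd => ?_⟩
  obtain ⟨U, p, hU, hp, hAU⟩ := hA.exists_eq_conj_diagonal
  have hAd : Uᴴ * A * U = Matrix.diagonal (fun i => (p i : ℂ)) := by
    rw [hAU, conjTranspose_mul_conj_mul hU]
  have hE : matEntropy A = ∑ i, Real.negMulLog (p i) := by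
    rw [hAU, matEntropy_conj_diagonal hU]
  refine (matEntropy_le_sum_diag hB hU).trans ?_
  have hterm : ∀ j, Real.negMulLog ((Uᴴ * B * U) j j).re ≤
      Real.negMulLog (p j) + ε / (Fintype.card n + 1) := by
    intro j
    have hBp := hB.conjTranspose_mul_mul_same U
    have hApj := hA.conjTranspose_mul_mul_same U
    have h1 : ((Uᴴ * B * U) j j).re ∈ Set.Icc 0 R := ⟨hBp.re_diag_nonneg j,
      (hBp.re_diag_le_trace j).trans (by rwa [trace_conjTranspose_conj hU])⟩
    have hpe : ((Uᴴ * A * U) j j).re = p j := by rw [hAd]; simp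
    have h2 : p j ∈ Set.Icc 0 R := ⟨hp j, by
      rw [← hpe]
      exact (hApj.re_diag_le_trace j).trans (by rwa [trace_conjTranspose_conj hU])⟩
    have h3 : dist ((Uᴴ * B * U) j j).re (p j) < δ := by
      rw [Real.dist_eq, ← hpe, ← Complex.sub_re, ← Matrix.sub_apply, ← Matrix.sub_mul,
        ← Matrix.mul_sub]
      exact (abs_re_conj_diag_le hU (B - A) j).trans_lt (by simpa using hd)
    have h4 := H _ h1 _ h2 h3
    rw [Real.dist_eq] at h4
    linarith [le_abs_self (Real.negMulLog ((Uᴴ * B * U) j j).re - Real.negMulLog (p j))]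
  refine (Finset.sum_le_sum fun j _ => hterm j).trans ?_
  rw [Finset.sum_add_distrib, ← hE, Finset.sum_const, Finset.card_univ, nsmul_eq_mul]
  have : (Fintype.card n : ℝ) * (ε / (Fintype.card n + 1)) ≤ ε := by
    rw [mul_div_assoc', div_le_iff₀ (by positivity)]
    nlinarith
  linarith

theorem tendsto_matEntropy {ι : Type*} {l : Filter ι} {A : ι → Matrix n n ℂ} {B : Matrix n n ℂ}
    (hA : ∀ᶠ i in l, (A i).PosSemidef) (hB : B.PosSemidef)
    (h : ∀ a b, Filter.Tendsto (fun i => A i a b) l (nhds (B a b))) :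
    Filter.Tendsto (fun i => matEntropy (A i)) l (nhds (matEntropy B)) := by
  have htr : Filter.Tendsto (fun i => (A i).trace.re) l (nhds B.trace.re) := by
    refine (Complex.continuous_re.tendsto _).comp ?_
    exact tendsto_finsetSum _ fun a _ => h a a
  have hd : Filter.Tendsto (fun i => ∑ a, ∑ b, ‖A i a b - B a b‖) l (nhds 0) := by
    have : Filter.Tendsto (fun i => ∑ a, ∑ b, ‖A i a b - B a b‖) l
        (nhds (∑ a, ∑ b, ‖B a b - B a b‖)) :=
      tendsto_finsetSum _ fun a _ => tendsto_finsetSum _ fun b _ =>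
        ((h a b).sub tendsto_const_nhds).norm
    simpa using this
  rw [Metric.tendsto_nhds]
  intro ε hε
  obtain ⟨δ, hδ, H⟩ := exists_matEntropy_le_add n (B.trace.re + 1) (half_pos hε)
  filter_upwards [hA, htr.eventually_lt_const (lt_add_one _), hd.eventually_lt_const hδ]
    with i h1 h2 h3
  have h4 := H (A i) B h1 hB h2.le (by linarith) (by simpa only [norm_sub_rev] using h3)
  have h5 := H B (A i) hB h1 (by linarith) h2.le h3
  rw [Real.dist_eq, abs_lt]
  constructor <;> linarith

theorem tendsto_homEntropy {ι : Type*} {l : Filter ι} {A : ι → Matrix n n ℂ} {B : Matrix n n ℂ}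
    (hA : ∀ᶠ i in l, (A i).PosSemidef) (hB : B.PosSemidef)
    (h : ∀ a b, Filter.Tendsto (fun i => A i a b) l (nhds (B a b))) :
    Filter.Tendsto (fun i => homEntropy (A i)) l (nhds (homEntropy B)) := by
  refine (tendsto_matEntropy hA hB h).sub ((Real.continuous_negMulLog.tendsto _).comp ?_)
  exact (Complex.continuous_re.tendsto _).comp (tendsto_finsetSum _ fun a _ => h a a)

theorem homEntropy_smul {A : Matrix n n ℂ} (hA : A.PosSemidef) (c : ℝ) :
    homEntropy ((c : ℂ) • A) = c * homEntropy A := by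
  obtain ⟨U, p, hU, hp, rfl⟩ := hA.exists_eq_conj_diagonal
  have h1 : (c : ℂ) • (U * Matrix.diagonal (fun i => (p i : ℂ)) * Uᴴ) =
      U * Matrix.diagonal (fun i => ((c * p i : ℝ) : ℂ)) * Uᴴ := by
    have : Matrix.diagonal (fun i => ((c * p i : ℝ) : ℂ)) =
        (c : ℂ) • Matrix.diagonal (fun i => (p i : ℂ)) := by
      ext i j
      by_cases hij : i = j
      · subst hij; simp
      · simp [hij]
    rw [this, Matrix.mul_smul, Matrix.smul_mul]
  have htr : ∀ q : n → ℝ,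
      (U * Matrix.diagonal (fun i => (q i : ℂ)) * Uᴴ).trace.re = ∑ i, q i := by
    intro q
    rw [Matrix.trace_mul_comm, ← mul_assoc, hU, one_mul]
    simp [Matrix.trace]
  unfold homEntropy
  rw [h1, matEntropy_conj_diagonal hU, matEntropy_conj_diagonal hU, htr, htr, ← Finset.mul_sum]
  have h2 : ∀ i, Real.negMulLog (c * p i) = c * Real.negMulLog (p i) + p i * Real.negMulLog c := by
    intro i; rw [Real.negMulLog_mul]; ring
  simp_rw [h2]
  rw [Finset.sum_add_distrib, ← Finset.mul_sum, ← Finset.sum_mul, Real.negMulLog_mul]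
  ring

end
end

section
open scoped ComplexOrder

/-! ### Infinite matrices and the attenuator in the Fock basis -/

/-- The upper left `K × K` corner of an infinite matrix. -/
def corner (K : ℕ) (r : ℕ → ℕ → ℂ) : Matrix (Fin K) (Fin K) ℂ := Matrix.of fun i j => r i j

/-- An infinite matrix is positive semidefinite if all its corners are. -/
def IsPosKernel (r : ℕ → ℕ → ℂ) : Prop := ∀ K, (corner K r).PosSemidef

/-- The weight with which the entry `(m + l, n + l)` of the input contributes to the entry `(m, n)`
of the output of the attenuator, when `l` photons are lost. -/
noncomputable def attWeight (lam : ℝ) (m n l : ℕ) : ℝ :=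
  √((m + l).choose l) * √((n + l).choose l) * √lam ^ (m + n) * (1 - lam) ^ l

/-- The action of the attenuator on matrices in the Fock basis. -/
noncomputable def attKernel (lam : ℝ) (r : ℕ → ℕ → ℂ) (m n : ℕ) : ℂ :=
  ∑' l, (attWeight lam m n l : ℂ) * r (m + l) (n + l)

theorem IsPosKernel.weighted {r : ℕ → ℕ → ℂ} (hr : IsPosKernel r) (c : ℕ → ℝ) (l : ℕ) :
    IsPosKernel fun m n => ((c m * c n : ℝ) : ℂ) * r (m + l) (n + l) := by
  intro K
  have h := ((hr (K + l)).submatrix (fun i : Fin K => (⟨i + l, by omega⟩ : Fin (K + l)))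
    ).conjTranspose_mul_mul_same (Matrix.diagonal fun i : Fin K => ((c i : ℝ) : ℂ))
  convert h using 1
  ext i j
  rw [Matrix.mul_diagonal, Matrix.diagonal_conjTranspose, Matrix.diagonal_mul]
  simp only [corner, Matrix.of_apply, Matrix.submatrix_apply, Pi.star_apply, Complex.star_def,
    Complex.conj_ofReal, Complex.ofReal_mul]
  ring

/-- Losing `l` photons is the Kraus term `K_l r K_lᴴ` with real amplitudes, hence positive. -/
theorem attWeight_eq_mul {lam : ℝ} (h1 : lam ≤ 1) (m n l : ℕ) :
    attWeight lam m n l = (√((m + l).choose l) * √lam ^ m * √(1 - lam) ^ l) *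
      (√((n + l).choose l) * √lam ^ n * √(1 - lam) ^ l) := by
  unfold attWeight
  have : (1 - lam) ^ l = √(1 - lam) ^ l * √(1 - lam) ^ l := by
    rw [← mul_pow, Real.mul_self_sqrt (by linarith)]
  rw [this, pow_add]
  ring

theorem IsPosKernel.attWeight {r : ℕ → ℕ → ℂ} (hr : IsPosKernel r) {lam : ℝ} (h1 : lam ≤ 1)
    (l : ℕ) : IsPosKernel fun m n => (attWeight lam m n l : ℂ) * r (m + l) (n + l) := by
  simp_rw [attWeight_eq_mul h1]
  exact hr.weighted (fun m => √((m + l).choose l) * √lam ^ m * √(1 - lam) ^ l) l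

/-! ### Finitely supported matrices under the attenuator semigroup -/

/-- The infinite matrix `r` vanishes outside its `D × D` corner. -/
def SupportedBelow (D : ℕ) (r : ℕ → ℕ → ℂ) : Prop := ∀ m n, D ≤ m ∨ D ≤ n → r m n = 0

theorem attKernel_eq_sum {D : ℕ} {r : ℕ → ℕ → ℂ} (hr : SupportedBelow D r) (lam : ℝ) (m n : ℕ) :
    attKernel lam r m n =
      ∑ l ∈ Finset.range D, (attWeight lam m n l : ℂ) * r (m + l) (n + l) := by
  refine tsum_eq_sum fun l hl => ?_
  rw [Finset.mem_range, not_lt] at hl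
  rw [hr _ _ (Or.inl (by omega)), mul_zero]

theorem SupportedBelow.attKernel {D : ℕ} {r : ℕ → ℕ → ℂ} (hr : SupportedBelow D r) (lam : ℝ) :
    SupportedBelow D (attKernel lam r) := by
  intro m n h
  rw [attKernel_eq_sum hr]
  refine Finset.sum_eq_zero fun l _ => ?_
  rw [hr _ _ (by omega), mul_zero]

theorem attKernel_one (r : ℕ → ℕ → ℂ) (m n : ℕ) :
    attKernel 1 r m n = r m n := by
  unfold attKernel
  rw [tsum_eq_single 0]
  · simp [attWeight]
  · intro l hl
    simp [attWeight, hl]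

theorem corner_attKernel {D : ℕ} {r : ℕ → ℕ → ℂ} (hr : SupportedBelow D r) (lam : ℝ) (K : ℕ) :
    corner K (attKernel lam r) = ∑ l ∈ Finset.range D,
      corner K fun m n => (attWeight lam m n l : ℂ) * r (m + l) (n + l) := by
  ext i j
  rw [Matrix.sum_apply]
  simp [corner, attKernel_eq_sum hr]

theorem posDef_corner_attKernel {D : ℕ} {r : ℕ → ℕ → ℂ} (hr : SupportedBelow D r)
    (hpos : IsPosKernel r) (hD : (corner D r).PosDef) {lam : ℝ} (h0 : 0 < lam) (h1 : lam ≤ 1) :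
    (corner D (attKernel lam r)).PosDef := by
  rw [corner_attKernel hr]
  rcases D with _ | D
  · convert hD using 1
    ext i
    exact i.elim0
  rw [Finset.sum_range_succ']
  refine Matrix.PosDef.posSemidef_add
    (Matrix.posSemidef_sum _ fun l _ => hpos.attWeight h1 (l + 1) _) ?_
  -- the term without photon loss is `lam^(N/2) r lam^(N/2)`
  rw [(hpos.attWeight h1 0 _).posDef_iff_det_ne_zero]
  have : corner (D + 1) (fun m n => (attWeight lam m n 0 : ℂ) * r (m + 0) (n + 0)) =
      Matrix.diagonal (fun i : Fin (D + 1) => ((√lam : ℝ) : ℂ) ^ (i : ℕ)) * corner (D + 1) r *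
        Matrix.diagonal (fun i : Fin (D + 1) => ((√lam : ℝ) : ℂ) ^ (i : ℕ)) := by
    ext i j
    rw [Matrix.mul_diagonal, Matrix.diagonal_mul]
    simp only [corner, Matrix.of_apply, attWeight]
    simp [pow_add]
    ring
  rw [this, Matrix.det_mul, Matrix.det_mul, Matrix.det_diagonal]
  have hs : ((√lam : ℝ) : ℂ) ≠ 0 := by
    exact_mod_cast (Real.sqrt_pos.2 h0).ne'
  exact mul_ne_zero (mul_ne_zero (Finset.prod_ne_zero_iff.2 fun i _ => pow_ne_zero _ hs)
    hD.det_pos.ne') (Finset.prod_ne_zero_iff.2 fun i _ => pow_ne_zero _ hs)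

theorem sqrt_choose_succ (m l : ℕ) :
    √((m + (l + 1)).choose (l + 1)) * √(l + 1) = √(m + 1) * √((m + 1 + l).choose l) := by
  rw [← Real.sqrt_mul (by positivity), ← Real.sqrt_mul (by positivity)]
  congr 1
  have h := Nat.choose_succ_right_eq (m + (l + 1)) l
  have h2 : m + (l + 1) - l = m + 1 := by omega
  rw [h2] at h
  have h3 : m + 1 + l = m + (l + 1) := by ring
  rw [h3]
  have h4 : ((m + (l + 1)).choose (l + 1) : ℝ) * ((l + 1 : ℕ) : ℝ) =
    ((m + (l + 1)).choose l : ℝ) * ((m + 1 : ℕ) : ℝ) := by exact_mod_cast h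
  push_cast at h4
  linarith

theorem attWeight_exp (u : ℝ) (m n l : ℕ) :
    attWeight (Real.exp u) m n l = √((m + l).choose l) * √((n + l).choose l) *
      Real.exp (u * ((m + n) / 2)) * (1 - Real.exp u) ^ l := by
  unfold attWeight
  have : √(Real.exp u) ^ (m + n) = Real.exp (u * ((m + n) / 2)) := by
    rw [Real.sqrt_eq_rpow, ← Real.exp_mul, ← Real.exp_nat_mul]
    push_cast
    ring_nf
  rw [this]

theorem hasDerivAt_attWeight_exp (u : ℝ) (m n l : ℕ) :
    HasDerivAt (fun u => attWeight (Real.exp u) m n l)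
      ((m + n) / 2 * attWeight (Real.exp u) m n l -
        √((m + l).choose l) * √((n + l).choose l) * Real.exp (u * ((m + n) / 2)) *
          (l * (1 - Real.exp u) ^ (l - 1) * Real.exp u)) u := by
  simp_rw [attWeight_exp]
  have h1 : HasDerivAt (fun u : ℝ => Real.exp (u * ((m + n) / 2)))
      (Real.exp (u * ((m + n) / 2)) * (1 * ((m + n) / 2))) u :=
    ((hasDerivAt_id u).mul_const _).exp
  have h2 : HasDerivAt (fun u : ℝ => (1 - Real.exp u) ^ l)
      (l * (1 - Real.exp u) ^ (l - 1) * (-Real.exp u)) u := by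
    exact ((Real.hasDerivAt_exp u).const_sub 1).pow l
  refine ((h1.const_mul (√((m + l).choose l) * √((n + l).choose l))).fun_mul h2).congr_deriv ?_
  ring

theorem attWeight_exp_succ (u : ℝ) (m n l : ℕ) :
    √((m + (l + 1)).choose (l + 1)) * √((n + (l + 1)).choose (l + 1)) *
        Real.exp (u * ((m + n) / 2)) *
          (((l + 1 : ℕ) : ℝ) * (1 - Real.exp u) ^ l * Real.exp u) =
      √(m + 1) * √(n + 1) * attWeight (Real.exp u) (m + 1) (n + 1) l := by
  rw [attWeight_exp]
  have h1 := sqrt_choose_succ m l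
  have h2 := sqrt_choose_succ n l
  have h3 : Real.exp (u * (((m + 1 : ℕ) + (n + 1 : ℕ)) / 2)) =
      Real.exp (u * ((m + n) / 2)) * Real.exp u := by
    rw [← Real.exp_add]; push_cast; ring_nf
  have h4 : ((l + 1 : ℕ) : ℝ) = √(l + 1) * √(l + 1) := by
    rw [Real.mul_self_sqrt (by positivity)]; push_cast; ring
  rw [h3, h4]
  calc _ = (√((m + (l + 1)).choose (l + 1)) * √(l + 1)) *
      (√((n + (l + 1)).choose (l + 1)) * √(l + 1)) * Real.exp (u * ((m + n) / 2)) *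
        (1 - Real.exp u) ^ l * Real.exp u := by ring
    _ = _ := by rw [h1, h2]; ring

/-- The attenuator semigroup, in the parameter `u = ln lam`, is generated by
`ρ ↦ (N ρ + ρ N) / 2 - a ρ a†`. -/
theorem hasDerivAt_attKernel_exp {D : ℕ} {r : ℕ → ℕ → ℂ} (hr : SupportedBelow D r) (u : ℝ)
    (m n : ℕ) : HasDerivAt (fun u => attKernel (Real.exp u) r m n)
      (((m : ℂ) + n) / 2 * attKernel (Real.exp u) r m n -
        ((√(m + 1) * √(n + 1) : ℝ) : ℂ) * attKernel (Real.exp u) r (m + 1) (n + 1)) u := by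
  simp_rw [attKernel_eq_sum hr]
  have hd := HasDerivAt.fun_sum (u := Finset.range D) fun l _ =>
    ((hasDerivAt_attWeight_exp u m n l).ofReal_comp.mul_const (r (m + l) (n + l)))
  refine hd.congr_deriv ?_
  have hsecond : ∑ l ∈ Finset.range D,
      ((√((m + l).choose l) * √((n + l).choose l) * Real.exp (u * ((m + n) / 2)) *
          (l * (1 - Real.exp u) ^ (l - 1) * Real.exp u) : ℝ) : ℂ) * r (m + l) (n + l) =
      ∑ l ∈ Finset.range D, ((√(m + 1) * √(n + 1) : ℝ) : ℂ) *
        ((attWeight (Real.exp u) (m + 1) (n + 1) l : ℂ) * r (m + 1 + l) (n + 1 + l)) := by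
    rcases D with _ | D
    · simp
    rw [Finset.sum_range_succ', Finset.sum_range_succ (n := D),
      hr (m + 1 + D) _ (Or.inl (by omega))]
    simp only [Nat.cast_zero, zero_mul, mul_zero, Complex.ofReal_zero, add_zero]
    refine Finset.sum_congr rfl fun l _ => ?_
    rw [Nat.add_sub_cancel, attWeight_exp_succ, show m + (l + 1) = m + 1 + l by ring,
      show n + (l + 1) = n + 1 + l by ring]
    push_cast
    ring
  rw [Finset.mul_sum, Finset.mul_sum, ← hsecond, ← Finset.sum_sub_distrib]
  refine Finset.sum_congr rfl fun l _ => ?_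
  push_cast
  ring

theorem trace_corner (K : ℕ) (r : ℕ → ℕ → ℂ) :
    (corner K r).trace = ∑ n ∈ Finset.range K, r n n := by
  rw [Finset.sum_range]
  rfl

/-- The generator has trace zero: its diagonal telescopes. -/
theorem trace_corner_attKernel {D : ℕ} {r : ℕ → ℕ → ℂ} (hr : SupportedBelow D r) {lam : ℝ}
    (h0 : 0 < lam) : (corner D (attKernel lam r)).trace = (corner D r).trace := by
  have hder : ∀ u, HasDerivAt (fun u => (corner D (attKernel (Real.exp u) r)).trace) 0 u := by
    intro u
    simp_rw [trace_corner]
    refine (HasDerivAt.fun_sum fun n _ => hasDerivAt_attKernel_exp hr u n n).congr_deriv ?_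
    have : ∀ n : ℕ, ((n : ℂ) + n) / 2 * attKernel (Real.exp u) r n n -
        ((√(n + 1) * √(n + 1) : ℝ) : ℂ) * attKernel (Real.exp u) r (n + 1) (n + 1) =
        -(((n + 1 : ℕ) : ℂ) * attKernel (Real.exp u) r (n + 1) (n + 1) -
          (n : ℂ) * attKernel (Real.exp u) r n n) := by
      intro n
      rw [Real.mul_self_sqrt (by positivity)]
      push_cast
      ring
    simp_rw [this]
    rw [Finset.sum_neg_distrib,
      Finset.sum_range_sub (fun n : ℕ => (n : ℂ) * attKernel (Real.exp u) r n n),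
      (hr.attKernel _) D D (Or.inl le_rfl)]
    simp
  have hconst := is_const_of_deriv_eq_zero (fun u => (hder u).differentiableAt)
    (fun u => (hder u).deriv) (Real.log lam) 0
  simp only [Real.exp_log h0, Real.exp_zero] at hconst
  rw [hconst, trace_corner, trace_corner]
  exact Finset.sum_congr rfl fun n _ => attKernel_one r n n

/-! ### The entropy production of the attenuator semigroup -/

/-- The annihilation operator on the span of the first `D` Fock states. -/
noncomputable def annihilation (D : ℕ) : Matrix (Fin D) (Fin D) ℂ :=
  Matrix.of fun i j => if (j : ℕ) = i + 1 then ((√(i + 1) : ℝ) : ℂ) else 0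

theorem annihilation_mul_corner {D : ℕ} {s : ℕ → ℕ → ℂ} (hs : ∀ m n, D ≤ m → s m n = 0) :
    annihilation D * corner D s = corner D fun m n => ((√(m + 1) : ℝ) : ℂ) * s (m + 1) n := by
  ext i j
  rw [Matrix.mul_apply]
  by_cases hi : (i : ℕ) + 1 < D
  · rw [Finset.sum_eq_single ⟨i + 1, hi⟩]
    · simp [annihilation, corner]
    · intro k _ hk
      have : ¬ (k : ℕ) = i + 1 := fun h => hk (Fin.ext h)
      simp [annihilation, this]
    · simp
  · rw [Finset.sum_eq_zero]
    · simp [corner, hs (i + 1) j (by omega)]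
    · intro k _
      have : ¬ (k : ℕ) = i + 1 := by omega
      simp [annihilation, this]

theorem corner_mul_annihilation_conjTranspose {D : ℕ} {s : ℕ → ℕ → ℂ}
    (hs : ∀ m n, D ≤ n → s m n = 0) :
    corner D s * (annihilation D)ᴴ =
      corner D fun m n => ((√(n + 1) : ℝ) : ℂ) * s m (n + 1) := by
  have h := annihilation_mul_corner (D := D) (s := fun m n => star (s n m))
    (fun m n h => by rw [hs n m h, star_zero])
  have h2 := congrArg Matrix.conjTranspose h
  rw [Matrix.conjTranspose_mul] at h2
  have h3 : (corner D fun m n => star (s n m))ᴴ = corner D s := by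
    ext i j; simp [corner]
  rw [h3] at h2
  rw [h2]
  ext i j
  simp [corner]

theorem annihilation_conjTranspose_mul_self (D : ℕ) :
    (annihilation D)ᴴ * annihilation D = Matrix.diagonal fun i : Fin D => ((i : ℕ) : ℂ) := by
  ext i j
  rw [Matrix.mul_apply]
  simp only [Matrix.conjTranspose_apply, annihilation, Matrix.of_apply]
  obtain hi | ⟨i', hi⟩ : (i : ℕ) = 0 ∨ ∃ i', (i : ℕ) = i' + 1 := by
    rcases (i : ℕ) with _ | i'
    · exact Or.inl rfl
    · exact Or.inr ⟨i', rfl⟩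
  · rw [Finset.sum_eq_zero]
    · rw [Matrix.diagonal_apply]
      split_ifs with hij <;> simp [hi]
    · intro k _
      rw [if_neg (by omega)]
      simp
  · rw [Finset.sum_eq_single ⟨i', by omega⟩]
    · by_cases hij : i = j
      · subst hij
        rw [if_pos hi, Matrix.diagonal_apply_eq, hi]
        rw [Complex.star_def, Complex.conj_ofReal, ← Complex.ofReal_mul,
          Real.mul_self_sqrt (by positivity)]
        push_cast
        ring
      · have : ¬ (j : ℕ) = i' + 1 := fun h => hij (Fin.ext (hi.trans h.symm))
        rw [Matrix.diagonal_apply_ne _ hij]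
        simp [this]
    · intro k _ hk
      have : ¬ (i : ℕ) = (k : ℕ) + 1 := fun h => hk (Fin.ext (by simp; omega))
      simp [this]
    · simp

/-- The truncated commutator `[a, a†]` is at most `1`. -/
theorem posSemidef_one_sub_commutator (D : ℕ) :
    (1 - (annihilation D * (annihilation D)ᴴ - (annihilation D)ᴴ * annihilation D)).PosSemidef := by
  have : 1 - (annihilation D * (annihilation D)ᴴ - (annihilation D)ᴴ * annihilation D) =
      Matrix.diagonal fun i : Fin D => if (i : ℕ) + 1 < D then (0 : ℂ) else (i : ℕ) + 1 := by
    rw [annihilation_conjTranspose_mul_self]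
    ext i j
    rw [Matrix.sub_apply, Matrix.sub_apply, Matrix.mul_apply]
    simp only [Matrix.conjTranspose_apply, annihilation, Matrix.of_apply]
    by_cases hi : (i : ℕ) + 1 < D
    · rw [Finset.sum_eq_single ⟨i + 1, hi⟩]
      · by_cases hij : i = j
        · subst hij
          simp only [if_true, Matrix.diagonal_apply_eq, Matrix.one_apply_eq, hi]
          rw [Complex.star_def, Complex.conj_ofReal, ← Complex.ofReal_mul,
            Real.mul_self_sqrt (by positivity)]
          push_cast
          ring
        · have : ¬ (i : ℕ) = j := fun h => hij (Fin.ext h)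
          simp [this, hij]
      · intro k _ hk
        have : ¬ (k : ℕ) = i + 1 := fun h => hk (Fin.ext h)
        simp [this]
      · simp
    · rw [Finset.sum_eq_zero]
      · by_cases hij : i = j
        · subst hij
          simp [hi]
          ring
        · simp [hij]
      · intro k _
        have : ¬ (k : ℕ) = i + 1 := by omega
        simp [this]
  rw [this]
  refine Matrix.PosSemidef.diagonal fun i => ?_
  dsimp only
  split_ifs
  · exact le_rfl
  · positivity

/-- Spectral theorem for positive definite matrices, with decreasing eigenvalues. -/
theorem Matrix.PosDef.exists_eq_conj_diagonal_antitone {D : ℕ} {A : Matrix (Fin D) (Fin D) ℂ}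
    (hA : A.PosDef) : ∃ (U : Matrix (Fin D) (Fin D) ℂ) (p : Fin D → ℝ), Uᴴ * U = 1 ∧
      (∀ i, 0 < p i) ∧ Antitone p ∧ A = U * Matrix.diagonal (fun i => (p i : ℂ)) * Uᴴ := by
  obtain ⟨U, p, hU, hp, hAU⟩ : ∃ (U : Matrix (Fin D) (Fin D) ℂ) (p : Fin D → ℝ), Uᴴ * U = 1 ∧
      (∀ i, 0 < p i) ∧ A = U * Matrix.diagonal (fun i => (p i : ℂ)) * Uᴴ :=
    ⟨hA.1.eigenvectorUnitary, hA.1.eigenvalues,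
      Unitary.coe_star_mul_self hA.1.eigenvectorUnitary, hA.eigenvalues_pos,
      hA.1.spectral_theorem⟩
  set e : Equiv.Perm (Fin D) := Tuple.sort fun i => -p i
  refine ⟨U.submatrix id e, p ∘ e, ?_, fun i => hp _, ?_, ?_⟩
  · rw [Matrix.conjTranspose_submatrix,
      ← Matrix.submatrix_mul Uᴴ U e id e Function.bijective_id, hU, Matrix.submatrix_one_equiv]
  · intro i j hij
    have := Tuple.monotone_sort (fun i => -p i) hij
    simpa using this
  · have hd : Matrix.diagonal (fun i => (((p ∘ e) i : ℝ) : ℂ)) =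
        (Matrix.diagonal fun i => (p i : ℂ)).submatrix e e := by
      rw [Matrix.submatrix_diagonal_equiv]; rfl
    rw [hd, Matrix.conjTranspose_submatrix, Matrix.submatrix_mul_equiv, Matrix.submatrix_mul_equiv,
      Matrix.submatrix_id_id, hAU]

/-- The entropy production `Tr [X (-ln σ)]` along `X = (N σ + σ N) / 2 - a σ a†`, for a state `σ`
with entropy `g(y)`, is at most its value `F(y)` at the thermal state. In the eigenbasis of `σ` it
equals `∑ |a_{ij}|² p_j ln (p_i / p_j)`, and `Tr Q [a, a†] ≤ k` for the projection `Q` on the first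
`k` eigenvectors. -/
theorem entropyProduction_le {D : ℕ} {σ U : Matrix (Fin D) (Fin D) ℂ} {p : Fin D → ℝ}
    (hU : Uᴴ * U = 1) (hp : ∀ i, 0 < p i) (hanti : Antitone p)
    (hσ : σ = U * Matrix.diagonal (fun i => (p i : ℂ)) * Uᴴ) (hsum : ∑ i, p i = 1) {y : ℝ}
    (hy : 0 < y) (hH : matEntropy σ = gReal y) {X : Matrix (Fin D) (Fin D) ℂ}
    (hX : X = (2⁻¹ : ℂ) • ((annihilation D)ᴴ * annihilation D * σ +
      σ * ((annihilation D)ᴴ * annihilation D)) - annihilation D * σ * (annihilation D)ᴴ) :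
    ∑ j, ((Uᴴ * X * U) j j).re * -Real.log (p j) ≤ entropyRate y := by
  set a := annihilation D with ha
  set P : Matrix (Fin D) (Fin D) ℂ := Matrix.diagonal (fun i => (p i : ℂ)) with hP
  set b := Uᴴ * a * U with hb
  have hUU : U * Uᴴ = 1 := mul_eq_one_comm.1 hU
  have hbc : bᴴ = Uᴴ * aᴴ * U := by
    rw [hb, Matrix.conjTranspose_mul, Matrix.conjTranspose_mul, Matrix.conjTranspose_conjTranspose,
      mul_assoc]
  have hins : ∀ M N : Matrix (Fin D) (Fin D) ℂ,
      Uᴴ * (M * N) * U = (Uᴴ * M * U) * (Uᴴ * N * U) := by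
    intro M N
    rw [show (Uᴴ * M * U) * (Uᴴ * N * U) = Uᴴ * M * (U * Uᴴ) * N * U by simp only [mul_assoc], hUU,
      mul_one]
    simp only [mul_assoc]
  have hσP : Uᴴ * σ * U = P := by rw [hσ, conjTranspose_mul_conj_mul hU]
  have hXb : Uᴴ * X * U = (2⁻¹ : ℂ) • (bᴴ * b * P + P * (bᴴ * b)) - b * P * bᴴ := by
    rw [hX, Matrix.mul_sub, Matrix.sub_mul, Matrix.mul_smul, Matrix.smul_mul, Matrix.mul_add,
      Matrix.add_mul, hins, hins σ, hins aᴴ a, hins _ aᴴ, hins a σ, hσP, ← hb, ← hbc]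
  set W : Fin D → Fin D → ℝ := fun i j => Complex.normSq (b i j) with hW
  have hbb : ∀ j, (bᴴ * b) j j = ((∑ i, W i j : ℝ) : ℂ) := by
    intro j
    rw [Matrix.mul_apply, Complex.ofReal_sum]
    refine Finset.sum_congr rfl fun i _ => ?_
    rw [hW, Complex.normSq_eq_conj_mul_self]
    rfl
  have hbb' : ∀ i, (b * bᴴ) i i = ((∑ j, W i j : ℝ) : ℂ) := by
    intro j
    rw [Matrix.mul_apply, Complex.ofReal_sum]
    refine Finset.sum_congr rfl fun i _ => ?_
    rw [hW, Complex.normSq_eq_conj_mul_self, mul_comm]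
    rfl
  have hbPb : ∀ j, (b * P * bᴴ) j j = ((∑ i, W j i * p i : ℝ) : ℂ) := by
    intro j
    rw [Matrix.mul_apply, Complex.ofReal_sum]
    refine Finset.sum_congr rfl fun i _ => ?_
    rw [hP, Matrix.mul_diagonal, hW, Complex.ofReal_mul, Complex.normSq_eq_conj_mul_self,
      Matrix.conjTranspose_apply, Complex.star_def]
    ring
  have hdiag : ∀ j, ((Uᴴ * X * U) j j).re = ∑ i, W i j * p j - ∑ i, W j i * p i := by
    intro j
    rw [hXb, Matrix.sub_apply, Matrix.smul_apply, Matrix.add_apply, hbPb, hP, Matrix.mul_diagonal,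
      Matrix.diagonal_mul, hbb, ← Finset.sum_mul, smul_eq_mul]
    have : (2⁻¹ : ℂ) * (((∑ i, W i j : ℝ) : ℂ) * (p j : ℂ) + (p j : ℂ) * ((∑ i, W i j : ℝ) : ℂ)) -
        ((∑ i, W j i * p i : ℝ) : ℂ) =
        (((∑ i, W i j) * p j - ∑ i, W j i * p i : ℝ) : ℂ) := by
      push_cast
      ring
    rw [this, Complex.ofReal_re]
  have hJ : ∑ j, ((Uᴴ * X * U) j j).re * -Real.log (p j) =
      ∑ i, ∑ j, W i j * (p j * (Real.log (p i) - Real.log (p j))) := by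
    simp_rw [hdiag, sub_mul, Finset.sum_mul]
    rw [Finset.sum_sub_distrib]
    rw [Finset.sum_comm, ← Finset.sum_sub_distrib]
    refine Finset.sum_congr rfl fun i _ => ?_
    rw [← Finset.sum_sub_distrib]
    refine Finset.sum_congr rfl fun j _ => ?_
    ring
  -- pass to sequences indexed by `ℕ`
  set p' : ℕ → ℝ := fun n => if h : n < D then p ⟨n, h⟩ else 0 with hp'
  set W' : ℕ → ℕ → ℝ := fun i j =>
    if h : i < D ∧ j < D then W ⟨i, h.1⟩ ⟨j, h.2⟩ else 0 with hW'
  have hp'v : ∀ i : Fin D, p' i = p i := fun i => by simp [hp']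
  have hW'v : ∀ i j : Fin D, W' i j = W i j := fun i j => by simp [hW']
  have hp'pos : ∀ n < D, 0 < p' n := fun n hn => by simp only [hp', dif_pos hn]; exact hp _
  rw [hJ]
  have e1 : ∑ i, ∑ j, W i j * (p j * (Real.log (p i) - Real.log (p j))) =
      ∑ i ∈ Finset.range D, ∑ j ∈ Finset.range D,
        W' i j * (p' j * (Real.log (p' i) - Real.log (p' j))) := by
    simp_rw [Finset.sum_range, hp'v, hW'v]
  rw [e1]
  refine (sum_weight_mul_log_le hp'pos ?_ ?_ ?_).trans
    (sum_mul_log_le_entropyRate hp'pos ?_ hy ?_)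
  · intro m n hmn hn
    simp only [hp', dif_pos hn, dif_pos (hmn.trans_lt hn)]
    exact hanti (by simpa using hmn)
  · intro i j
    simp only [hW']
    split_ifs
    · exact Complex.normSq_nonneg _
    · exact le_rfl
  · intro k hk
    have hcomm : ∀ i, ∑ j, W i j - ∑ j, W j i ≤ 1 := by
      intro i
      have h := ((posSemidef_one_sub_commutator D).conjTranspose_mul_mul_same U).re_diag_nonneg i
      rw [← ha, Matrix.mul_sub, Matrix.mul_sub, Matrix.sub_mul, Matrix.sub_mul, hins, hins, ← hbc,
        ← hb, mul_one, hU, Matrix.sub_apply, Matrix.sub_apply, hbb, hbb',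
        Matrix.one_apply_eq, ← Complex.ofReal_sub, Complex.sub_re, Complex.one_re,
        Complex.ofReal_re] at h
      linarith
    have e2 : ∑ i ∈ Finset.range D, ∑ j ∈ Finset.range D,
        W' i j * ((if i < k then 1 else 0) - (if j < k then 1 else 0)) =
        ∑ i : Fin D, (if (i : ℕ) < k then (1 : ℝ) else 0) * (∑ j, W i j - ∑ j, W j i) := by
      simp_rw [Finset.sum_range, hW'v, mul_sub, Finset.sum_sub_distrib]
      congr 1
      · refine Finset.sum_congr rfl fun i _ => ?_
        rw [← Finset.sum_mul, mul_comm]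
      · rw [Finset.sum_comm]
        refine Finset.sum_congr rfl fun i _ => ?_
        rw [← Finset.sum_mul, mul_comm]
    rw [e2]
    calc _ ≤ ∑ i : Fin D, (if (i : ℕ) < k then (1 : ℝ) else 0) * 1 := by
          refine Finset.sum_le_sum fun i _ => mul_le_mul_of_nonneg_left (hcomm i) ?_
          split_ifs <;> norm_num
      _ = k := by
          rw [← Finset.sum_range (fun i => (if i < k then (1 : ℝ) else 0) * 1)]
          simp only [mul_one]
          rw [Finset.sum_ite, Finset.sum_const_zero, add_zero, Finset.sum_const, nsmul_eq_mul,
            mul_one]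
          congr 1
          have : (Finset.range D).filter (fun i => i < k) = Finset.range k := by
            ext i; simp only [Finset.mem_filter, Finset.mem_range]; omega
          rw [this, Finset.card_range]
  · simp_rw [Finset.sum_range, hp'v]
    exact hsum
  · simp_rw [Finset.sum_range, hp'v]
    rw [← hH, hσ, matEntropy_conj_diagonal hU]

end

section
open scoped ComplexOrder Topology
open Filter

/-! ### The entropy inequality for finitely supported states -/

/-- Along the attenuator semigroup, the right slope of the entropy in `u = ln lam` is controlled by
the entropy production `J`. Peierls' and Gibbs' inequalities bound the entropy at a later time by
the linear functional `-Tr[σ ln σ_u]`, which touches it at `u`. -/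
theorem exists_entropyProduction {D : ℕ} {r : ℕ → ℕ → ℂ} (hr : SupportedBelow D r)
    (hpos : IsPosKernel r) (hD : (corner D r).PosDef) (htr : (corner D r).trace = 1) {u : ℝ}
    (hu : u < 0) :
    ∃ J : ℝ, (∀ y, 0 < y → matEntropy (corner D (attKernel (Real.exp u) r)) = gReal y →
        J ≤ entropyRate y) ∧
      ∀ c, J < c → ∃ᶠ z in 𝓝[>] u,
        slope (fun u => matEntropy (corner D (attKernel (Real.exp u) r))) u z < c := by
  set s : ℝ → ℕ → ℕ → ℂ := fun u => attKernel (Real.exp u) r with hs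
  have hPD : ∀ v ≤ 0, (corner D (s v)).PosDef := fun v hv =>
    posDef_corner_attKernel hr hpos hD (Real.exp_pos v) (Real.exp_le_one_iff.2 hv)
  have hT : ∀ v, (corner D (s v)).trace = 1 := fun v => by
    rw [hs, trace_corner_attKernel hr (Real.exp_pos v), htr]
  obtain ⟨U, p, hU, hp, hanti, hσ⟩ := (hPD u hu.le).exists_eq_conj_diagonal_antitone
  have hsum : ∑ i, p i = 1 := by
    have h := hT u
    rw [hσ, Matrix.trace_mul_comm, ← mul_assoc, hU, one_mul, Matrix.trace_diagonal] at h
    exact_mod_cast h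
  set X : Matrix (Fin D) (Fin D) ℂ := corner D fun m n => ((m : ℂ) + n) / 2 * s u m n -
    ((√(m + 1) * √(n + 1) : ℝ) : ℂ) * s u (m + 1) (n + 1) with hX
  have hsupp : SupportedBelow D (s u) := hr.attKernel _
  have hXeq : X = (2⁻¹ : ℂ) • ((annihilation D)ᴴ * annihilation D * corner D (s u) +
      corner D (s u) * ((annihilation D)ᴴ * annihilation D)) -
        annihilation D * corner D (s u) * (annihilation D)ᴴ := by
    rw [annihilation_mul_corner fun m n h => hsupp m n (Or.inl h),
      corner_mul_annihilation_conjTranspose fun m n h => by rw [hsupp _ _ (Or.inr h), mul_zero],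
      annihilation_conjTranspose_mul_self]
    ext i j
    rw [Matrix.sub_apply, Matrix.smul_apply, Matrix.add_apply, Matrix.diagonal_mul,
      Matrix.mul_diagonal]
    simp only [hX, corner, Matrix.of_apply, smul_eq_mul]
    push_cast
    ring
  set φ : ℝ → ℝ := fun z => ∑ j, ((Uᴴ * corner D (s z) * U) j j).re * -Real.log (p j) with hφ
  have hφd : HasDerivAt φ (∑ j, ((Uᴴ * X * U) j j).re * -Real.log (p j)) u := by
    refine HasDerivAt.fun_sum fun j _ => ?_
    have h1 : HasDerivAt (fun z => (Uᴴ * corner D (s z) * U) j j) ((Uᴴ * X * U) j j) u := by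
      simp only [Matrix.mul_apply]
      refine HasDerivAt.fun_sum fun b _ => HasDerivAt.mul_const ?_ _
      refine HasDerivAt.fun_sum fun a _ => HasDerivAt.const_mul _ ?_
      exact hasDerivAt_attKernel_exp hr u a b
    have h2 := (Complex.reCLM.hasFDerivAt (x := (Uᴴ * corner D (s u) * U) j j)
      ).comp_hasDerivAt u h1
    exact h2.mul_const _
  refine ⟨_, fun y hy hH => entropyProduction_le hU hp hanti hσ hsum hy hH hXeq, fun c hc => ?_⟩
  have hslope := hasDerivAt_iff_tendsto_slope.1 hφd
  have hev : ∀ᶠ z in 𝓝[>] u, slope φ u z < c :=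
    (hslope.mono_left (nhdsWithin_mono u fun z hz => ne_of_gt hz)).eventually_lt_const hc
  have hneg : ∀ᶠ z in 𝓝[>] u, z < 0 := nhdsWithin_le_nhds (Iio_mem_nhds hu)
  refine Eventually.frequently ?_
  filter_upwards [hev, hneg, self_mem_nhdsWithin] with z h1 h2 h3
  refine lt_of_le_of_lt ?_ h1
  have h3 : u < z := h3
  rw [slope_def_field, slope_def_field]
  refine div_le_div_of_nonneg_right ?_ (by linarith)
  have hφu : φ u = matEntropy (corner D (s u)) := by
    rw [hφ, hσ, matEntropy_conj_diagonal hU]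
    refine Finset.sum_congr rfl fun j _ => ?_
    rw [hσ, conjTranspose_mul_conj_mul hU, Matrix.diagonal_apply_eq, Complex.ofReal_re,
      Real.negMulLog]
    ring
  have hPz := (hPD z h2.le).posSemidef
  have hφz : matEntropy (corner D (s z)) ≤ φ z := by
    refine (matEntropy_le_sum_diag hPz hU).trans ?_
    have hterm : ∀ j, Real.negMulLog ((Uᴴ * corner D (s z) * U) j j).re ≤
        ((Uᴴ * corner D (s z) * U) j j).re * -Real.log (p j) + p j -
          ((Uᴴ * corner D (s z) * U) j j).re := by
      intro j
      have := negMulLog_le_tangent ((hPz.conjTranspose_mul_mul_same U).re_diag_nonneg j) (hp j)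
      linarith
    refine (Finset.sum_le_sum fun j _ => hterm j).trans ?_
    have htz : ∑ j, ((Uᴴ * corner D (s z) * U) j j).re = 1 := by
      rw [← Complex.re_sum]
      have : ∑ j, (Uᴴ * corner D (s z) * U) j j = (Uᴴ * corner D (s z) * U).trace := rfl
      rw [this, trace_conjTranspose_conj hU, hT z, Complex.one_re]
    rw [Finset.sum_sub_distrib, Finset.sum_add_distrib, hsum, htz]
    simp [hφ]
  linarith

theorem exists_gReal_eq {S : ℝ} (hS : 0 ≤ S) : ∃ y, 0 ≤ y ∧ gReal y = S := by
  obtain ⟨x, hx⟩ := bijective_gFun.2 (ENNReal.ofReal S)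
  refine ⟨x.toReal, ENNReal.toReal_nonneg, ?_⟩
  unfold gFun at hx
  split_ifs at hx with h
  · exact absurd hx.symm ENNReal.ofReal_ne_top
  · exact (ENNReal.ofReal_eq_ofReal_iff (gReal_nonneg ENNReal.toReal_nonneg) hS).1 hx

theorem matEntropy_nonneg {n : Type*} [Fintype n] [DecidableEq n] {A : Matrix n n ℂ}
    (hA : A.PosSemidef) (h1 : A.trace.re ≤ 1) : 0 ≤ matEntropy A := by
  obtain ⟨U, p, hU, hp, hAU⟩ := hA.exists_eq_conj_diagonal
  have htr : A.trace.re = ∑ i, p i := by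
    rw [hAU, Matrix.trace_mul_comm, ← mul_assoc, hU, one_mul]
    simp [Matrix.trace]
  rw [hAU, matEntropy_conj_diagonal hU]
  refine Finset.sum_nonneg fun i _ => Real.negMulLog_nonneg (hp i) ?_
  exact (Finset.single_le_sum (fun i _ => hp i) (Finset.mem_univ i)).trans (htr ▸ h1)

/-- The comparison argument: with `y₀` the photon number of the thermal state having the output
entropy, the entropy at `u` stays below `g(y₀ e^(u - u₀))`, the solution of the differential
equation satisfied by thermal states. -/
theorem gReal_le_matEntropy_attKernel {D : ℕ} {r : ℕ → ℕ → ℂ} (hr : SupportedBelow D r)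
    (hpos : IsPosKernel r) (hD : (corner D r).PosDef) (htr : (corner D r).trace = 1) {lam : ℝ}
    (h0 : 0 < lam) (h1 : lam ≤ 1) {y : ℝ} (hy : 0 ≤ y) (hyE : gReal y ≤ matEntropy (corner D r)) :
    gReal (lam * y) ≤ matEntropy (corner D (attKernel lam r)) := by
  set f : ℝ → ℝ := fun u => matEntropy (corner D (attKernel (Real.exp u) r)) with hf
  set u₀ := Real.log lam with hu₀
  have hu₀0 : u₀ ≤ 0 := Real.log_nonpos h0.le h1
  have hPS : ∀ v ≤ 0, (corner D (attKernel (Real.exp v) r)).PosSemidef := fun v hv =>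
    (posDef_corner_attKernel hr hpos hD (Real.exp_pos v) (Real.exp_le_one_iff.2 hv)).posSemidef
  have hfu₀ : f u₀ = matEntropy (corner D (attKernel lam r)) := by
    rw [hf]; simp only [hu₀, Real.exp_log h0]
  have hf0 : f 0 = matEntropy (corner D r) := by
    rw [hf]
    simp only [Real.exp_zero]
    congr 1
    ext i j
    exact attKernel_one r i j
  obtain ⟨y₀, hy₀, hgy₀⟩ : ∃ y₀, 0 ≤ y₀ ∧ gReal y₀ = f u₀ := by
    refine exists_gReal_eq (matEntropy_nonneg (hPS u₀ hu₀0) ?_)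
    rw [trace_corner_attKernel hr (Real.exp_pos _), htr, Complex.one_re]
  have hcont : ContinuousOn f (Set.Icc u₀ 0) := by
    intro u hu
    refine tendsto_matEntropy ?_ (hPS u hu.2) fun a b => ?_
    · filter_upwards [self_mem_nhdsWithin] with v hv using hPS v hv.2
    · exact (hasDerivAt_attKernel_exp hr u a b).continuousAt.continuousWithinAt
  have hJ : ∀ u, ∃ J : ℝ, u < 0 → (∀ y, 0 < y → f u = gReal y → J ≤ entropyRate y) ∧
      ∀ c, J < c → ∃ᶠ z in 𝓝[>] u, slope f u z < c := by
    intro u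
    by_cases hu : u < 0
    · obtain ⟨J, hJ⟩ := exists_entropyProduction hr hpos hD htr hu
      exact ⟨J, fun _ => hJ⟩
    · exact ⟨0, fun h => absurd h hu⟩
  choose J hJ using hJ
  -- the comparison needs a strict inequality of slopes, which the perturbation by `δ` provides
  have hcomp : ∀ δ > 0, f 0 ≤ gReal ((y₀ + δ) * Real.exp ((1 + δ) * (0 - u₀))) := by
    intro δ hδ
    have hpos' : ∀ u, 0 < (y₀ + δ) * Real.exp ((1 + δ) * (u - u₀)) := fun u =>
      mul_pos (by linarith) (Real.exp_pos _)
    have hB : ∀ u, HasDerivAt (fun u => gReal ((y₀ + δ) * Real.exp ((1 + δ) * (u - u₀))))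
        ((1 + δ) * entropyRate ((y₀ + δ) * Real.exp ((1 + δ) * (u - u₀)))) u := by
      intro u
      have h1 : HasDerivAt (fun u => (y₀ + δ) * Real.exp ((1 + δ) * (u - u₀)))
          ((y₀ + δ) * (Real.exp ((1 + δ) * (u - u₀)) * ((1 + δ) * 1))) u :=
        ((((hasDerivAt_id u).sub_const u₀).const_mul (1 + δ)).exp).const_mul _
      refine ((hasDerivAt_gReal (hpos' u)).comp u h1).congr_deriv ?_
      unfold entropyRate
      ring
    refine image_le_of_liminf_slope_right_lt_deriv_boundary hcont
      (fun u hu c hc => (hJ u hu.2).2 c hc) ?_ hB ?_ (Set.right_mem_Icc.2 hu₀0)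
    · rw [← hgy₀, sub_self, mul_zero, Real.exp_zero, mul_one]
      exact strictMonoOn_gReal.monotoneOn hy₀ (by simp only [Set.mem_Ici]; linarith)
        (by linarith)
    · intro u hu hfu
      refine ((hJ u hu.2).1 _ (hpos' u) hfu).trans_lt ?_
      have := entropyRate_pos (hpos' u)
      nlinarith
  have hlim : f 0 ≤ gReal (y₀ * Real.exp (-u₀)) := by
    have hc : Continuous fun δ : ℝ => gReal ((y₀ + δ) * Real.exp ((1 + δ) * (0 - u₀))) :=
      continuous_gReal.comp (by fun_prop)
    have ht := (hc.tendsto 0).mono_left (nhdsWithin_le_nhds (s := Set.Ioi 0))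
    have := ge_of_tendsto ht (by filter_upwards [self_mem_nhdsWithin] with δ hδ using hcomp δ hδ)
    simpa using this
  rw [← hfu₀, ← hgy₀]
  have hle : y ≤ y₀ * Real.exp (-u₀) := by
    rw [← strictMonoOn_gReal.le_iff_le hy (by simp only [Set.mem_Ici]; positivity)]
    exact (hyE.trans hf0.symm.le).trans hlim
  rw [hu₀, Real.exp_neg, Real.exp_log h0, ← div_eq_mul_inv, le_div_iff₀ h0] at hle
  exact strictMonoOn_gReal.monotoneOn (by simp only [Set.mem_Ici]; positivity) hy₀ (by linarith)

/-- The entropy inequality for unnormalized states. -/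
theorem gReal_mul_trace_le_homEntropy_attKernel {D : ℕ} {r : ℕ → ℕ → ℂ} (hr : SupportedBelow D r)
    (hpos : IsPosKernel r) (hD : (corner D r).PosDef) (htr : 0 < (corner D r).trace.re) {lam : ℝ}
    (h0 : 0 < lam) (h1 : lam ≤ 1) {y : ℝ} (hy : 0 ≤ y)
    (hyE : gReal y * (corner D r).trace.re ≤ homEntropy (corner D r)) :
    gReal (lam * y) * (corner D r).trace.re ≤ homEntropy (corner D (attKernel lam r)) := by
  set t := (corner D r).trace.re with ht
  have htc : (corner D r).trace = (t : ℂ) := by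
    have h := (Complex.nonneg_iff.1 (hD.posSemidef.trace_nonneg)).2
    exact Complex.ext rfl (by rw [← h]; simp)
  set r' : ℕ → ℕ → ℂ := fun m n => ((t⁻¹ : ℝ) : ℂ) * r m n with hr'
  have hcorner : ∀ K, corner K r' = ((t⁻¹ : ℝ) : ℂ) • corner K r := fun K => rfl
  have hattr : ∀ K, corner K (attKernel lam r') = ((t⁻¹ : ℝ) : ℂ) • corner K (attKernel lam r) := by
    intro K
    ext i j
    simp only [corner, Matrix.of_apply, Matrix.smul_apply, smul_eq_mul, attKernel, hr']
    rw [← tsum_mul_left]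
    exact tsum_congr fun l => by ring
  have hti : (0 : ℂ) < ((t⁻¹ : ℝ) : ℂ) := by
    rw [Complex.zero_lt_real]; exact inv_pos.2 htr
  have hsupp' : SupportedBelow D r' := fun m n h => by simp only [hr', hr m n h, mul_zero]
  have hpos' : IsPosKernel r' := fun K => by
    rw [hcorner]; exact (hpos K).smul hti.le
  have hD' : (corner D r').PosDef := by rw [hcorner]; exact hD.smul hti
  have htr' : (corner D r').trace = 1 := by
    rw [hcorner, Matrix.trace_smul, htc, smul_eq_mul, ← Complex.ofReal_mul,
      inv_mul_cancel₀ htr.ne', Complex.ofReal_one]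
  have hhom : ∀ A : Matrix (Fin D) (Fin D) ℂ, A.trace = 1 → homEntropy A = matEntropy A := by
    intro A hA
    simp [homEntropy, hA]
  have hout : (corner D (attKernel lam r')).trace = 1 := by
    rw [trace_corner_attKernel hsupp' h0, htr']
  have hPSout := (posDef_corner_attKernel hr hpos hD h0 h1).posSemidef
  have key := gReal_le_matEntropy_attKernel hsupp' hpos' hD' htr' h0 h1 hy (by
    rw [← hhom _ htr', hcorner, homEntropy_smul hD.posSemidef, ← div_eq_inv_mul, le_div_iff₀ htr]
    exact hyE)
  rw [← hhom _ hout, hattr, homEntropy_smul hPSout, ← div_eq_inv_mul, le_div_iff₀ htr] at key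
  exact key

end

section
open scoped ComplexOrder Topology
open Filter

/-! ### Photon loss on the diagonal -/

/-- Binomial thinning preserves total mass: `p.1` photons are kept and `p.2` are lost. -/
theorem hasSum_thinning {d : ℕ → ℝ} {w lam : ℝ} (hd0 : ∀ n, 0 ≤ d n) (hd : HasSum d w)
    (h0 : 0 ≤ lam) (h1 : lam ≤ 1) :
    HasSum (fun p : ℕ × ℕ => ((p.1 + p.2).choose p.2 : ℝ) * lam ^ p.1 * (1 - lam) ^ p.2 *
      d (p.1 + p.2)) w := by
  set G : ℕ × ℕ → ℝ := fun p =>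
    if p.2 ≤ p.1 then (p.1.choose p.2 : ℝ) * lam ^ (p.1 - p.2) * (1 - lam) ^ p.2 * d p.1 else 0
    with hG
  have h1' : 0 ≤ 1 - lam := by linarith
  have hG0 : 0 ≤ G := by
    intro p
    simp only [hG, Pi.zero_apply]
    split_ifs
    · have := hd0 p.1
      positivity
    · exact le_rfl
  have hrow : ∀ k, HasSum (fun l => G (k, l)) (d k) := by
    intro k
    have hs : ∑ l ∈ Finset.range (k + 1), G (k, l) = d k := by
      have : ∀ l ∈ Finset.range (k + 1), G (k, l) =
          (1 - lam) ^ l * lam ^ (k - l) * k.choose l * d k := by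
        intro l hl
        rw [Finset.mem_range] at hl
        simp only [hG]
        rw [if_pos (by omega)]
        ring
      rw [Finset.sum_congr rfl this, ← Finset.sum_mul, ← add_pow]
      simp
    rw [← hs]
    refine hasSum_sum_of_ne_finset_zero fun l hl => ?_
    rw [Finset.mem_range] at hl
    simp only [hG]
    rw [if_neg (by omega)]
  have hGs : Summable G := by
    rw [summable_prod_of_nonneg hG0]
    refine ⟨fun k => (hrow k).summable, ?_⟩
    simp_rw [fun k => (hrow k).tsum_eq]
    exact hd.summable
  have hGw : HasSum G w := by
    have := hGs.hasSum.prod_fiberwise hrow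
    rw [hd.unique this]
    exact hGs.hasSum
  have hinj : Function.Injective fun p : ℕ × ℕ => (p.1 + p.2, p.2) := by
    rintro ⟨a, b⟩ ⟨c, d⟩ h
    simp only [Prod.mk.injEq] at h ⊢
    omega
  rw [← hinj.hasSum_iff] at hGw
  · convert hGw using 1
    funext p
    simp [hG]
  · rintro ⟨k, l⟩ h
    simp only [hG]
    rw [if_neg]
    intro hle
    exact h ⟨(k - l, l), by simp [Nat.sub_add_cancel hle]⟩

theorem attWeight_self {lam : ℝ} (h0 : 0 ≤ lam) (n l : ℕ) :
    attWeight lam n n l = ((n + l).choose l : ℝ) * lam ^ n * (1 - lam) ^ l := by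
  unfold attWeight
  rw [Real.mul_self_sqrt (by positivity), pow_add, ← mul_pow, Real.mul_self_sqrt h0]

theorem attWeight_nonneg {lam : ℝ} (h1 : lam ≤ 1) (m n l : ℕ) : 0 ≤ attWeight lam m n l := by
  have : 0 ≤ 1 - lam := by linarith
  unfold attWeight
  positivity

theorem hasSum_choose_mul_pow {x : ℝ} (hx : |x| < 1) (n : ℕ) :
    HasSum (fun l => ((n + l).choose l : ℝ) * x ^ l) (1 / (1 - x) ^ (n + 1)) := by
  have h := hasSum_choose_mul_geometric_of_norm_lt_one n (r := x) (by rwa [Real.norm_eq_abs])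
  refine h.congr_fun ?_
  intro l
  rw [add_comm l n, Nat.choose_symm_add]

theorem summable_attWeight {lam : ℝ} (h0 : 0 < lam) (h1 : lam ≤ 1) (m n : ℕ) :
    Summable fun l => attWeight lam m n l := by
  have hx : |1 - lam| < 1 := by rw [abs_lt]; constructor <;> linarith
  have hx0 : 0 ≤ 1 - lam := by linarith
  refine Summable.of_nonneg_of_le (fun l => attWeight_nonneg h1 m n l) (fun l => ?_)
    ((hasSum_choose_mul_pow hx m).summable.add (hasSum_choose_mul_pow hx n).summable)
  unfold attWeight
  have hs1 : √lam ^ (m + n) ≤ 1 :=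
    pow_le_one₀ (Real.sqrt_nonneg _) (Real.sqrt_le_one.2 h1)
  have hp : 0 ≤ (1 - lam) ^ l := by positivity
  have ha := Real.sq_sqrt (show (0 : ℝ) ≤ ((m + l).choose l : ℝ) by positivity)
  have hb := Real.sq_sqrt (show (0 : ℝ) ≤ ((n + l).choose l : ℝ) by positivity)
  have hab : √((m + l).choose l) * √((n + l).choose l) ≤
      ((m + l).choose l : ℝ) + (n + l).choose l := by
    have ha0 := Real.sqrt_nonneg ((m + l).choose l : ℝ)
    have hb0 := Real.sqrt_nonneg ((n + l).choose l : ℝ)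
    nlinarith [sq_nonneg (√((m + l).choose l : ℝ) - √((n + l).choose l : ℝ))]
  calc _ ≤ (((m + l).choose l : ℝ) + (n + l).choose l) * 1 * (1 - lam) ^ l := by gcongr
    _ = _ := by ring

theorem summable_attWeight_mul {lam : ℝ} (h0 : 0 < lam) (h1 : lam ≤ 1) {r : ℕ → ℕ → ℂ} {C : ℝ}
    (hC : ∀ m n, ‖r m n‖ ≤ C) (m n : ℕ) :
    Summable fun l => (attWeight lam m n l : ℂ) * r (m + l) (n + l) := by
  refine Summable.of_norm_bounded ((summable_attWeight h0 h1 m n).mul_right C) fun l => ?_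
  rw [norm_mul, Complex.norm_real, Real.norm_of_nonneg (attWeight_nonneg h1 m n l)]
  exact mul_le_mul_of_nonneg_left (hC _ _) (attWeight_nonneg h1 m n l)

/-! ### Limits of positive infinite matrices -/

theorem Matrix.PosSemidef.of_tendsto {ι : Type*} {l : Filter ι} [l.NeBot] {n : Type*} [Fintype n]
    {A : ι → Matrix n n ℂ} {B : Matrix n n ℂ} (hA : ∀ i, (A i).PosSemidef)
    (h : ∀ a b, Tendsto (fun i => A i a b) l (𝓝 (B a b))) : B.PosSemidef := by
  have := Complex.orderClosedTopology
  refine Matrix.PosSemidef.of_dotProduct_mulVec_nonneg ?_ fun x => ?_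
  · ext a b
    refine tendsto_nhds_unique ((Complex.continuous_conj.tendsto _).comp (h b a)) ?_
    refine (h a b).congr fun i => ?_
    exact (congrFun (congrFun (hA i).1 a) b).symm
  · have ht : Tendsto (fun i => star x ⬝ᵥ (A i).mulVec x) l (𝓝 (star x ⬝ᵥ B.mulVec x)) := by
      simp only [dotProduct, Matrix.mulVec]
      exact tendsto_finsetSum _ fun a _ => Tendsto.const_mul _
        (tendsto_finsetSum _ fun b _ => (h a b).mul_const _)
    exact ge_of_tendsto' ht fun i => (hA i).dotProduct_mulVec_nonneg x

theorem IsPosKernel.tsum {f : ℕ → ℕ → ℕ → ℂ} (hf : ∀ l, IsPosKernel (f l))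
    (hs : ∀ m n, Summable fun l => f l m n) : IsPosKernel fun m n => ∑' l, f l m n := by
  intro K
  refine Matrix.PosSemidef.of_tendsto (l := atTop) (A := fun s : Finset ℕ =>
    ∑ l ∈ s, corner K (f l)) (fun s => Matrix.posSemidef_sum _ fun l _ => hf l K) fun a b => ?_
  simp only [Matrix.sum_apply]
  exact (hs a b).hasSum

theorem IsPosKernel.attKernel {r : ℕ → ℕ → ℂ} (hr : IsPosKernel r) {lam : ℝ} (h0 : 0 < lam)
    (h1 : lam ≤ 1) {C : ℝ} (hC : ∀ m n, ‖r m n‖ ≤ C) : IsPosKernel (attKernel lam r) :=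
  IsPosKernel.tsum (fun l => hr.attWeight h1 l) (summable_attWeight_mul h0 h1 hC)

theorem IsPosKernel.diag_nonneg {r : ℕ → ℕ → ℂ} (hr : IsPosKernel r) (n : ℕ) : 0 ≤ r n n :=
  (hr (n + 1)).diag_nonneg (i := ⟨n, by omega⟩)

theorem IsPosKernel.diag_eq_re {r : ℕ → ℕ → ℂ} (hr : IsPosKernel r) (n : ℕ) :
    r n n = ((r n n).re : ℂ) :=
  Complex.ext rfl (Complex.nonneg_iff.1 (hr.diag_nonneg n)).2.symm

theorem Matrix.PosSemidef.norm_apply_le_trace {n : Type*} [Fintype n] [DecidableEq n]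
    {A : Matrix n n ℂ} (hA : A.PosSemidef) (i j : n) : ‖A i j‖ ≤ A.trace.re := by
  obtain ⟨U, p, hU, hp, hAU⟩ := hA.exists_eq_conj_diagonal
  have htr : A.trace.re = ∑ i, p i := by
    rw [hAU, Matrix.trace_mul_comm, ← mul_assoc, hU, one_mul]
    simp [Matrix.trace]
  have hb : ∀ a b, ‖U a b‖ ≤ 1 := fun a b =>
    entry_norm_bound_of_unitary (Matrix.mem_unitaryGroup_iff'.2 hU) a b
  rw [htr, hAU, Matrix.mul_apply]
  refine (norm_sum_le _ _).trans (Finset.sum_le_sum fun k _ => ?_)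
  rw [Matrix.mul_diagonal, norm_mul, norm_mul, Complex.norm_real, Real.norm_of_nonneg (hp k),
    Matrix.conjTranspose_apply, norm_star]
  have h3 := mul_le_mul (mul_le_mul (hb i k) le_rfl (hp k) zero_le_one) (hb j k) (norm_nonneg _)
    (by simpa using hp k)
  simpa using h3

theorem re_trace_corner (K : ℕ) (r : ℕ → ℕ → ℂ) :
    (corner K r).trace.re = ∑ n ∈ Finset.range K, (r n n).re := by
  rw [trace_corner, Complex.re_sum]

theorem IsPosKernel.norm_le {r : ℕ → ℕ → ℂ} (hr : IsPosKernel r) {w : ℝ}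
    (hw : HasSum (fun n => (r n n).re) w) (m n : ℕ) : ‖r m n‖ ≤ w := by
  have h := (hr (m + n + 1)).norm_apply_le_trace ⟨m, by omega⟩ ⟨n, by omega⟩
  refine h.trans ?_
  rw [re_trace_corner]
  exact sum_le_hasSum _ (fun k _ => (Complex.nonneg_iff.1 (hr.diag_nonneg k)).1) hw

theorem hasSum_attKernel_diag {r : ℕ → ℕ → ℂ} (hr : IsPosKernel r) {w lam : ℝ}
    (hw : HasSum (fun n => (r n n).re) w) (h0 : 0 < lam) (h1 : lam ≤ 1) :
    HasSum (fun n => (attKernel lam r n n).re) w := by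
  have hd0 : ∀ n, 0 ≤ (r n n).re := fun n => (Complex.nonneg_iff.1 (hr.diag_nonneg n)).1
  refine (hasSum_thinning hd0 hw h0.le h1).prod_fiberwise fun n => ?_
  have hs := summable_attWeight_mul h0 h1 (hr.norm_le hw) n n
  have := hs.hasSum.mapL Complex.reCLM
  refine this.congr_fun ?_
  intro l
  simp only [Complex.reCLM_apply, Complex.re_ofReal_mul, attWeight_self h0.le]

/-- Passing to a smaller corner is compression by a contraction. -/
theorem homEntropy_corner_mono {r : ℕ → ℕ → ℂ} (hr : IsPosKernel r) {L M : ℕ} (hLM : L ≤ M) :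
    homEntropy (corner L r) ≤ homEntropy (corner M r) := by
  set C : Matrix (Fin M) (Fin L) ℂ := Matrix.of fun i j => if (i : ℕ) = j then 1 else 0 with hC
  have hsum : ∀ (f : Fin M → ℂ) (j : Fin L), ∑ k, f k * C k j = f ⟨j, by omega⟩ := by
    intro f j
    rw [Finset.sum_eq_single ⟨j, by omega⟩]
    · simp [hC]
    · intro k _ hk
      have : ¬ (k : ℕ) = j := fun h => hk (Fin.ext h)
      simp [hC, this]
    · simp
  have h1 : corner L r = Cᴴ * corner M r * C := by
    ext i j
    rw [Matrix.mul_apply, hsum, Matrix.mul_apply]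
    have : ∀ k, Cᴴ i k = C k i := fun k => by
      simp only [Matrix.conjTranspose_apply, hC, Matrix.of_apply]
      split_ifs <;> simp
    simp_rw [this, mul_comm (C _ i), hsum]
    rfl
  rw [h1]
  refine homEntropy_conj_le (hr M) ?_
  have h2 : 1 - C * Cᴴ = Matrix.diagonal fun i : Fin M => if (i : ℕ) < L then (0 : ℂ) else 1 := by
    ext i j
    rw [Matrix.sub_apply, Matrix.mul_apply]
    by_cases hi : (i : ℕ) < L
    · rw [Finset.sum_eq_single ⟨i, hi⟩]
      · by_cases hij : i = j
        · subst hij; simp [hC, hi]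
        · have : ¬ (j : ℕ) = i := fun h => hij (Fin.ext h.symm)
          simp [hC, hij, this]
      · intro k _ hk
        have : ¬ (i : ℕ) = k := fun h => hk (Fin.ext h.symm)
        simp [hC, this]
      · simp
    · rw [Finset.sum_eq_zero]
      · by_cases hij : i = j
        · subst hij; simp [hi]
        · simp [hij]
      · intro k _
        have : ¬ (i : ℕ) = k := by omega
        simp [hC, this]
  rw [h2]
  refine Matrix.PosSemidef.diagonal fun i => ?_
  dsimp only
  split_ifs <;> simp

/-- The entropy of a larger corner is controlled by the added diagonal entries. -/
theorem matEntropy_corner_le {s : ℕ → ℕ → ℂ} (hs : IsPosKernel s) (K m : ℕ) :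
    matEntropy (corner (K + m) s) ≤ matEntropy (corner K s) +
      ∑ j ∈ Finset.range m, Real.negMulLog (s (K + j) (K + j)).re := by
  rw [← matEntropy_reindex finSumFinEquiv.symm (corner (K + m) s)]
  have hP : (Matrix.reindex finSumFinEquiv.symm finSumFinEquiv.symm
      (corner (K + m) s)).PosSemidef := (hs (K + m)).submatrix _
  refine (matEntropy_le_block hP).trans (le_of_eq ?_)
  congr 1
  rw [Finset.sum_range]
  rfl

/-! ### Damped states -/

/-- The damping `z^N r z^N` of an infinite matrix, where `N` is the photon number. -/
noncomputable def damp (z : ℝ) (r : ℕ → ℕ → ℂ) (m n : ℕ) : ℂ := ((z ^ m * z ^ n : ℝ) : ℂ) * r m n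

theorem IsPosKernel.damp {r : ℕ → ℕ → ℂ} (hr : IsPosKernel r) (z : ℝ) : IsPosKernel (damp z r) :=
  hr.weighted (fun m => z ^ m) 0

theorem norm_damp_le {r : ℕ → ℕ → ℂ} {C z : ℝ} (hC : ∀ m n, ‖r m n‖ ≤ C) (hz0 : 0 ≤ z)
    (hz1 : z ≤ 1) (m n : ℕ) : ‖damp z r m n‖ ≤ C := by
  unfold damp
  rw [norm_mul, Complex.norm_real, Real.norm_of_nonneg (by positivity)]
  have h : z ^ m * z ^ n ≤ 1 := mul_le_one₀ (pow_le_one₀ hz0 hz1) (by positivity)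
    (pow_le_one₀ hz0 hz1)
  exact (mul_le_mul h (hC m n) (norm_nonneg _) zero_le_one).trans (one_mul C).le

/-- Damping the input decreases the homogeneous entropy of the output. Since
`a^l z^N = z^l z^N a^l`, the output becomes `z^N τ z^N`, where `τ` is obtained from the undamped
output by weakening each term of its Kraus sum. -/
theorem homEntropy_attKernel_damp_le {r : ℕ → ℕ → ℂ} (hr : IsPosKernel r) {lam C z : ℝ}
    (h0 : 0 < lam) (h1 : lam ≤ 1) (hC : ∀ m n, ‖r m n‖ ≤ C) (hz0 : 0 ≤ z) (hz1 : z ≤ 1) (K : ℕ) :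
    homEntropy (corner K (attKernel lam (damp z r))) ≤ homEntropy (corner K (attKernel lam r)) := by
  have hsum := summable_attWeight_mul h0 h1 hC
  have hzl : ∀ l, z ^ (2 * l) ≤ 1 := fun l => pow_le_one₀ hz0 hz1
  set τ : ℕ → ℕ → ℂ := fun m n =>
    ∑' l, ((z ^ (2 * l) : ℝ) : ℂ) * ((attWeight lam m n l : ℂ) * r (m + l) (n + l)) with hτ
  have hscale : ∀ {c : ℝ} {k : ℕ → ℕ → ℂ}, 0 ≤ c → IsPosKernel k →
      IsPosKernel fun m n => (c : ℂ) * k m n := fun hc hk K =>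
    (hk K).smul (Complex.zero_le_real.2 hc)
  have hsumτ : ∀ m n, Summable fun l =>
      ((z ^ (2 * l) : ℝ) : ℂ) * ((attWeight lam m n l : ℂ) * r (m + l) (n + l)) := by
    intro m n
    refine Summable.of_norm_bounded (hsum m n).norm fun l => ?_
    rw [norm_mul, Complex.norm_real, Real.norm_of_nonneg (by positivity)]
    exact mul_le_of_le_one_left (norm_nonneg _) (hzl l)
  have hτpos : IsPosKernel τ :=
    IsPosKernel.tsum (fun l => hscale (by positivity) (hr.attWeight h1 l)) hsumτ
  have hdiff : IsPosKernel fun m n => attKernel lam r m n - τ m n := by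
    have : (fun m n => attKernel lam r m n - τ m n) = fun m n => ∑' l,
        ((1 - z ^ (2 * l) : ℝ) : ℂ) * ((attWeight lam m n l : ℂ) * r (m + l) (n + l)) := by
      funext m n
      rw [attKernel, hτ, ← (hsum m n).tsum_sub (hsumτ m n)]
      refine tsum_congr fun l => ?_
      push_cast
      ring
    rw [this]
    refine IsPosKernel.tsum (fun l => hscale (sub_nonneg.2 (hzl l)) (hr.attWeight h1 l)) ?_
    intro m n
    refine ((hsum m n).sub (hsumτ m n)).congr fun l => ?_
    push_cast
    ring
  set Z : Matrix (Fin K) (Fin K) ℂ := Matrix.diagonal fun i => ((z ^ (i : ℕ) : ℝ) : ℂ) with hZ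
  have hout : corner K (attKernel lam (damp z r)) = Zᴴ * corner K τ * Z := by
    ext i j
    rw [hZ, Matrix.mul_diagonal, Matrix.diagonal_conjTranspose, Matrix.diagonal_mul]
    simp only [corner, Matrix.of_apply, Pi.star_apply, Complex.star_def, Complex.conj_ofReal,
      attKernel, hτ, damp]
    rw [← tsum_mul_left, ← tsum_mul_right]
    refine tsum_congr fun l => ?_
    push_cast
    ring
  rw [hout]
  refine (homEntropy_conj_le (hτpos K) ?_).trans (homEntropy_mono (hτpos K) (hdiff K))
  have : 1 - Z * Zᴴ =
      Matrix.diagonal fun i : Fin K => ((1 - z ^ (i : ℕ) * z ^ (i : ℕ) : ℝ) : ℂ) := by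
    rw [hZ, Matrix.diagonal_conjTranspose, Matrix.diagonal_mul_diagonal, ← Matrix.diagonal_one,
      Matrix.diagonal_sub]
    congr 1
    funext i
    simp
  rw [this]
  refine Matrix.PosSemidef.diagonal fun i => ?_
  rw [Pi.zero_apply, Complex.zero_le_real, sub_nonneg]
  exact mul_le_one₀ (pow_le_one₀ hz0 hz1) (by positivity) (pow_le_one₀ hz0 hz1)

end

section
open scoped ComplexOrder Topology
open Filter

/-! ### The entropy inequality for infinite matrices -/

/-- The finitely supported, positive definite approximation of `damp z r`: the entries below `M` of
`z^N (r + 1 / (M + 1)) z^N`. -/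
noncomputable def truncatedDamp (z : ℝ) (r : ℕ → ℕ → ℂ) (M m n : ℕ) : ℂ :=
  (((if m < M then z ^ m else 0) * (if n < M then z ^ n else 0) : ℝ) : ℂ) *
    (r m n + if m = n then ((((M : ℝ) + 1)⁻¹ : ℝ) : ℂ) else 0)

theorem supportedBelow_truncatedDamp (z : ℝ) (r : ℕ → ℕ → ℂ) (M : ℕ) :
    SupportedBelow M (truncatedDamp z r M) := by
  rintro m n (h | h)
  · simp [truncatedDamp, not_lt.2 h]
  · simp [truncatedDamp, not_lt.2 h]

theorem posDef_corner_add_diagonal {r : ℕ → ℕ → ℂ} (hr : IsPosKernel r) {c : ℝ} (hc : 0 < c)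
    (K : ℕ) : (corner K fun m n => r m n + if m = n then (c : ℂ) else 0).PosDef := by
  have : (corner K fun m n => r m n + if m = n then (c : ℂ) else 0) =
      corner K r + Matrix.diagonal fun _ => (c : ℂ) := by
    ext i j
    simp [corner, Matrix.diagonal_apply, Fin.ext_iff]
  rw [this]
  exact Matrix.PosDef.posSemidef_add (hr K)
    (Matrix.PosDef.diagonal fun i => Complex.zero_lt_real.2 hc)

theorem isPosKernel_truncatedDamp {r : ℕ → ℕ → ℂ} (hr : IsPosKernel r) (z : ℝ) (M : ℕ) :
    IsPosKernel (truncatedDamp z r M) := by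
  have h : IsPosKernel fun m n => r m n + if m = n then ((((M : ℝ) + 1)⁻¹ : ℝ) : ℂ) else 0 :=
    fun K => (posDef_corner_add_diagonal hr (by positivity) K).posSemidef
  exact h.weighted (fun m => if m < M then z ^ m else 0) 0

theorem posDef_corner_truncatedDamp {r : ℕ → ℕ → ℂ} (hr : IsPosKernel r) {z : ℝ} (hz : 0 < z)
    (M : ℕ) : (corner M (truncatedDamp z r M)).PosDef := by
  rw [(isPosKernel_truncatedDamp hr z M M).posDef_iff_det_ne_zero]
  have : corner M (truncatedDamp z r M) =
      Matrix.diagonal (fun i : Fin M => ((z : ℝ) : ℂ) ^ (i : ℕ)) *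
        (corner M fun m n => r m n + if m = n then ((((M : ℝ) + 1)⁻¹ : ℝ) : ℂ) else 0) *
        Matrix.diagonal (fun i : Fin M => ((z : ℝ) : ℂ) ^ (i : ℕ)) := by
    ext i j
    rw [Matrix.mul_diagonal, Matrix.diagonal_mul]
    simp only [corner, Matrix.of_apply, truncatedDamp, i.2, j.2, if_true]
    push_cast
    ring
  rw [this, Matrix.det_mul, Matrix.det_mul, Matrix.det_diagonal]
  have hs : (z : ℂ) ≠ 0 := by exact_mod_cast hz.ne'
  exact mul_ne_zero (mul_ne_zero (Finset.prod_ne_zero_iff.2 fun i _ => pow_ne_zero _ hs)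
    (posDef_corner_add_diagonal hr (by positivity) M).det_pos.ne')
    (Finset.prod_ne_zero_iff.2 fun i _ => pow_ne_zero _ hs)

theorem norm_truncatedDamp_le {r : ℕ → ℕ → ℂ} (h1 : ∀ m n, ‖r m n‖ ≤ 1) {z : ℝ} (hz : 0 ≤ z)
    (M m n : ℕ) : ‖truncatedDamp z r M m n‖ ≤ z ^ m * z ^ n * 2 := by
  unfold truncatedDamp
  rw [norm_mul, Complex.norm_real, Real.norm_eq_abs]
  have ha : |(if m < M then z ^ m else 0) * (if n < M then z ^ n else 0)| ≤ z ^ m * z ^ n := by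
    rw [abs_of_nonneg (by positivity)]
    split_ifs <;> simp <;> positivity
  have hb : ‖r m n + if m = n then ((((M : ℝ) + 1)⁻¹ : ℝ) : ℂ) else 0‖ ≤ 2 := by
    refine (norm_add_le _ _).trans ?_
    have : ‖(if m = n then ((((M : ℝ) + 1)⁻¹ : ℝ) : ℂ) else 0)‖ ≤ 1 := by
      split_ifs
      · rw [Complex.norm_real, Real.norm_of_nonneg (by positivity)]
        exact inv_le_one_of_one_le₀ (by linarith [(Nat.cast_nonneg M : (0 : ℝ) ≤ M)])
      · simp
    linarith [h1 m n]
  exact mul_le_mul ha hb (norm_nonneg _) (by positivity)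

theorem tendsto_truncatedDamp (z : ℝ) (r : ℕ → ℕ → ℂ) (m n : ℕ) :
    Tendsto (fun M => truncatedDamp z r M m n) atTop (𝓝 (damp z r m n)) := by
  have h : Tendsto (fun M : ℕ => ((z ^ m * z ^ n : ℝ) : ℂ) *
      (r m n + ((if m = n then 1 else 0 : ℂ) * (((M : ℝ) + 1)⁻¹ : ℝ)))) atTop
      (𝓝 (((z ^ m * z ^ n : ℝ) : ℂ) * (r m n + (if m = n then 1 else 0 : ℂ) * ((0 : ℝ) : ℂ)))) := by
    refine Tendsto.const_mul _ (tendsto_const_nhds.add (Tendsto.const_mul _ ?_))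
    refine (Complex.continuous_ofReal.tendsto _).comp ?_
    exact tendsto_inv_atTop_zero.comp
      (tendsto_atTop_add_const_right _ _ tendsto_natCast_atTop_atTop)
  simp only [Complex.ofReal_zero, mul_zero, add_zero] at h
  refine h.congr' ?_
  filter_upwards [eventually_gt_atTop m, eventually_gt_atTop n] with M hm hn
  simp only [truncatedDamp, if_pos hm, if_pos hn]
  split_ifs <;> simp

theorem tendsto_trace_truncatedDamp {r : ℕ → ℕ → ℂ} {z w : ℝ} (hz0 : 0 ≤ z) (hz1 : z < 1)
    (hw : HasSum (fun n => (damp z r n n).re) w) :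
    Tendsto (fun M => (corner M (truncatedDamp z r M)).trace.re) atTop (𝓝 w) := by
  have hzz : z * z < 1 := by nlinarith
  have hgeo : Tendsto (fun M : ℕ => ∑ n ∈ Finset.range M, (z * z) ^ n) atTop
      (𝓝 (1 - z * z)⁻¹) := (hasSum_geometric_of_lt_one (by positivity) hzz).tendsto_sum_nat
  have hinv : Tendsto (fun M : ℕ => ((M : ℝ) + 1)⁻¹) atTop (𝓝 0) :=
    tendsto_inv_atTop_zero.comp (tendsto_atTop_add_const_right _ _ tendsto_natCast_atTop_atTop)
  have h := hw.tendsto_sum_nat.add (hinv.mul hgeo)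
  rw [zero_mul, add_zero] at h
  refine h.congr fun M => ?_
  rw [re_trace_corner, Finset.mul_sum, ← Finset.sum_add_distrib]
  refine Finset.sum_congr rfl fun n hn => ?_
  rw [Finset.mem_range] at hn
  simp only [truncatedDamp, damp, if_pos hn, if_true]
  rw [Complex.re_ofReal_mul, Complex.re_ofReal_mul, Complex.add_re, Complex.ofReal_re, mul_pow]
  ring

theorem tendsto_attKernel_truncatedDamp {r : ℕ → ℕ → ℂ} (hb : ∀ m n, ‖r m n‖ ≤ 1) {z lam : ℝ}
    (hz0 : 0 ≤ z) (hz1 : z ≤ 1) (h0 : 0 < lam) (h1 : lam ≤ 1) (m n : ℕ) :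
    Tendsto (fun M => attKernel lam (truncatedDamp z r M) m n) atTop
      (𝓝 (attKernel lam (damp z r) m n)) := by
  refine tendsto_tsum_of_dominated_convergence ((summable_attWeight h0 h1 m n).mul_right 2)
    (fun l => (tendsto_truncatedDamp z r (m + l) (n + l)).const_mul _)
    (Eventually.of_forall fun M l => ?_)
  rw [norm_mul, Complex.norm_real, Real.norm_of_nonneg (attWeight_nonneg h1 m n l)]
  refine mul_le_mul_of_nonneg_left ((norm_truncatedDamp_le hb hz0 M _ _).trans ?_)
    (attWeight_nonneg h1 m n l)
  have : z ^ (m + l) * z ^ (n + l) ≤ 1 := mul_le_one₀ (pow_le_one₀ hz0 hz1) (by positivity)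
    (pow_le_one₀ hz0 hz1)
  linarith

/-- The photon number distribution of the output decays geometrically, uniformly in the
truncation, and hence so does its entropy. -/
theorem exists_attKernel_truncatedDamp_diag_le {r : ℕ → ℕ → ℂ} (hr : IsPosKernel r)
    (hb : ∀ m n, ‖r m n‖ ≤ 1) {z lam : ℝ} (hz0 : 0 ≤ z) (hz1 : z < 1) (h0 : 0 < lam)
    (h1 : lam ≤ 1) : ∃ B q : ℝ, 0 ≤ B ∧ 0 ≤ q ∧ q < 1 ∧ ∀ M n,
      Real.negMulLog (attKernel lam (truncatedDamp z r M) n n).re ≤ B * q ^ n := by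
  set x := (1 - lam) * (z * z) with hx
  have hlam' : 0 ≤ 1 - lam := by linarith
  have hzz : z * z < 1 := by nlinarith
  have hzz0 : 0 ≤ z * z := by positivity
  have hx0 : 0 ≤ x := by positivity
  have hx1 : x < 1 := by nlinarith
  have h1x : 0 < 1 - x := by linarith
  set y := lam * (z * z) / (1 - x) with hy
  have hy0 : 0 ≤ y := by positivity
  have hy1 : y < 1 := by rw [hy, div_lt_one h1x]; nlinarith
  refine ⟨√(2 / (1 - x)), √y, Real.sqrt_nonneg _, Real.sqrt_nonneg _, ?_, fun M n => ?_⟩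
  · rw [Real.sqrt_lt' one_pos]; simpa using hy1
  have hb2 : ∀ m n, ‖truncatedDamp z r M m n‖ ≤ 2 := fun m n =>
    (norm_truncatedDamp_le hb hz0 M m n).trans (by
      have : z ^ m * z ^ n ≤ 1 := mul_le_one₀ (pow_le_one₀ hz0 hz1.le) (by positivity)
        (pow_le_one₀ hz0 hz1.le)
      linarith)
  have hs := (summable_attWeight_mul h0 h1 hb2 n n).hasSum.mapL Complex.reCLM
  have hgeo := (hasSum_choose_mul_pow (x := x) (by rwa [abs_of_nonneg hx0]) n).mul_left
    (2 * (lam * (z * z)) ^ n)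
  have hle : (attKernel lam (truncatedDamp z r M) n n).re ≤
      2 * (lam * (z * z)) ^ n * (1 / (1 - x) ^ (n + 1)) := by
    refine hasSum_le (fun l => ?_) hs hgeo
    simp only [Complex.reCLM_apply]
    rw [Complex.re_ofReal_mul, attWeight_self h0.le]
    have hre : (truncatedDamp z r M (n + l) (n + l)).re ≤ z ^ (n + l) * z ^ (n + l) * 2 :=
      (Complex.re_le_norm _).trans (norm_truncatedDamp_le hb hz0 M _ _)
    refine (mul_le_mul_of_nonneg_left hre (by positivity)).trans (le_of_eq ?_)
    rw [hx]
    simp only [mul_pow, pow_add]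
    ring
  have h00 : 0 ≤ (attKernel lam (truncatedDamp z r M) n n).re := by
    have := ((isPosKernel_truncatedDamp hr z M).attKernel h0 h1 hb2).diag_nonneg n
    exact (Complex.nonneg_iff.1 this).1
  refine (negMulLog_le_sqrt h00).trans ((Real.sqrt_le_sqrt hle).trans (le_of_eq ?_))
  rw [show 2 * (lam * (z * z)) ^ n * (1 / (1 - x) ^ (n + 1)) = 2 / (1 - x) * y ^ n by
      rw [hy, div_pow, pow_succ]; field_simp, Real.sqrt_mul (by positivity)]
  congr 1
  rw [Real.sqrt_eq_iff_mul_self_eq (by positivity) (by positivity), ← mul_pow,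
    Real.mul_self_sqrt hy0]

theorem hasSum_damp {r : ℕ → ℕ → ℂ} (hr : IsPosKernel r) (hsum : HasSum (fun n => (r n n).re) 1)
    {z : ℝ} (hz0 : 0 ≤ z) (hz1 : z ≤ 1) :
    HasSum (fun n => (damp z r n n).re) (∑' n, z ^ n * z ^ n * (r n n).re) := by
  have : (fun n => (damp z r n n).re) = fun n => z ^ n * z ^ n * (r n n).re := by
    funext n
    rw [damp, Complex.re_ofReal_mul]
  rw [this]
  refine (Summable.of_nonneg_of_le (fun n => ?_) (fun n => ?_) hsum.summable).hasSum
  · exact mul_nonneg (by positivity) (Complex.nonneg_iff.1 (hr.diag_nonneg n)).1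
  · exact mul_le_of_le_one_left (Complex.nonneg_iff.1 (hr.diag_nonneg n)).1
      (mul_le_one₀ (pow_le_one₀ hz0 hz1) (by positivity) (pow_le_one₀ hz0 hz1))

/-- The entropy inequality for a damped state, as a limit of the finitely supported case. The
hypotheses compare the input after damping with the output before damping, as damping can only
decrease the homogeneous entropy of the output. -/
theorem gReal_mul_le_of_damp {r : ℕ → ℕ → ℂ} (hr : IsPosKernel r)
    (hsum : HasSum (fun n => (r n n).re) 1) {lam z w y S : ℝ} (h0 : 0 < lam) (h1 : lam ≤ 1)
    (hz0 : 0 < z) (hz1 : z < 1) (hw : HasSum (fun n => (damp z r n n).re) w) (hy : 0 ≤ y) {L : ℕ}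
    (hL : gReal y * w < homEntropy (corner L (damp z r)))
    (hS : ∀ K, homEntropy (corner K (attKernel lam r)) ≤ S) : gReal (lam * y) * w ≤ S := by
  have hb : ∀ m n, ‖r m n‖ ≤ 1 := hr.norm_le hsum
  have hb2 : ∀ M m n, ‖truncatedDamp z r M m n‖ ≤ 2 := fun M m n =>
    (norm_truncatedDamp_le hb hz0.le M m n).trans (by
      have : z ^ m * z ^ n ≤ 1 := mul_le_one₀ (pow_le_one₀ hz0.le hz1.le) (by positivity)
        (pow_le_one₀ hz0.le hz1.le)
      linarith)
  have hTr := tendsto_trace_truncatedDamp hz0.le hz1 hw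
  obtain ⟨B, q, hB, hq0, hq1, htail⟩ :=
    exists_attKernel_truncatedDamp_diag_le hr hb hz0.le hz1 h0 h1
  have hposM := fun M => isPosKernel_truncatedDamp hr z M
  have hposOut : ∀ M, IsPosKernel (attKernel lam (truncatedDamp z r M)) := fun M =>
    (hposM M).attKernel h0 h1 (hb2 M)
  have hposOutz : IsPosKernel (attKernel lam (damp z r)) :=
    (hr.damp z).attKernel h0 h1 (norm_damp_le hb hz0.le hz1.le)
  -- the inequality for the truncated states, with a tail bound beyond the corner of size `K`
  have hfin : ∀ K, ∀ᶠ M in atTop, gReal (lam * y) * (corner M (truncatedDamp z r M)).trace.re ≤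
      matEntropy (corner K (attKernel lam (truncatedDamp z r M))) + B * q ^ K * (1 - q)⁻¹ -
        Real.negMulLog (corner M (truncatedDamp z r M)).trace.re := by
    intro K
    have hLM : Tendsto (fun M => homEntropy (corner L (truncatedDamp z r M))) atTop
        (𝓝 (homEntropy (corner L (damp z r)))) :=
      tendsto_homEntropy (Eventually.of_forall fun M => hposM M L) (hr.damp z L)
        fun a b => tendsto_truncatedDamp z r a b
    have hev := ((hTr.const_mul (gReal y)).eventually_lt hLM hL)
    filter_upwards [hev, eventually_ge_atTop L, eventually_ge_atTop K, eventually_gt_atTop 0]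
      with M hM hML hMK hM0
    have : Nonempty (Fin M) := ⟨⟨0, hM0⟩⟩
    have hPD := posDef_corner_truncatedDamp hr hz0 M
    have hsupp := supportedBelow_truncatedDamp z r M
    have key := gReal_mul_trace_le_homEntropy_attKernel hsupp (hposM M) hPD
      (Complex.pos_iff.1 hPD.trace_pos).1 h0 h1 hy
      (hM.le.trans (homEntropy_corner_mono (hposM M) hML))
    refine key.trans ?_
    unfold homEntropy
    rw [trace_corner_attKernel hsupp h0]
    obtain ⟨m, rfl⟩ := Nat.exists_eq_add_of_le hMK
    have h3 := matEntropy_corner_le (hposOut (K + m)) K m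
    have h4 : ∑ j ∈ Finset.range m,
        Real.negMulLog (attKernel lam (truncatedDamp z r (K + m)) (K + j) (K + j)).re ≤
        B * q ^ K * (1 - q)⁻¹ := by
      refine (Finset.sum_le_sum fun j _ => htail (K + m) (K + j)).trans ?_
      have h5 := sum_le_hasSum (Finset.range m) (fun j _ => by positivity)
        (hasSum_geometric_of_lt_one hq0 hq1)
      have h6 := mul_le_mul_of_nonneg_left h5 (show 0 ≤ B * q ^ K by positivity)
      rw [Finset.mul_sum] at h6
      refine (le_of_eq ?_).trans h6
      exact Finset.sum_congr rfl fun j _ => by rw [pow_add]; ring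
    linarith
  have hK : ∀ K, gReal (lam * y) * w ≤
      S + Real.negMulLog (corner K (attKernel lam (damp z r))).trace.re +
        B * q ^ K * (1 - q)⁻¹ - Real.negMulLog w := by
    intro K
    have hE : Tendsto (fun M => matEntropy (corner K (attKernel lam (truncatedDamp z r M)))) atTop
        (𝓝 (matEntropy (corner K (attKernel lam (damp z r))))) :=
      tendsto_matEntropy (Eventually.of_forall fun M => hposOut M K) (hposOutz K)
        fun a b => tendsto_attKernel_truncatedDamp hb hz0.le hz1.le h0 h1 a b
    have hlim := le_of_tendsto_of_tendsto (hTr.const_mul (gReal (lam * y)))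
      ((hE.add_const (B * q ^ K * (1 - q)⁻¹)).sub
        ((Real.continuous_negMulLog.tendsto w).comp hTr)) (hfin K)
    have hdamp := (homEntropy_attKernel_damp_le hr h0 h1 hb hz0.le hz1.le K).trans (hS K)
    unfold homEntropy at hdamp
    linarith
  have htrK : Tendsto (fun K => (corner K (attKernel lam (damp z r))).trace.re) atTop (𝓝 w) := by
    simp_rw [re_trace_corner]
    exact (hasSum_attKernel_diag (hr.damp z) hw h0 h1).tendsto_sum_nat
  have hlim := ((((Real.continuous_negMulLog.tendsto w).comp htrK).const_add S).add
    (((tendsto_pow_atTop_nhds_zero_of_lt_one hq0 hq1).const_mul B).mul_const (1 - q)⁻¹)).sub_const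
      (Real.negMulLog w)
  have := ge_of_tendsto' hlim hK
  simpa using this

/-- The entropy inequality for an infinite matrix, in terms of the homogeneous entropies of the
corners. The damping parameter `z` tends to one. -/
theorem gReal_le_of_homEntropy_corner {r : ℕ → ℕ → ℂ} (hr : IsPosKernel r)
    (hsum : HasSum (fun n => (r n n).re) 1) {lam y S : ℝ} (h0 : 0 < lam) (h1 : lam ≤ 1)
    (hy : 0 ≤ y) {L : ℕ} (hL : gReal y < homEntropy (corner L r))
    (hS : ∀ K, homEntropy (corner K (attKernel lam r)) ≤ S) : gReal (lam * y) ≤ S := by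
  have hd0 : ∀ n, 0 ≤ (r n n).re := fun n => (Complex.nonneg_iff.1 (hr.diag_nonneg n)).1
  have hIoo : ∀ᶠ z : ℝ in 𝓝[<] 1, 0 < z ∧ z < 1 := by
    filter_upwards [Ioo_mem_nhdsLT (show (0 : ℝ) < 1 from one_pos)] with z hz using hz
  have hpow : ∀ n : ℕ, Tendsto (fun z : ℝ => z ^ n) (𝓝[<] 1) (𝓝 1) := fun n => by
    have : Tendsto (fun z : ℝ => z ^ n) (𝓝 1) (𝓝 (1 ^ n)) := (continuous_pow n).tendsto 1
    rw [one_pow] at this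
    exact this.mono_left nhdsWithin_le_nhds
  have hw : Tendsto (fun z : ℝ => ∑' n, z ^ n * z ^ n * (r n n).re) (𝓝[<] 1) (𝓝 1) := by
    have h := tendsto_tsum_of_dominated_convergence (𝓕 := 𝓝[<] (1 : ℝ))
      (f := fun z n => z ^ n * z ^ n * (r n n).re) (g := fun n => (r n n).re) hsum.summable
      (fun n => by simpa using ((hpow n).mul (hpow n)).mul_const (r n n).re) ?_
    · rwa [hsum.tsum_eq] at h
    · filter_upwards [hIoo] with z hz n
      rw [Real.norm_of_nonneg (mul_nonneg (by have := hz.1; positivity) (hd0 n))]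
      exact mul_le_of_le_one_left (hd0 n) (mul_le_one₀ (pow_le_one₀ hz.1.le hz.2.le)
        (by have := hz.1; positivity) (pow_le_one₀ hz.1.le hz.2.le))
  have hE : Tendsto (fun z : ℝ => homEntropy (corner L (damp z r))) (𝓝[<] 1)
      (𝓝 (homEntropy (corner L r))) := by
    refine tendsto_homEntropy (Eventually.of_forall fun z => hr.damp z L) (hr L) fun a b => ?_
    have h := ((Complex.continuous_ofReal.tendsto (1 * 1)).comp
      ((hpow a).mul (hpow b))).mul_const (r a b)
    simpa [corner, damp] using h
  have hlt : ∀ᶠ z : ℝ in 𝓝[<] 1, gReal y * (∑' n, z ^ n * z ^ n * (r n n).re) <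
      homEntropy (corner L (damp z r)) :=
    (hw.const_mul (gReal y)).eventually_lt hE (by rwa [mul_one])
  have hev : ∀ᶠ z : ℝ in 𝓝[<] 1,
      gReal (lam * y) * (∑' n, z ^ n * z ^ n * (r n n).re) ≤ S := by
    filter_upwards [hIoo, hlt] with z hz hzL
    exact gReal_mul_le_of_damp hr hsum h0 h1 hz.1 hz.2 (hasSum_damp hr hsum hz.1.le hz.2.le) hy
      hzL hS
  have := le_of_tendsto (hw.const_mul (gReal (lam * y))) hev
  rwa [mul_one] at this

end

section
open scoped ComplexOrder Topology
open Filter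

/-! ### Functional calculus of positive operators -/

theorem re_inner_le_of_le {H : Type*} [NormedAddCommGroup H] [InnerProductSpace ℂ H]
    {S T : H →L[ℂ] H} (h : S ≤ T) (x : H) :
    (⟪x, S x⟫_ℂ).re ≤ (⟪x, T x⟫_ℂ).re := by
  have := ((ContinuousLinearMap.le_def S T).1 h).re_inner_nonneg_right x
  rw [sub_apply, inner_sub_right, map_sub] at this
  exact sub_nonneg.1 this

section
variable {H : Type*} [NormedAddCommGroup H] [InnerProductSpace ℂ H] [CompleteSpace H]

/-- A self-adjoint square root. -/
theorem ContinuousLinearMap.IsPositive.exists_sqrt {T : H →L[ℂ] H} (hT : T.IsPositive) :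
    ∃ s : H →L[ℂ] H, (∀ x y, ⟪s x, y⟫_ℂ = ⟪x, s y⟫_ℂ) ∧ ∀ x, s (s x) = T x := by
  have h0 : 0 ≤ T := (ContinuousLinearMap.nonneg_iff_isPositive T).2 hT
  have hs : (CFC.sqrt T).IsPositive :=
    (ContinuousLinearMap.nonneg_iff_isPositive _).1 (CFC.sqrt_nonneg T)
  refine ⟨CFC.sqrt T, fun x y => hs.isSymmetric x y, fun x => ?_⟩
  exact congrArg (fun A : H →L[ℂ] H => A x) (CFC.sqrt_mul_sqrt_self T h0)

theorem spectrum_nonneg_of_isPositive {ρ : H →L[ℂ] H} (hρ : ρ.IsPositive) {x : ℝ}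
    (hx : x ∈ spectrum ℝ ρ) : 0 ≤ x :=
  spectrum_nonneg_of_nonneg ((ContinuousLinearMap.nonneg_iff_isPositive ρ).2 hρ) hx

theorem cfc_affine {ρ : H →L[ℂ] H} (hρ : IsSelfAdjoint ρ) (α β : ℝ) :
    cfc (fun x : ℝ => α * x + β) ρ = (α : ℂ) • ρ + (β : ℂ) • (1 : H →L[ℂ] H) := by
  rw [cfc_add_const β (fun x : ℝ => α * x) ρ, cfc_const_mul_id α ρ]
  rfl

theorem cfc_quadratic {ρ : H →L[ℂ] H} (hρ : IsSelfAdjoint ρ) (α β : ℝ) :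
    cfc (fun x : ℝ => α * x - β * x ^ 2) ρ = (α : ℂ) • ρ - (β : ℂ) • (ρ * ρ) := by
  rw [cfc_sub (fun x : ℝ => α * x) (fun x : ℝ => β * x ^ 2) ρ, cfc_const_mul_id α ρ,
    cfc_const_mul β (fun x : ℝ => x ^ 2) ρ, cfc_pow_id ρ 2, pow_two]
  rfl

/-- Jensen's inequality for `-x ln x` in a vector state. -/
theorem re_inner_entropyOperator_le {ρ : H →L[ℂ] H} (hρ : ρ.IsPositive) {φ : H}
    (hφ : ‖φ‖ = 1) : (⟪φ, entropyOperator ρ φ⟫_ℂ).re ≤ Real.negMulLog (⟪φ, ρ φ⟫_ℂ).re := by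
  set a := (⟪φ, ρ φ⟫_ℂ).re with ha
  have ha0 : 0 ≤ a := hρ.re_inner_nonneg_right φ
  have key : ∀ b > 0, (⟪φ, entropyOperator ρ φ⟫_ℂ).re ≤ (-Real.log b - 1) * a + b := by
    intro b hb
    have hle : entropyOperator ρ ≤ cfc (fun x : ℝ => (-Real.log b - 1) * x + b) ρ := by
      refine cfc_mono (fun x hx => ?_) (Real.continuous_negMulLog.continuousOn) (by fun_prop)
      have := negMulLog_le_tangent (spectrum_nonneg_of_isPositive hρ hx) hb
      linarith
    refine (re_inner_le_of_le hle φ).trans (le_of_eq ?_)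
    rw [cfc_affine hρ.isSelfAdjoint]
    simp only [add_apply, smul_apply,
      one_apply_eq_self, inner_add_right, inner_smul_right, Complex.add_re,
      Complex.re_ofReal_mul, inner_self_eq_norm_sq_to_K, hφ]
    simp [ha]
  rcases ha0.eq_or_lt with h | h
  · rw [← h, Real.negMulLog_zero]
    refine le_of_forall_pos_le_add fun b hb => ?_
    have := key b hb
    rw [← h] at this
    linarith
  · refine (key a h).trans (le_of_eq ?_)
    unfold Real.negMulLog
    ring

/-- The parabola `(1 - ln b) x - x² / b` lies below `-x ln x` and touches it to first order at
`b`. -/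
theorem le_re_inner_entropyOperator {ρ : H →L[ℂ] H} (hρ : ρ.IsPositive) (φ : H) {b : ℝ}
    (hb : 0 < b) : (1 - Real.log b) * (⟪φ, ρ φ⟫_ℂ).re - b⁻¹ * ‖ρ φ‖ ^ 2 ≤
      (⟪φ, entropyOperator ρ φ⟫_ℂ).re := by
  have hle : cfc (fun x : ℝ => (1 - Real.log b) * x - b⁻¹ * x ^ 2) ρ ≤ entropyOperator ρ := by
    refine cfc_mono (fun x hx => ?_) (by fun_prop) (Real.continuous_negMulLog.continuousOn)
    rcases (spectrum_nonneg_of_isPositive hρ hx).eq_or_lt with rfl | hx0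
    · simp
    · have h1 := Real.log_le_sub_one_of_pos (show 0 < x / b by positivity)
      rw [Real.log_div hx0.ne' hb.ne'] at h1
      have h2 := mul_le_mul_of_nonneg_left h1 hx0.le
      have h3 : x * (x / b - 1) = b⁻¹ * x ^ 2 - x := by field_simp
      unfold Real.negMulLog
      linarith
  refine le_trans (le_of_eq ?_) (re_inner_le_of_le hle φ)
  rw [cfc_quadratic hρ.isSelfAdjoint]
  have h4 : ⟪φ, ρ (ρ φ)⟫_ℂ = ((‖ρ φ‖ ^ 2 : ℝ) : ℂ) := by
    rw [← show ⟪ρ φ, ρ φ⟫_ℂ = ⟪φ, ρ (ρ φ)⟫_ℂ from hρ.isSymmetric φ (ρ φ),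
      inner_self_eq_norm_sq_to_K]
    norm_cast
  have h5 : (ρ * ρ) φ = ρ (ρ φ) := rfl
  simp only [sub_apply, smul_apply, h5, inner_sub_right, inner_smul_right, Complex.sub_re,
    Complex.re_ofReal_mul, h4, Complex.ofReal_re]

theorem ContinuousLinearMap.IsPositive.entropyOperator_of_norm_le_one {ρ : H →L[ℂ] H}
    (hρ : ρ.IsPositive) (h1 : ‖ρ‖ ≤ 1) : (entropyOperator ρ).IsPositive := by
  rw [← ContinuousLinearMap.nonneg_iff_isPositive]
  refine cfc_nonneg fun x hx => Real.negMulLog_nonneg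
    (spectrum_nonneg_of_isPositive hρ hx) ?_
  have h2 := spectrum.norm_le_norm_mul_of_mem hx
  rw [Real.norm_eq_abs] at h2
  refine (le_abs_self x).trans (h2.trans (mul_le_one₀ h1 (norm_nonneg _) ?_))
  exact ContinuousLinearMap.norm_id_le

end

/-! ### Matrix entries of operators -/

/-- The matrix of an operator in the Fock basis. -/
noncomputable def fockMatrix (T : Mode →L[ℂ] Mode) (m n : ℕ) : ℂ := ⟪ket m, T (ket n)⟫_ℂ

theorem inner_ket_left (n : ℕ) (x : Mode) : ⟪ket n, x⟫_ℂ = x n := by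
  unfold ket
  rw [lp.inner_single_left]
  simp

theorem inner_ket_ket (m n : ℕ) : ⟪ket m, ket n⟫_ℂ = if m = n then 1 else 0 := by
  rw [inner_ket_left]
  unfold ket
  rw [lp.single_apply]
  split_ifs <;> simp_all

theorem hasSum_norm_inner_ket_sq (x : Mode) :
    HasSum (fun n => ‖⟪ket n, x⟫_ℂ‖ ^ 2) (‖x‖ ^ 2) := by
  have h := lp.hasSum_norm (p := 2) (by norm_num) x
  simp_rw [inner_ket_left]
  simpa using h

theorem ext_inner_ket {x y : Mode} (h : ∀ n, ⟪ket n, x⟫_ℂ = ⟪ket n, y⟫_ℂ) : x = y := by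
  ext n
  simpa [inner_ket_left] using h n

theorem ContinuousLinearMap.ext_fockMatrix {S T : Mode →L[ℂ] Mode}
    (h : fockMatrix S = fockMatrix T) : S = T := by
  have hket : ∀ n, S (ket n) = T (ket n) := fun n =>
    ext_inner_ket fun m => congrFun (congrFun h m) n
  have hsub : ∀ x, S x = T x := by
    intro x
    have hx := lp.hasSum_single (p := 2) (by norm_num) x
    have e : ∀ n, lp.single 2 n (x n) = x n • ket n := by
      intro n
      unfold ket
      rw [← lp.single_smul]
      simp
    have h1 := hx.mapL S
    have h2 := hx.mapL T
    simp only [e, map_smul, hket] at h1 h2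
    exact h1.unique h2
  exact ContinuousLinearMap.ext hsub

/-- The vector of the mode with given first `K` coordinates, the others being zero. -/
noncomputable def embed {K : ℕ} (v : Fin K → ℂ) : Mode := ∑ i : Fin K, v i • ket i

theorem inner_embed_apply {K : ℕ} (T : Mode →L[ℂ] Mode) (v w : Fin K → ℂ) :
    ⟪embed v, T (embed w)⟫_ℂ = star v ⬝ᵥ (corner K (fockMatrix T)).mulVec w := by
  simp only [embed, sum_inner, map_sum, map_smul, inner_sum, inner_smul_left, inner_smul_right,
    dotProduct, Matrix.mulVec, Finset.mul_sum]
  rw [Finset.sum_comm]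
  refine Finset.sum_congr rfl fun i _ => Finset.sum_congr rfl fun j _ => ?_
  simp only [fockMatrix, corner, Matrix.of_apply, Pi.star_apply, Complex.star_def]
  ring

theorem inner_embed_col {K : ℕ} (T : Mode →L[ℂ] Mode) (U : Matrix (Fin K) (Fin K) ℂ)
    (i j : Fin K) : ⟪embed fun k => U k i, T (embed fun k => U k j)⟫_ℂ =
      (Uᴴ * corner K (fockMatrix T) * U) i j := by
  rw [inner_embed_apply, mul_assoc]
  rfl

theorem fockMatrix_isPosKernel {T : Mode →L[ℂ] Mode} (hT : T.IsPositive) :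
    IsPosKernel (fockMatrix T) := by
  intro K
  refine Matrix.PosSemidef.of_dotProduct_mulVec_nonneg ?_ fun v => ?_
  · ext i j
    simp only [corner, Matrix.conjTranspose_apply, Matrix.of_apply, fockMatrix, Complex.star_def]
    rw [inner_conj_symm]
    exact hT.isSymmetric _ _
  · rw [← inner_embed_apply]
    exact hT.inner_nonneg_right _

theorem IsState.hasSum_re {ρ : Mode →L[ℂ] Mode} (hρ : IsState ρ) :
    HasSum (fun n => (fockMatrix ρ n n).re) 1 := by
  have := hρ.trace_eq_one.mapL Complex.reCLM
  simpa [fockMatrix] using this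

/-! ### Positive operators of finite trace -/

theorem fockMatrix_diag_eq_norm_sq {T s : Mode →L[ℂ] Mode}
    (hs : ∀ x y, ⟪s x, y⟫_ℂ = ⟪x, s y⟫_ℂ) (hsT : ∀ x, s (s x) = T x) (n : ℕ) :
    (fockMatrix T n n).re = ‖s (ket n)‖ ^ 2 := by
  rw [fockMatrix, ← hsT, ← hs, inner_self_eq_norm_sq_to_K]
  norm_cast

/-- Bessel's inequality for the trace of `T = s²`. -/
theorem sum_norm_sq_apply_le {T s : Mode →L[ℂ] Mode} {t : ℝ}
    (hs : ∀ x y, ⟪s x, y⟫_ℂ = ⟪x, s y⟫_ℂ) (hsT : ∀ x, s (s x) = T x)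
    (ht : HasSum (fun n => (fockMatrix T n n).re) t) {ι : Type*} [Fintype ι] {f : ι → Mode}
    (hf : Orthonormal ℂ f) : ∑ i, ‖s (f i)‖ ^ 2 ≤ t := by
  have h1 : HasSum (fun n => ∑ i, ‖⟪ket n, s (f i)⟫_ℂ‖ ^ 2) (∑ i, ‖s (f i)‖ ^ 2) :=
    hasSum_sum fun i _ => hasSum_norm_inner_ket_sq (s (f i))
  refine hasSum_le (fun n => ?_) h1 ht
  rw [fockMatrix_diag_eq_norm_sq hs hsT]
  have h2 := hf.sum_inner_products_le (s (ket n)) (s := Finset.univ)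
  refine le_of_eq_of_le (Finset.sum_congr rfl fun i _ => ?_) h2
  rw [← hs, norm_inner_symm]

theorem ContinuousLinearMap.IsPositive.norm_le_trace {T : Mode →L[ℂ] Mode} (hT : T.IsPositive)
    {t : ℝ} (ht : HasSum (fun n => (fockMatrix T n n).re) t) : ‖T‖ ≤ t := by
  obtain ⟨s, hs, hsT⟩ := hT.exists_sqrt
  have ht0 : 0 ≤ t := ht.nonneg fun n => by
    rw [fockMatrix_diag_eq_norm_sq hs hsT]; positivity
  have hsn : ‖s‖ ≤ √t := by
    refine s.opNorm_le_bound (Real.sqrt_nonneg t) fun x => ?_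
    have h2 : ‖s x‖ ^ 2 ≤ t * ‖x‖ ^ 2 := by
      refine hasSum_le (fun n => ?_) (hasSum_norm_inner_ket_sq (s x)) (ht.mul_right (‖x‖ ^ 2))
      rw [fockMatrix_diag_eq_norm_sq hs hsT, ← hs, ← mul_pow]
      exact pow_le_pow_left₀ (norm_nonneg _) (norm_inner_le_norm _ _) 2
    have h3 : ‖s x‖ ^ 2 ≤ (√t * ‖x‖) ^ 2 := by rwa [mul_pow, Real.sq_sqrt ht0]
    exact le_of_sq_le_sq h3 (by positivity)
  refine T.opNorm_le_bound ht0 fun x => ?_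
  rw [← hsT]
  calc ‖s (s x)‖ ≤ ‖s‖ * (‖s‖ * ‖x‖) :=
        (s.le_opNorm _).trans (mul_le_mul_of_nonneg_left (s.le_opNorm x) (norm_nonneg _))
    _ ≤ √t * (√t * ‖x‖) := by gcongr
    _ = t * ‖x‖ := by rw [← mul_assoc, Real.mul_self_sqrt ht0]

/-! ### The entropy of a state as a limit over corners -/

theorem entropyOperator_isPositive {ρ : Mode →L[ℂ] Mode} (hρ : IsState ρ) :
    (entropyOperator ρ).IsPositive :=
  hρ.isPositive.entropyOperator_of_norm_le_one (hρ.isPositive.norm_le_trace hρ.hasSum_re)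

theorem re_fockMatrix_entropyOperator_nonneg {ρ : Mode →L[ℂ] Mode} (hρ : IsState ρ) (n : ℕ) :
    0 ≤ (fockMatrix (entropyOperator ρ) n n).re :=
  (entropyOperator_isPositive hρ).re_inner_nonneg_right (ket n)

section
variable {ρ : Mode →L[ℂ] Mode} {K : ℕ}

theorem norm_embed_col {U : Matrix (Fin K) (Fin K) ℂ} (hU : Uᴴ * U = 1) (j : Fin K) :
    ‖embed fun k => U k j‖ = 1 := by
  have h := inner_embed_col 1 U j j
  have h1 : corner K (fockMatrix 1) = 1 := by
    ext a b
    simp [corner, fockMatrix, inner_ket_ket, Matrix.one_apply, Fin.ext_iff]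
  rw [h1, mul_one, hU, Matrix.one_apply_eq, one_apply_eq_self,
    inner_self_eq_norm_sq_to_K, ← RCLike.ofReal_pow] at h
  have h2 : ‖embed fun k => U k j‖ ^ 2 = 1 := Complex.ofReal_eq_one.1 h
  nlinarith [norm_nonneg (embed fun k => U k j)]

theorem sum_re_inner_embed_col {U : Matrix (Fin K) (Fin K) ℂ} (hU : Uᴴ * U = 1)
    (T : Mode →L[ℂ] Mode) : ∑ j, (⟪embed fun k => U k j, T (embed fun k => U k j)⟫_ℂ).re =
      ∑ n ∈ Finset.range K, (fockMatrix T n n).re := by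
  rw [← re_trace_corner, ← trace_conjTranspose_conj hU, Matrix.trace, Complex.re_sum]
  exact Finset.sum_congr rfl fun j _ => by rw [inner_embed_col]; rfl

/-- Peierls' inequality for the compression to the first `K` Fock states. -/
theorem sum_re_entropyOperator_le (hρ : ρ.IsPositive) (K : ℕ) :
    ∑ n ∈ Finset.range K, (fockMatrix (entropyOperator ρ) n n).re ≤
      matEntropy (corner K (fockMatrix ρ)) := by
  obtain ⟨U, a, hU, ha, hd⟩ := (fockMatrix_isPosKernel hρ K).exists_eq_conj_diagonal
  rw [← sum_re_inner_embed_col hU, hd, matEntropy_conj_diagonal hU]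
  refine Finset.sum_le_sum fun j _ => ?_
  refine (re_inner_entropyOperator_le hρ (norm_embed_col hU j)).trans (le_of_eq ?_)
  rw [inner_embed_col, hd, conjTranspose_mul_conj_mul hU, Matrix.diagonal_apply_eq,
    Complex.ofReal_re]

/-- The homogeneous entropy of a corner is at most the entropy of the state. With `φ_j`, `a_j` the
eigenvectors and eigenvalues of the corner and `w = ∑ a_j`, the bound on `⟨φ_j| -ρ ln ρ |φ_j⟩` in
`le_re_inner_entropyOperator` at `b = a_j / w` is summed; the second order terms are controlled by
Bessel's inequality, as the vectors `ρ^{1/2} φ_j / √a_j` are orthonormal. -/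
theorem homEntropy_corner_le_sum (hρ : IsState ρ) (K : ℕ) :
    homEntropy (corner K (fockMatrix ρ)) ≤
      ∑ n ∈ Finset.range K, (fockMatrix (entropyOperator ρ) n n).re := by
  obtain ⟨U, a, hU, ha, hd⟩ := (fockMatrix_isPosKernel hρ.isPositive K).exists_eq_conj_diagonal
  set φ : Fin K → Mode := fun j => embed fun k => U k j with hφ
  have hin : ∀ i j, ⟪φ i, ρ (φ j)⟫_ℂ = if i = j then (a j : ℂ) else 0 := by
    intro i j
    rw [hφ, inner_embed_col, hd, conjTranspose_mul_conj_mul hU, Matrix.diagonal_apply]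
    split_ifs with h
    · rw [h]
    · rfl
  have htr : (corner K (fockMatrix ρ)).trace.re = ∑ j, a j := by
    rw [hd, Matrix.trace_mul_comm, ← mul_assoc, hU, one_mul]
    simp [Matrix.trace]
  set w := ∑ j, a j with hw
  have hw0 : 0 ≤ w := Finset.sum_nonneg fun j _ => ha j
  rw [homEntropy, htr, hd, matEntropy_conj_diagonal hU, ← sum_re_inner_embed_col hU]
  obtain ⟨s, hs, hsρ⟩ := hρ.isPositive.exists_sqrt
  have hbessel : ∑ j, (a j)⁻¹ * ‖ρ (φ j)‖ ^ 2 ≤ 1 := by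
    set f : {j : Fin K // a j ≠ 0} → Mode := fun j => ((√(a j))⁻¹ : ℂ) • s (φ j) with hf
    have hort : Orthonormal ℂ f := by
      rw [orthonormal_iff_ite]
      intro i j
      have hi : (√(a i) : ℂ) ≠ 0 := by
        exact_mod_cast (Real.sqrt_ne_zero'.2 ((ha i).lt_of_ne' i.2))
      simp only [hf]
      rw [inner_smul_left, inner_smul_right, hs, hsρ, hin]
      by_cases hij : i = j
      · subst hij
        have hsq : (a i : ℂ) = (√(a i) : ℂ) * (√(a i) : ℂ) := by
          exact_mod_cast (Real.mul_self_sqrt (ha i)).symm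
        simp only [if_true]
        rw [hsq, map_inv₀, Complex.conj_ofReal]
        field_simp
      · have : ¬ (i : Fin K) = j := fun h => hij (Subtype.ext h)
        simp [hij, this]
    refine le_trans (le_of_eq ?_) (sum_norm_sq_apply_le hs hsρ hρ.hasSum_re hort)
    have h1 : ∀ j : {j : Fin K // a j ≠ 0}, ‖s (f j)‖ ^ 2 = (a j)⁻¹ * ‖ρ (φ j)‖ ^ 2 := by
      intro j
      simp only [hf]
      rw [map_smul, hsρ, norm_smul, mul_pow, norm_inv, Complex.norm_real, inv_pow,
        Real.norm_of_nonneg (Real.sqrt_nonneg _), Real.sq_sqrt (ha j)]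
    rw [Finset.sum_congr rfl fun j _ => h1 j]
    rw [← Finset.sum_filter_of_ne (p := fun j => a j ≠ 0)]
    · exact Finset.sum_subtype _ (by simp) _
    · intro j _ hj h
      rw [h] at hj
      simp at hj
  have hterm : ∀ j, Real.negMulLog (a j) + a j * Real.log w + a j -
      w * ((a j)⁻¹ * ‖ρ (φ j)‖ ^ 2) ≤ (⟪φ j, entropyOperator ρ (φ j)⟫_ℂ).re := by
    intro j
    rcases (ha j).eq_or_lt with h | h
    · rw [← h]
      simpa using (entropyOperator_isPositive hρ).re_inner_nonneg_right (φ j)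
    · have hwpos : 0 < w := h.trans_le (Finset.single_le_sum (fun i _ => ha i) (Finset.mem_univ j))
      refine le_trans (le_of_eq ?_)
        (le_re_inner_entropyOperator hρ.isPositive (φ j) (b := a j / w) (by positivity))
      rw [hin, if_pos rfl, Complex.ofReal_re, Real.log_div h.ne' hwpos.ne', inv_div,
        Real.negMulLog]
      field_simp
      ring
  refine le_trans ?_ (Finset.sum_le_sum fun j _ => hterm j)
  rw [Finset.sum_sub_distrib, Finset.sum_add_distrib, Finset.sum_add_distrib, ← Finset.sum_mul,
    ← Finset.mul_sum, ← hw]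
  have := mul_le_mul_of_nonneg_left hbessel hw0
  unfold Real.negMulLog at *
  linarith

end

theorem ofReal_homEntropy_corner_le {ρ : Mode →L[ℂ] Mode} (hρ : IsState ρ) (K : ℕ) :
    ENNReal.ofReal (homEntropy (corner K (fockMatrix ρ))) ≤ vonNeumannEntropy ρ := by
  refine (ENNReal.ofReal_le_ofReal (homEntropy_corner_le_sum hρ K)).trans ?_
  rw [ENNReal.ofReal_sum_of_nonneg fun n _ => re_fockMatrix_entropyOperator_nonneg hρ n]
  exact ENNReal.sum_le_tsum _

theorem vonNeumannEntropy_le {ρ : Mode →L[ℂ] Mode} (hρ : IsState ρ) {c : ℝ}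
    (hc : ∀ K, matEntropy (corner K (fockMatrix ρ)) ≤ c) :
    vonNeumannEntropy ρ ≤ ENNReal.ofReal c := by
  refine ENNReal.tsum_le_of_sum_range_le fun K => ?_
  change ∑ n ∈ Finset.range K, ENNReal.ofReal (fockMatrix (entropyOperator ρ) n n).re ≤ _
  rw [← ENNReal.ofReal_sum_of_nonneg fun n _ => re_fockMatrix_entropyOperator_nonneg hρ n]
  exact ENNReal.ofReal_le_ofReal ((sum_re_entropyOperator_le hρ.isPositive K).trans (hc K))

/-- The trace of the corners tends to one, so that in the limit the homogeneous entropy is the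
entropy. -/
theorem exists_lt_homEntropy_corner {ρ : Mode →L[ℂ] Mode} (hρ : IsState ρ) {c : ℝ}
    (hc : ENNReal.ofReal c < vonNeumannEntropy ρ) :
    ∃ K, c < homEntropy (corner K (fockMatrix ρ)) := by
  have hpos := re_fockMatrix_entropyOperator_nonneg hρ
  obtain ⟨c', hc', hcc'⟩ : ∃ c', c < c' ∧ ENNReal.ofReal c' < vonNeumannEntropy ρ := by
    by_contra! h
    refine absurd hc (not_lt.2 ?_)
    have hcont : Tendsto (fun x : ℝ => ENNReal.ofReal x) (𝓝[>] c) (𝓝 (ENNReal.ofReal c)) :=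
      (ENNReal.continuous_ofReal.tendsto c).mono_left nhdsWithin_le_nhds
    exact ge_of_tendsto hcont (by filter_upwards [self_mem_nhdsWithin] with x hx using h x hx)
  obtain ⟨K₀, hK₀⟩ : ∃ K₀, c' < ∑ n ∈ Finset.range K₀, (fockMatrix (entropyOperator ρ) n n).re := by
    by_contra! h
    refine absurd hcc' (not_lt.2 (ENNReal.tsum_le_of_sum_range_le fun K => ?_))
    change ∑ n ∈ Finset.range K, ENNReal.ofReal (fockMatrix (entropyOperator ρ) n n).re ≤ _
    rw [← ENNReal.ofReal_sum_of_nonneg fun n _ => hpos n]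
    exact ENNReal.ofReal_le_ofReal (h K)
  have htr : Tendsto (fun K => Real.negMulLog (corner K (fockMatrix ρ)).trace.re) atTop
      (𝓝 0) := by
    have h1 := hρ.hasSum_re.tendsto_sum_nat
    have h2 := (Real.continuous_negMulLog.tendsto 1).comp h1
    rw [Real.negMulLog_one] at h2
    refine h2.congr fun K => ?_
    rw [Function.comp_apply, re_trace_corner]
  obtain ⟨K, hKe, hK⟩ := ((htr.eventually_lt_const (sub_pos.2 hc')).and
    (eventually_ge_atTop K₀)).exists
  refine ⟨K, ?_⟩
  have h3 := sum_re_entropyOperator_le hρ.isPositive K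
  have h4 := Finset.sum_le_sum_of_subset_of_nonneg (Finset.range_subset_range.2 hK)
    fun n _ _ => hpos n
  unfold homEntropy
  linarith

end

section
open scoped ComplexOrder Topology
open Filter

/-! ### The beam splitter acting on Fock states -/

/-- The amplitude of `|i⟩_A ⊗ |N - i⟩_E` in the image of `|N⟩_A ⊗ |0⟩_E` under the beam splitter. -/
noncomputable def splitAmplitude (N : ℕ) (θ : ℝ) (i : ℕ) : ℝ :=
  √(N.choose i) * Real.cos θ ^ i * (-Real.sin θ) ^ (N - i)

theorem cast_choose_succ_mul {N i : ℕ} (h : i < N) :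
    ((N.choose (i + 1) : ℕ) : ℝ) * (i + 1) = N.choose i * ((N : ℝ) - i) := by
  have h2 : ((N.choose (i + 1) * (i + 1) : ℕ) : ℝ) = (N.choose i * (N - i) : ℕ) := by
    rw [Nat.choose_succ_right_eq N i]
  push_cast [Nat.cast_sub h.le] at h2
  exact h2

theorem sqrt_mul_sqrt_choose_succ {N i : ℕ} (h : i < N) :
    √(((i : ℝ) + 1) * ((N : ℝ) - i)) * √(N.choose i) = (i + 1) * √(N.choose (i + 1)) := by
  rw [← Real.sqrt_mul' _ (Nat.cast_nonneg _)]
  have h3 : ((i : ℝ) + 1) * ((N : ℝ) - i) * N.choose i = ((i : ℝ) + 1) ^ 2 * N.choose (i + 1) := by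
    linear_combination (-((i : ℝ) + 1)) * cast_choose_succ_mul h
  rw [h3, Real.sqrt_mul (by positivity), Real.sqrt_sq (by positivity)]

theorem sqrt_mul_sqrt_choose_self {N i : ℕ} (h : i < N) :
    √(((i : ℝ) + 1) * ((N : ℝ) - i)) * √(N.choose (i + 1)) = ((N : ℝ) - i) * √(N.choose i) := by
  have hi : (0 : ℝ) < (N : ℝ) - i := sub_pos.2 (by exact_mod_cast h)
  rw [← Real.sqrt_mul' _ (Nat.cast_nonneg _)]
  have h3 : ((i : ℝ) + 1) * ((N : ℝ) - i) * N.choose (i + 1) = ((N : ℝ) - i) ^ 2 * N.choose i := by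
    linear_combination ((N : ℝ) - i) * cast_choose_succ_mul h
  rw [h3, Real.sqrt_mul (by positivity), Real.sqrt_sq hi.le]

theorem mixingGenerator_mulVec (N : ℕ) (w : ℕ → ℂ) (i : Fin (N + 1)) :
    (mixingGenerator N).mulVec (fun j => w j) i =
      (if (i : ℕ) = 0 then 0 else
        ((√((((i - 1 : ℕ) : ℝ) + 1) * ((N : ℝ) - ((i - 1 : ℕ) : ℝ))) : ℝ) : ℂ) * w (i - 1)) -
      (if (i : ℕ) = N then 0 else
        ((√(((i : ℝ) + 1) * ((N : ℝ) - i)) : ℝ) : ℂ) * w (i + 1)) := by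
  obtain ⟨i, hi⟩ := i
  have h1 : ∀ j : Fin (N + 1), mixingGenerator N ⟨i, hi⟩ j * w j =
      (if i = j + 1 then ((√(((j : ℝ) + 1) * ((N : ℝ) - j)) : ℝ) : ℂ) * w j else 0) -
      (if (j : ℕ) = i + 1 then ((√(((i : ℝ) + 1) * ((N : ℝ) - i)) : ℝ) : ℂ) * w j else 0) := by
    intro j
    simp only [mixingGenerator, Matrix.of_apply]
    split_ifs with ha hb hb
    · omega
    · ring
    · ring
    · ring
  rw [Matrix.mulVec, dotProduct, Finset.sum_congr rfl fun j _ => h1 j, Finset.sum_sub_distrib,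
    Fin.sum_univ_eq_sum_range (fun j : ℕ =>
      if i = j + 1 then ((√(((j : ℝ) + 1) * ((N : ℝ) - j)) : ℝ) : ℂ) * w j else 0),
    Fin.sum_univ_eq_sum_range (fun j : ℕ =>
      if j = i + 1 then ((√(((i : ℝ) + 1) * ((N : ℝ) - i)) : ℝ) : ℂ) * w j else 0)]
  congr 1
  · rcases i with _ | k
    · simp
    · simp only [Nat.add_right_cancel_iff, Finset.sum_ite_eq, Finset.mem_range]
      rw [if_pos (by omega)]
      simp
  · simp only [Finset.sum_ite_eq', Finset.mem_range]
    by_cases h : i = N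
    · simp [h]
    · rw [if_pos (by omega), if_neg h]

/-- The amplitudes solve the linear differential equation of the beam splitter. -/
theorem hasDerivAt_splitAmplitude (N : ℕ) (θ : ℝ) (i : Fin (N + 1)) :
    HasDerivAt (fun t => ((splitAmplitude N t i : ℝ) : ℂ))
      ((mixingGenerator N).mulVec (fun j => ((splitAmplitude N θ j : ℝ) : ℂ)) i) θ := by
  rw [mixingGenerator_mulVec N (fun j => ((splitAmplitude N θ j : ℝ) : ℂ))]
  obtain ⟨i, hi⟩ := i
  have h1 : HasDerivAt (fun t => splitAmplitude N t i)
      (√(N.choose i) * (i * Real.cos θ ^ (i - 1) * -Real.sin θ) * (-Real.sin θ) ^ (N - i) +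
        √(N.choose i) * Real.cos θ ^ i *
          ((N - i : ℕ) * (-Real.sin θ) ^ (N - i - 1) * -Real.cos θ)) θ :=
    (((Real.hasDerivAt_cos θ).pow i).const_mul _).mul (((Real.hasDerivAt_sin θ).neg).pow (N - i))
  refine h1.ofReal_comp.congr_deriv ?_
  have hA : √(N.choose i) * (i * Real.cos θ ^ (i - 1) * -Real.sin θ) * (-Real.sin θ) ^ (N - i) =
      if i = 0 then 0 else √((((i - 1 : ℕ) : ℝ) + 1) * ((N : ℝ) - ((i - 1 : ℕ) : ℝ))) *
        splitAmplitude N θ (i - 1) := by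
    rcases i with _ | k
    · simp
    · have h2 := sqrt_mul_sqrt_choose_succ (show k < N by omega)
      rw [if_neg (by omega), splitAmplitude, Nat.add_sub_cancel,
        show N - k = N - (k + 1) + 1 by omega, pow_succ]
      push_cast
      linear_combination (Real.cos θ ^ k * (-Real.sin θ) ^ (N - (k + 1)) * Real.sin θ) * h2
  have hB : √(N.choose i) * Real.cos θ ^ i *
      ((N - i : ℕ) * (-Real.sin θ) ^ (N - i - 1) * -Real.cos θ) =
      -(if i = N then 0 else √(((i : ℝ) + 1) * ((N : ℝ) - i)) * splitAmplitude N θ (i + 1)) := by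
    by_cases h : i = N
    · simp [h]
    · have h2 := sqrt_mul_sqrt_choose_self (show i < N by omega)
      rw [if_neg h, splitAmplitude, Nat.sub_sub, Nat.cast_sub (by omega), pow_succ]
      linear_combination (Real.cos θ ^ i * Real.cos θ * (-Real.sin θ) ^ (N - (i + 1))) * h2
  rw [hA, hB]
  simp only
  split_ifs <;> push_cast <;> ring

section
open scoped Matrix.Norms.Operator

/-- The vacuum column of the beam splitter: if `v' = G v`, then `exp (-θ G) v(θ)` is constant. -/
theorem mixingMatrix_apply_last (θ : ℝ) (N : ℕ) (i : Fin (N + 1)) :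
    mixingMatrix θ N i (Fin.last N) = ((splitAmplitude N θ i : ℝ) : ℂ) := by
  set G := mixingGenerator N
  set v : ℝ → Fin (N + 1) → ℂ := fun t j => ((splitAmplitude N t j : ℝ) : ℂ) with hv
  have hM : ∀ (t : ℝ) (a b : Fin (N + 1)),
      HasDerivAt (fun u : ℝ => NormedSpace.exp (u • -G) a b)
        ((NormedSpace.exp (t • -G) * -G) a b) t := by
    intro t a b
    have h := hasDerivAt_exp_smul_const (𝕂 := ℝ) (-G) t
    exact (hasDerivAt_pi.1 ((hasDerivAt_pi.1 h) a)) b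
  have hF : ∀ a t, HasDerivAt (fun u : ℝ => (NormedSpace.exp (u • -G)).mulVec (v u) a) 0 t := by
    intro a t
    have h : HasDerivAt (fun u : ℝ => ∑ b, NormedSpace.exp (u • -G) a b * v u b)
        (∑ b, ((NormedSpace.exp (t • -G) * -G) a b * v t b +
          NormedSpace.exp (t • -G) a b * G.mulVec (v t) b)) t :=
      HasDerivAt.fun_sum fun b _ => (hM t a b).mul (hasDerivAt_splitAmplitude N t b)
    refine h.congr_deriv ?_
    rw [Finset.sum_add_distrib]
    change ((NormedSpace.exp (t • -G) * -G).mulVec (v t)) a +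
      ((NormedSpace.exp (t • -G)).mulVec (G.mulVec (v t))) a = 0
    rw [Matrix.mulVec_mulVec, mul_neg, Matrix.neg_mulVec, Pi.neg_apply, neg_add_cancel]
  have h0 : v 0 = Pi.single (Fin.last N) 1 := by
    ext j
    simp only [hv, splitAmplitude, Real.cos_zero, Real.sin_zero, one_pow, mul_one, neg_zero]
    by_cases h : j = Fin.last N
    · subst h; simp
    · have : (j : ℕ) ≠ N := fun h' => h (Fin.ext h')
      rw [zero_pow (by omega)]
      simp [h]
  have hconst : (NormedSpace.exp (θ • -G)).mulVec (v θ) = Pi.single (Fin.last N) 1 := by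
    ext a
    have h := is_const_of_deriv_eq_zero (fun t => (hF a t).differentiableAt)
      (fun t => (hF a t).deriv) θ 0
    rw [h, zero_smul, NormedSpace.exp_zero, Matrix.one_mulVec, h0]
  have hinv : NormedSpace.exp (θ • G) * NormedSpace.exp (θ • -G) = 1 := by
    rw [← Matrix.exp_add_of_commute]
    · simp
    · exact ((Commute.refl G).neg_right.smul_left θ).smul_right θ
  have h2 := congrArg ((NormedSpace.exp (θ • G)).mulVec ·) hconst
  beta_reduce at h2
  rw [Matrix.mulVec_mulVec, hinv, Matrix.one_mulVec] at h2
  have h3 := congrFun h2 i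
  rw [Matrix.mulVec_single_one, Matrix.col_apply] at h3
  rw [mixingMatrix]
  exact h3.symm

end

theorem inner_beamSplitterKet_ket2 (θ : ℝ) (k m l : ℕ) :
    ⟪beamSplitterKet θ (k, 0), ket2 (m, l)⟫_ℂ =
      if k = m + l then ((splitAmplitude k θ m : ℝ) : ℂ) else 0 := by
  have h : beamSplitterKet θ (k, 0) =
      ∑ i : Fin (k + 1), ((splitAmplitude k θ i : ℝ) : ℂ) • ket2 ((i : ℕ), k - i) := by
    change ∑ i : Fin (k + 1), mixingMatrix θ k i (Fin.last k) • ket2 ((i : ℕ), k - i) = _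
    refine Finset.sum_congr rfl fun i _ => ?_
    exact congrArg (fun c : ℂ => c • ket2 ((i : ℕ), k - i)) (mixingMatrix_apply_last θ k i)
  rw [h, sum_inner]
  have h2 : ∀ i : Fin (k + 1), ⟪((splitAmplitude k θ i : ℝ) : ℂ) • ket2 ((i : ℕ), k - i),
      ket2 (m, l)⟫_ℂ = (fun i : ℕ => if i = m then
        (if k = m + l then ((splitAmplitude k θ m : ℝ) : ℂ) else 0) else 0) i := by
    intro i
    have := i.2
    rw [inner_smul_left, inner_ket2, Complex.conj_ofReal]
    simp only [Prod.mk.injEq]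
    by_cases h1 : (i : ℕ) = m
    · by_cases h3 : k = m + l
      · rw [if_pos ⟨h1, by omega⟩, if_pos h1, if_pos h3, h1, mul_one]
      · rw [if_neg (by omega), if_pos h1, if_neg h3, mul_zero]
    · rw [if_neg (by tauto), if_neg h1, mul_zero]
  rw [Finset.sum_congr rfl fun i _ => h2 i, Fin.sum_univ_eq_sum_range (fun i : ℕ => if i = m then
        (if k = m + l then ((splitAmplitude k θ m : ℝ) : ℂ) else 0) else 0), Finset.sum_ite_eq']
  by_cases h3 : k = m + l
  · rw [if_pos (Finset.mem_range.2 (by omega))]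
  · simp [h3]

end

section
open scoped ComplexOrder Topology
open Filter

/-! ### Series of positive operators -/

theorem HasSum.fockMatrix {ι : Type*} {X : ι → Mode →L[ℂ] Mode} {T : Mode →L[ℂ] Mode}
    (h : HasSum X T) (m n : ℕ) : HasSum (fun l => fockMatrix (X l) m n) (fockMatrix T m n) :=
  (h.mapL (ContinuousLinearMap.apply ℂ Mode (ket n))).mapL (innerSL ℂ (ket m))

theorem HasSum.isPositive {ι : Type*} {X : ι → Mode →L[ℂ] Mode} {T : Mode →L[ℂ] Mode}
    (h : HasSum X T) (hX : ∀ l, (X l).IsPositive) : T.IsPositive := by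
  rw [ContinuousLinearMap.isPositive_iff_complex]
  intro x
  have h1 : HasSum (fun l => ⟪x, X l x⟫_ℂ) ⟪x, T x⟫_ℂ :=
    (h.mapL (ContinuousLinearMap.apply ℂ Mode x)).mapL (innerSL ℂ x)
  have h2 : 0 ≤ ⟪x, T x⟫_ℂ := h1.nonneg fun l => (hX l).inner_nonneg_right x
  have h3 : 0 ≤ ⟪T x, x⟫_ℂ := by
    rw [← inner_conj_symm]
    exact star_nonneg_iff.2 h2
  obtain ⟨h4, h5⟩ := Complex.nonneg_iff.1 h3
  exact ⟨Complex.ext rfl h5, h4⟩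

/-- A series of positive operators whose traces add up to one converges in norm to a state. -/
theorem hasSum_isState {X : ℕ → Mode →L[ℂ] Mode} (hX : ∀ l, (X l).IsPositive)
    (h : HasSum (fun p : ℕ × ℕ => (fockMatrix (X p.2) p.1 p.1).re) 1) :
    HasSum X (∑' l, X l) ∧ IsState (∑' l, X l) := by
  have h' : HasSum (fun p : ℕ × ℕ => (fockMatrix (X p.1) p.2 p.2).re) 1 :=
    (Equiv.prodComm ℕ ℕ).hasSum_iff.2 h
  have hfib : ∀ l, HasSum (fun n => (fockMatrix (X l) n n).re)
      (∑' n, (fockMatrix (X l) n n).re) := fun l => (h'.summable.prod_factor l).hasSum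
  have hsum : Summable X := by
    refine Summable.of_norm_bounded (h'.prod_fiberwise hfib).summable fun l => ?_
    exact (hX l).norm_le_trace (hfib l)
  have hpos := hsum.hasSum.isPositive hX
  refine ⟨hsum.hasSum, hpos, ?_⟩
  have h1 : HasSum (fun n => (fockMatrix (∑' l, X l) n n).re) 1 :=
    h.prod_fiberwise fun n => (hsum.hasSum.fockMatrix n n).mapL Complex.reCLM
  have h2 := h1.mapL Complex.ofRealCLM
  simp only [Complex.ofRealCLM_apply, Complex.ofReal_one] at h2
  refine h2.congr_fun fun n => ?_
  exact (fockMatrix_isPosKernel hpos).diag_eq_re n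

/-! ### The attenuator in the Fock basis -/

/-- The sign `(-1)^l` of the amplitudes cancels in the product. -/
theorem splitAmplitude_arccos {lam : ℝ} (h0 : 0 ≤ lam) (h1 : lam ≤ 1) (m n l : ℕ) :
    splitAmplitude (m + l) (Real.arccos √lam) m * splitAmplitude (n + l) (Real.arccos √lam) n =
      attWeight lam m n l := by
  have hl1 : √lam ≤ 1 := Real.sqrt_le_one.2 h1
  have hl0 := Real.sqrt_nonneg lam
  have hs : Real.sin (Real.arccos √lam) * Real.sin (Real.arccos √lam) = 1 - lam := by
    rw [Real.sin_arccos, Real.sq_sqrt h0, Real.mul_self_sqrt (by linarith)]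
  rw [splitAmplitude, splitAmplitude, attWeight, Real.cos_arccos (by linarith) hl1,
    Nat.add_sub_cancel_left, Nat.add_sub_cancel_left, Nat.choose_symm_add, Nat.choose_symm_add,
    pow_add, ← hs, mul_pow, neg_pow]
  have : ((-1 : ℝ) ^ l) * (-1) ^ l = 1 := by rw [← mul_pow]; simp
  linear_combination (√((m + l).choose l) * √((n + l).choose l) * √lam ^ m * √lam ^ n *
    Real.sin (Real.arccos √lam) ^ l * Real.sin (Real.arccos √lam) ^ l) * this

theorem inner_conj_conj_apply {H K : Type*} [NormedAddCommGroup H] [InnerProductSpace ℂ H]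
    [CompleteSpace H] [NormedAddCommGroup K] [InnerProductSpace ℂ K] [CompleteSpace K]
    (S V : H →L[ℂ] K) (U : K →L[ℂ] K) (T : H →L[ℂ] H) (x y : H) :
    ⟪x, (ContinuousLinearMap.adjoint S ∘L (U ∘L (V ∘L T ∘L ContinuousLinearMap.adjoint V) ∘L
      ContinuousLinearMap.adjoint U) ∘L S) y⟫_ℂ =
    ⟪ContinuousLinearMap.adjoint V (ContinuousLinearMap.adjoint U (S x)),
      T (ContinuousLinearMap.adjoint V (ContinuousLinearMap.adjoint U (S y)))⟫_ℂ := by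
  have h1 := ContinuousLinearMap.adjoint_inner_right S x
    (U (V (T (ContinuousLinearMap.adjoint V (ContinuousLinearMap.adjoint U (S y))))))
  have h2 := ContinuousLinearMap.adjoint_inner_left U
    (V (T (ContinuousLinearMap.adjoint V (ContinuousLinearMap.adjoint U (S y))))) (S x)
  have h3 := ContinuousLinearMap.adjoint_inner_left V
    (T (ContinuousLinearMap.adjoint V (ContinuousLinearMap.adjoint U (S y))))
    (ContinuousLinearMap.adjoint U (S x))
  exact h1.trans (h2.symm.trans h3.symm)

/-- The summand `⟨l|_E U (ρ ⊗ |0⟩⟨0|_E) U† |l⟩_E` of the attenuator, in which `l` photons are lost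
to the environment. -/
noncomputable def attTerm (lam : ℝ) (ρ : Mode →L[ℂ] Mode) (l : ℕ) : Mode →L[ℂ] Mode :=
  (ContinuousLinearMap.adjoint (tensorKet l).toContinuousLinearMap) ∘L
    (beamSplitterOfTransmissivity lam ∘L tensorVacuum ρ ∘L
      ContinuousLinearMap.adjoint (beamSplitterOfTransmissivity lam)) ∘L
    (tensorKet l).toContinuousLinearMap

theorem attTerm_isPositive {ρ : Mode →L[ℂ] Mode} (hρ : ρ.IsPositive) (lam : ℝ) (l : ℕ) :
    (attTerm lam ρ l).IsPositive :=
  ((hρ.conj_adjoint _).conj_adjoint _).adjoint_conj _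

/-- The adjoint Kraus operator `⟨0|_E U† |l⟩_E` adds `l` photons. -/
theorem adjoint_tensorKet_beamSplitter_ket (lam : ℝ) (m l : ℕ) :
    ContinuousLinearMap.adjoint (tensorKet 0).toContinuousLinearMap
      (ContinuousLinearMap.adjoint (beamSplitterOfTransmissivity lam) (tensorKet l (ket m))) =
    ((splitAmplitude (m + l) (Real.arccos √lam) m : ℝ) : ℂ) • ket (m + l) := by
  refine ext_inner_ket fun k => ?_
  rw [ContinuousLinearMap.adjoint_inner_right, ContinuousLinearMap.adjoint_inner_right,
    inner_smul_right, inner_ket_ket]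
  have h1 : beamSplitterOfTransmissivity lam ((tensorKet 0).toContinuousLinearMap (ket k)) =
      beamSplitterKet (Real.arccos √lam) (k, 0) := by
    change beamSplitter (Real.arccos √lam) (tensorKet 0 (ket k)) = _
    rw [tensorKet_ket, beamSplitter_ket2]
  rw [h1, tensorKet_ket, inner_beamSplitterKet_ket2]
  split_ifs with h
  · rw [h, mul_one]
  · rw [mul_zero]

theorem fockMatrix_attTerm {lam : ℝ} (h0 : 0 ≤ lam) (h1 : lam ≤ 1) (ρ : Mode →L[ℂ] Mode)
    (l m n : ℕ) : fockMatrix (attTerm lam ρ l) m n =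
      (attWeight lam m n l : ℂ) * fockMatrix ρ (m + l) (n + l) := by
  have h : fockMatrix (attTerm lam ρ l) m n =
      ⟪ContinuousLinearMap.adjoint (tensorKet 0).toContinuousLinearMap
        (ContinuousLinearMap.adjoint (beamSplitterOfTransmissivity lam) (tensorKet l (ket m))),
      ρ (ContinuousLinearMap.adjoint (tensorKet 0).toContinuousLinearMap
        (ContinuousLinearMap.adjoint (beamSplitterOfTransmissivity lam)
          (tensorKet l (ket n))))⟫_ℂ :=
    inner_conj_conj_apply _ _ _ _ _ _
  rw [h, adjoint_tensorKet_beamSplitter_ket, adjoint_tensorKet_beamSplitter_ket, map_smul,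
    inner_smul_left, inner_smul_right, Complex.conj_ofReal, ← splitAmplitude_arccos h0 h1]
  push_cast
  rw [fockMatrix]
  ring

section
variable {ρ : Mode →L[ℂ] Mode} {lam : ℝ}

theorem hasSum_attTerm (hρ : IsState ρ) (h0 : 0 ≤ lam) (h1 : lam ≤ 1) :
    HasSum (attTerm lam ρ) (attenuator lam ρ) ∧ IsState (attenuator lam ρ) := by
  refine hasSum_isState (attTerm_isPositive hρ.isPositive lam) ?_
  have h := hasSum_thinning (fun n => (Complex.nonneg_iff.1
    ((fockMatrix_isPosKernel hρ.isPositive).diag_nonneg n)).1) hρ.hasSum_re h0 h1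
  refine h.congr_fun ?_
  rintro ⟨m, l⟩
  rw [fockMatrix_attTerm h0 h1, Complex.re_ofReal_mul, attWeight_self h0]

theorem isState_attenuator (hρ : IsState ρ) (h0 : 0 ≤ lam) (h1 : lam ≤ 1) :
    IsState (attenuator lam ρ) := (hasSum_attTerm hρ h0 h1).2

/-- The attenuator acts on matrices in the Fock basis by `attKernel`. -/
theorem fockMatrix_attenuator (hρ : IsState ρ) (h0 : 0 ≤ lam) (h1 : lam ≤ 1) :
    fockMatrix (attenuator lam ρ) = attKernel lam (fockMatrix ρ) := by
  ext m n
  rw [← ((hasSum_attTerm hρ h0 h1).1.fockMatrix m n).tsum_eq, attKernel]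
  simp only [fockMatrix_attTerm h0 h1]

end

/-! ### Thermal states -/

/-- The probability of `n` photons in the thermal state of mean photon number `E`. -/
noncomputable def thermalWeight (E : ℝ) (n : ℕ) : ℝ := 1 / (E + 1) * (E / (E + 1)) ^ n

theorem thermalWeight_nonneg {E : ℝ} (hE : 0 ≤ E) (n : ℕ) : 0 ≤ thermalWeight E n := by
  unfold thermalWeight
  positivity

theorem div_add_one_lt_one {E : ℝ} (hE : 0 ≤ E) : E / (E + 1) < 1 := by
  rw [div_lt_one (by positivity)]
  linarith

theorem hasSum_thermalWeight {E : ℝ} (hE : 0 ≤ E) : HasSum (thermalWeight E) 1 := by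
  have h := (hasSum_geometric_of_lt_one (by positivity) (div_add_one_lt_one hE)).mul_left
    (1 / (E + 1))
  have h2 : 1 / (E + 1) * (1 - E / (E + 1))⁻¹ = 1 := by
    have : 1 - E / (E + 1) = 1 / (E + 1) := by field_simp; ring
    rw [this]
    field_simp
  rwa [h2] at h

theorem fockMatrix_smul_rankOne (c : ℝ) (l m n : ℕ) :
    fockMatrix ((c : ℂ) • InnerProductSpace.rankOne ℂ (ket l) (ket l)) m n =
      if m = l ∧ n = l then (c : ℂ) else 0 := by
  rw [fockMatrix, smul_apply, InnerProductSpace.rankOne_apply, inner_smul_right, inner_smul_right,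
    inner_ket_ket, inner_ket_ket]
  by_cases hm : m = l <;> by_cases hn : n = l <;> simp [hm, hn, Ne.symm]

theorem hasSum_thermalState {E : ℝ} (hE : 0 ≤ E) :
    HasSum (fun n => ((thermalWeight E n : ℝ) : ℂ) • InnerProductSpace.rankOne ℂ (ket n) (ket n))
      (thermalState E) ∧ IsState (thermalState E) := by
  refine hasSum_isState (fun n => ?_) ?_
  · exact (InnerProductSpace.isPositive_rankOne_self (ket n)).smul_of_nonneg
      (Complex.zero_le_real.2 (thermalWeight_nonneg hE n))
  · have hinj : Function.Injective fun n : ℕ => (n, n) := fun a b h => congrArg Prod.fst h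
    refine (hinj.hasSum_iff ?_).1 ?_
    · rintro ⟨m, l⟩ h
      rw [fockMatrix_smul_rankOne, if_neg]
      · rfl
      · rintro ⟨h1, -⟩
        exact h ⟨m, Prod.ext rfl h1⟩
    · refine (hasSum_thermalWeight hE).congr_fun fun n => ?_
      rw [Function.comp_apply, fockMatrix_smul_rankOne, if_pos ⟨rfl, rfl⟩, Complex.ofReal_re]

theorem isState_thermalState {E : ℝ} (hE : 0 ≤ E) : IsState (thermalState E) :=
  (hasSum_thermalState hE).2

theorem fockMatrix_thermalState {E : ℝ} (hE : 0 ≤ E) (m n : ℕ) :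
    fockMatrix (thermalState E) m n = if m = n then (thermalWeight E n : ℂ) else 0 := by
  rw [← ((hasSum_thermalState hE).1.fockMatrix m n).tsum_eq, tsum_eq_single n]
  · simp only [fockMatrix_smul_rankOne, and_true]
  · intro l hl
    rw [fockMatrix_smul_rankOne, if_neg]
    rintro ⟨-, h⟩
    exact hl h.symm

/-- The attenuator maps thermal states to thermal states, multiplying the mean photon number by
`lam`. -/
theorem attenuator_thermalState {E lam : ℝ} (hE : 0 ≤ E) (h0 : 0 ≤ lam) (h1 : lam ≤ 1) :
    attenuator lam (thermalState E) = thermalState (lam * E) := by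
  refine ContinuousLinearMap.ext_fockMatrix ?_
  rw [fockMatrix_attenuator (isState_thermalState hE) h0 h1]
  ext m n
  rw [fockMatrix_thermalState (mul_nonneg h0 hE), attKernel]
  by_cases hmn : m = n
  · subst hmn
    rw [if_pos rfl]
    have hE1 : 0 < E + 1 := by positivity
    have hx0 : 0 ≤ (1 - lam) * (E / (E + 1)) := mul_nonneg (by linarith) (by positivity)
    have hx1 : |(1 - lam) * (E / (E + 1))| < 1 := by
      rw [abs_of_nonneg hx0]
      have := div_add_one_lt_one hE
      have h2 : (1 - lam) * (E / (E + 1)) ≤ 1 * (E / (E + 1)) :=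
        mul_le_mul_of_nonneg_right (by linarith) (by positivity)
      linarith
    have hs := (hasSum_choose_mul_pow hx1 m).mul_left
      (lam ^ m * (1 / (E + 1) * (E / (E + 1)) ^ m))
    have hval : lam ^ m * (1 / (E + 1) * (E / (E + 1)) ^ m) *
        (1 / (1 - (1 - lam) * (E / (E + 1))) ^ (m + 1)) = thermalWeight (lam * E) m := by
      have h3 : 0 < lam * E + 1 := by positivity
      have h2 : 1 - (1 - lam) * (E / (E + 1)) = (lam * E + 1) / (E + 1) := by field_simp; ring
      rw [h2, thermalWeight]
      simp only [div_pow, mul_pow, pow_succ]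
      field_simp
    rw [hval] at hs
    rw [← (Complex.hasSum_ofReal.2 hs).tsum_eq]
    refine tsum_congr fun l => ?_
    rw [fockMatrix_thermalState hE, if_pos rfl, attWeight_self h0, thermalWeight, mul_pow, pow_add]
    push_cast
    ring
  · rw [if_neg hmn]
    refine (tsum_congr fun l => ?_).trans tsum_zero
    rw [fockMatrix_thermalState hE, if_neg (by omega), mul_zero]

theorem corner_thermalState {E : ℝ} (hE : 0 ≤ E) (K : ℕ) :
    corner K (fockMatrix (thermalState E)) =
      Matrix.diagonal fun i : Fin K => ((thermalWeight E i : ℝ) : ℂ) := by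
  ext i j
  rw [corner, Matrix.of_apply, fockMatrix_thermalState hE, Matrix.diagonal_apply]
  simp only [Fin.ext_iff]
  split_ifs with h
  · rw [h]
  · rfl

theorem hasSum_negMulLog_thermalWeight {E : ℝ} (hE : 0 ≤ E) :
    HasSum (fun n => Real.negMulLog (thermalWeight E n)) (gReal E) := by
  rcases hE.eq_or_lt with rfl | hE'
  · rw [gReal_zero]
    refine hasSum_zero.congr_fun fun n => ?_
    rcases n with _ | n <;> simp [thermalWeight]
  · have hq := div_add_one_lt_one hE
    have hq0 : 0 < E / (E + 1) := by positivity
    have h1 := (hasSum_thermalWeight hE).mul_left (Real.log (E + 1))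
    have h2 := ((hasSum_coe_mul_geometric_of_norm_lt_one (r := E / (E + 1))
      (by rwa [Real.norm_of_nonneg hq0.le])).mul_left
      (1 / (E + 1))).mul_left (Real.log (E + 1) - Real.log E)
    have h3 := h1.add h2
    have hval : Real.log (E + 1) * 1 + (Real.log (E + 1) - Real.log E) *
        (1 / (E + 1) * (E / (E + 1) / (1 - E / (E + 1)) ^ 2)) = gReal E := by
      have : 1 - E / (E + 1) = 1 / (E + 1) := by field_simp; ring
      rw [this, gReal]
      field_simp
      ring
    rw [hval] at h3
    refine h3.congr_fun fun n => ?_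
    rw [Real.negMulLog]
    have hlog : Real.log (thermalWeight E n) =
        -Real.log (E + 1) + n * (Real.log E - Real.log (E + 1)) := by
      rw [thermalWeight, Real.log_mul (by positivity) (by positivity), Real.log_pow,
        Real.log_div hE'.ne' (by positivity), one_div, Real.log_inv]
    rw [hlog, thermalWeight]
    ring

theorem thermalWeight_le_one {E : ℝ} (hE : 0 ≤ E) (n : ℕ) : thermalWeight E n ≤ 1 :=
  (hasSum_thermalWeight hE).tsum_eq ▸
    (hasSum_thermalWeight hE).summable.le_tsum n fun k _ => thermalWeight_nonneg hE k

theorem matEntropy_corner_thermalState {E : ℝ} (hE : 0 ≤ E) (K : ℕ) :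
    matEntropy (corner K (fockMatrix (thermalState E))) =
      ∑ n ∈ Finset.range K, Real.negMulLog (thermalWeight E n) := by
  rw [corner_thermalState hE, matEntropy_diagonal,
    Fin.sum_univ_eq_sum_range (fun n => Real.negMulLog (thermalWeight E n))]

theorem vonNeumannEntropy_thermalState {E : ℝ} (hE : 0 ≤ E) :
    vonNeumannEntropy (thermalState E) = ENNReal.ofReal (gReal E) := by
  have hst := isState_thermalState hE
  have hs := hasSum_negMulLog_thermalWeight hE
  refine le_antisymm (vonNeumannEntropy_le hst fun K => ?_) ?_
  · rw [matEntropy_corner_thermalState hE]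
    exact sum_le_hasSum _ (fun n _ => Real.negMulLog_nonneg (thermalWeight_nonneg hE n)
      (thermalWeight_le_one hE n)) hs
  · have h1 := hs.tendsto_sum_nat.sub ((Real.continuous_negMulLog.tendsto 1).comp
      hst.hasSum_re.tendsto_sum_nat)
    rw [Real.negMulLog_one, sub_zero] at h1
    refine le_of_tendsto ((ENNReal.continuous_ofReal.tendsto _).comp h1)
      (Eventually.of_forall fun K => ?_)
    refine le_trans (le_of_eq ?_) (ofReal_homEntropy_corner_le hst K)
    rw [homEntropy, matEntropy_corner_thermalState hE, re_trace_corner]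
    rfl

end

section
open scoped Topology
open Filter

/-! ### Output entropy of the attenuator -/

theorem gFun_gInv (s : ℝ≥0∞) : gFun (gInv s) = s :=
  (Equiv.ofBijective gFun bijective_gFun).apply_symm_apply s

theorem gInv_gFun (x : ℝ≥0∞) : gInv (gFun x) = x :=
  (Equiv.ofBijective gFun bijective_gFun).symm_apply_apply x

theorem gFun_ofReal {x : ℝ} (hx : 0 ≤ x) : gFun (ENNReal.ofReal x) = ENNReal.ofReal (gReal x) := by
  rw [gFun, if_neg ENNReal.ofReal_ne_top, ENNReal.toReal_ofReal hx]

/-- The entropy inequality at real arguments, for an output of finite entropy. -/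
theorem gReal_le_toReal_vonNeumannEntropy_attenuator {lam y : ℝ} {ρ : Mode →L[ℂ] Mode}
    (hρ : IsState ρ) (h0 : 0 < lam) (h1 : lam ≤ 1)
    (hfin : vonNeumannEntropy (attenuator lam ρ) ≠ ∞) (hy : 0 ≤ y)
    (hlt : ENNReal.ofReal (gReal y) < vonNeumannEntropy ρ) :
    gReal (lam * y) ≤ (vonNeumannEntropy (attenuator lam ρ)).toReal := by
  obtain ⟨L, hL⟩ := exists_lt_homEntropy_corner hρ hlt
  refine gReal_le_of_homEntropy_corner (fockMatrix_isPosKernel hρ.isPositive) hρ.hasSum_re h0 h1 hy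
    hL fun K => ?_
  rw [← fockMatrix_attenuator hρ h0.le h1]
  exact (ENNReal.ofReal_le_iff_le_toReal hfin).1
    (ofReal_homEntropy_corner_le (isState_attenuator hρ h0.le h1) K)

/-- The lower bound on the output entropy, as the limit of the strict inequality in
`gReal_le_toReal_vonNeumannEntropy_attenuator`. -/
theorem gFun_mul_gInv_le {lam : ℝ} {ρ : Mode →L[ℂ] Mode} (hρ : IsState ρ) (h0 : 0 ≤ lam)
    (h1 : lam ≤ 1) : gFun (ENNReal.ofReal lam * gInv (vonNeumannEntropy ρ)) ≤
      vonNeumannEntropy (attenuator lam ρ) := by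
  rcases h0.eq_or_lt with rfl | h0
  · rw [ENNReal.ofReal_zero, zero_mul, ← ENNReal.ofReal_zero, gFun_ofReal le_rfl, gReal_zero,
      ENNReal.ofReal_zero]
    exact zero_le
  by_cases hfin : vonNeumannEntropy (attenuator lam ρ) = ∞
  · rw [hfin]
    exact le_top
  have key := fun y => gReal_le_toReal_vonNeumannEntropy_attenuator (y := y) hρ h0 h1 hfin
  set S := (vonNeumannEntropy (attenuator lam ρ)).toReal
  have hS0 : 0 ≤ S := ENNReal.toReal_nonneg
  obtain ⟨x, hx⟩ : ∃ x, gInv (vonNeumannEntropy ρ) = x := ⟨_, rfl⟩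
  have hgx : vonNeumannEntropy ρ = gFun x := by rw [← hx, gFun_gInv]
  rw [hx]
  by_cases hxtop : x = ∞
  · -- the output entropy exceeds `gReal (lam * y)` for all `y`, which is unbounded
    exfalso
    have hy := key (Real.exp S / lam) (by positivity)
      (by rw [hgx, hxtop, gFun, if_pos rfl]; exact ENNReal.ofReal_lt_top)
    rw [mul_div_cancel₀ _ h0.ne'] at hy
    have h2 := (log_le_gReal (Real.exp_pos S).le).trans hy
    have h3 := Real.log_lt_log (Real.exp_pos S) (lt_add_one (Real.exp S))
    rw [Real.log_exp] at h3
    linarith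
  · lift x to NNReal using hxtop
    have hx0 : (0 : ℝ) ≤ x := x.coe_nonneg
    rw [← ENNReal.ofReal_coe_nnreal, ← ENNReal.ofReal_mul h0.le,
      gFun_ofReal (mul_nonneg h0.le hx0), ENNReal.ofReal_le_iff_le_toReal hfin]
    rw [← ENNReal.ofReal_coe_nnreal, gFun_ofReal hx0] at hgx
    rcases hx0.eq_or_lt with h | h
    · rw [← h, mul_zero, gReal_zero]
      exact hS0
    · have hcont : Tendsto (fun y => gReal (lam * y)) (𝓝[<] (x : ℝ)) (𝓝 (gReal (lam * x))) :=
        ((continuous_gReal.comp (continuous_const_mul lam)).tendsto _).mono_left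
          nhdsWithin_le_nhds
      refine le_of_tendsto hcont ?_
      filter_upwards [Ioo_mem_nhdsLT h] with y hy
      refine key y hy.1.le ?_
      have hlt : gReal y < gReal x := strictMonoOn_gReal hy.1.le hx0 hy.2
      rw [hgx]
      exact (ENNReal.ofReal_lt_ofReal_iff ((gReal_nonneg hy.1.le).trans_lt hlt)).2 hlt

end

theorem mainTheorem3 (lam : ℝ) (h0 : 0 ≤ lam) (h1 : lam ≤ 1) :
    (∀ ρ : Mode →L[ℂ] Mode, IsState ρ →
      IsState (attenuator lam ρ) ∧
      gFun (ENNReal.ofReal lam * gInv (vonNeumannEntropy ρ)) ≤ vonNeumannEntropy (attenuator lam ρ)) ∧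
    (∀ E : ℝ, 0 ≤ E →
      IsState (thermalState E) ∧
      vonNeumannEntropy (thermalState E) = gFun (ENNReal.ofReal E) ∧
      vonNeumannEntropy (attenuator lam (thermalState E)) =
        gFun (ENNReal.ofReal lam * gInv (vonNeumannEntropy (thermalState E))) ∧
      ∀ ρ : Mode →L[ℂ] Mode, IsState ρ →
        vonNeumannEntropy ρ = vonNeumannEntropy (thermalState E) →
        vonNeumannEntropy (attenuator lam (thermalState E)) ≤
          vonNeumannEntropy (attenuator lam ρ)) := by
  refine ⟨fun ρ hρ => ⟨isState_attenuator hρ h0 h1, gFun_mul_gInv_le hρ h0 h1⟩, fun E hE => ?_⟩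
  have hS : vonNeumannEntropy (thermalState E) = gFun (ENNReal.ofReal E) := by
    rw [vonNeumannEntropy_thermalState hE, gFun_ofReal hE]
  have hout : vonNeumannEntropy (attenuator lam (thermalState E)) =
      gFun (ENNReal.ofReal lam * gInv (vonNeumannEntropy (thermalState E))) := by
    rw [attenuator_thermalState hE h0 h1, vonNeumannEntropy_thermalState (mul_nonneg h0 hE), hS,
      gInv_gFun, ← ENNReal.ofReal_mul h0, gFun_ofReal (mul_nonneg h0 hE)]
  refine ⟨isState_thermalState hE, hS, hout, fun ρ hρ h => ?_⟩
  rw [hout, ← h]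
  exact gFun_mul_gInv_le hρ h0 h1
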